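/- **Theorem.** Let $\Lambda$ be a (nonempty) directed preordered set and let $\{(X_\lambda,v_{\lambda\mu})\}_{\lambda\in\Lambda}$ be an inverse system of ringed spaces, with transition morphisms $v_{\lambda\mu}\colon X_\mu\to X_\lambda$ for $\lambda\le\mu$, such that the underlying space of every $X_\lambda$ is spectral and the underlying map of every $v_{\lambda\mu}$ is quasi-compact (preimages of quasi-compact open sets are quasi-compact). Let $X=\varprojlim_\lambda X_\lambda$ be the limit in the category of ringed spaces, with projections $v_\lambda\colon X\to X_\lambda$. For every $\lambda$ let $\mathscr F_\lambda$ be an $\mathcal O_{X_\lambda}$-module, and for every $\lambda\le\mu$ let $\varphi_{\lambda\mu}\colon v_{\lambda\mu}^*\mathscr F_\lambda\to\mathscr F_\mu$ be a morphism of $\mathcal O_{X_\mu}$-modules such that $\varphi_{\lambda\lambda}=\mathrm{id}$ and $\varphi_{\lambda\nu}=\varphi_{\mu\nu}\circ v_{\mu\nu}^*\varphi_{\lambda\mu}$ for $\lambda\le\mu\le\nu$. Put $\mathscr F=\varinjlim_\lambda v_\lambda^*\mathscr F_\lambda$, an $\mathcal O_X$-module. Let $U\subseteq X$ be a quasi-compact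 open subset, and let $Z\subseteq U$ be a subset that is closed in $U$ and such that $U-Z$ is quasi-compact. For an open subset $W$ of a ringed space $Y$, a subset $T\subseteq W$ closed in $W$, and an $\mathcal O_Y$-module $\mathscr G$, let $\Gamma_T(Y,\mathscr G)=\ker(\mathscr G(W)\to\mathscr G(W-T))$, and let $H^i_T(Y,\mathscr G)$ be the value at $\mathscr G$ of the $i$-th right derived functor of $\Gamma_T(Y,-)$ on sheaves of abelian groups. 1. There exist an index $\alpha\in\Lambda$, a quasi-compact open subset $U_\alpha\subseteq X_\alpha$, and a subset $Z_\alpha\subseteq U_\alpha$, closed in $U_\alpha$, such that $U_\alpha-Z_\alpha$ is quasi-compact, $U=v_\alpha^{-1}(U_\alpha)$ and $Z=v_\alpha^{-1}(Z_\alpha)$. 2. Let $A$ be a ring with ring homomorphisms $A\to\Gamma(X_\lambda,\mathcal O_{X_\lambda})$, $\lambda\in\Lambda$, compatible with the maps $\Gamma(X_\lambda,\mathcal O_{X_\lambda})\to\Gamma(X_\mu,\mathcal O_{X_\mu})$ for all $\lambda\le\mu$; these make the local cohomology groups below $A$-modules. Let $\alpha$, $U_\alpha$, $Z_\alpha$ be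 any data as in (1), and for $\lambda\ge\alpha$ set $U_\lambda=v_{\alpha\lambda}^{-1}(U_\alpha)$ and $Z_\lambda=v_{\alpha\lambda}^{-1}(Z_\alpha)$. Then, for all $i\ge 0$, the canonical pullback maps $H^i_{Z_\lambda}(X_\lambda,\mathscr F_\lambda)\to H^i_{Z_\mu}(X_\mu,\mathscr F_\mu)$ and $H^i_{Z_\lambda}(X_\lambda,\mathscr F_\lambda)\to H^i_Z(X,\mathscr F)$ (for $\alpha\le\lambda\le\mu$) are $A$-linear and form a direct system with a compatible family of maps out of it, and the induced $A$-module homomorphism $$\varinjlim_{\lambda\ge\alpha}H^i_{Z_\lambda}(X_\lambda,\mathscr F_\lambda)\longrightarrow H^i_Z(X,\mathscr F)$$ is an isomorphism. -/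

import Mathlib

universe u w

open CategoryTheory Limits TopologicalSpace Opposite AlgebraicGeometry

noncomputable section

namespace LocalCohomologyLimits

/-! ### Modules on ringed spaces -/

/-- The structure sheaf of a ringed space, as a sheaf of (not necessarily commutative) rings. -/
abbrev structureSheaf (X : RingedSpace.{u}) :
    Sheaf (Opens.grothendieckTopology X.carrier) RingCat.{u} :=
  (sheafCompose _ (forget₂ CommRingCat.{u} RingCat.{u})).obj
    (⟨X.presheaf, X.IsSheaf⟩ : Sheaf (Opens.grothendieckTopology X.carrier) CommRingCat.{u})

/-- The category of `O_X`-modules. -/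
abbrev Modules (X : RingedSpace.{u}) := SheafOfModules.{u} (structureSheaf X)

/-- The morphism of sheaves of rings `O_Y ⟶ f_* O_X` of a morphism `f` of ringed spaces. -/
def comorphism {X Y : RingedSpace.{u}} (f : X ⟶ Y) :
    structureSheaf Y ⟶ ((Opens.map f.hom.base).sheafPushforwardContinuous
      _ _ _).obj (structureSheaf X) where
  hom := Functor.whiskerRight f.hom.c _

/-- The direct image functor `f_*` on modules. -/
def pushforward {X Y : RingedSpace.{u}} (f : X ⟶ Y) : Modules X ⥤ Modules Y :=
  SheafOfModules.pushforward.{u} (comorphism f)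

instance {X Y : RingedSpace.{u}} (f : X ⟶ Y) :
    (PresheafOfModules.pushforward.{u} (F := Opens.map f.hom.base)
      (comorphism f).hom).IsRightAdjoint :=
  Functor.isRightAdjoint_of_leftAdjointObjIsDefined_eq_top
    (PresheafOfModules.pullbackObjIsDefined_eq_top (F := Opens.map f.hom.base) (comorphism f).hom)

instance {X Y : RingedSpace.{u}} (f : X ⟶ Y) : (SheafOfModules.pushforward.{u} (comorphism f)).IsRightAdjoint :=
  (SheafOfModules.PullbackConstruction.adjunction.{u} (comorphism f)).isRightAdjoint

/-- The inverse image functor `f^*` on modules, the left adjoint of `f_*`. -/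
def pullback {X Y : RingedSpace.{u}} (f : X ⟶ Y) : Modules Y ⥤ Modules X :=
  SheafOfModules.pullback.{u} (comorphism f)

/-- The adjunction between `f^*` and `f_*`. -/
def pullbackAdj {X Y : RingedSpace.{u}} (f : X ⟶ Y) : pullback f ⊣ pushforward f :=
  SheafOfModules.pullbackPushforwardAdjunction.{u} (comorphism f)

/-- The identification `g_* f_* = h_*` for `h = f ≫ g`. -/
def pushforwardComp {X Y Z : RingedSpace.{u}} (f : X ⟶ Y) (g : Y ⟶ Z) (h : X ⟶ Z)
    (e : f ≫ g = h) : pushforward f ⋙ pushforward g ≅ pushforward h :=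
  SheafOfModules.pushforwardComp (comorphism g) (comorphism f) ≪≫ eqToIso (by subst e; rfl)

/-- The identification of `f_*` with the identity functor for `f = 𝟙 X`. -/
def pushforwardId {X : RingedSpace.{u}} (f : X ⟶ X)
    (e : f = 𝟙 X) : pushforward f ≅ 𝟭 (Modules X) :=
  eqToIso (by subst e; rfl) ≪≫ SheafOfModules.pushforwardId (structureSheaf X)

lemma pushforwardComp_app {X Y Z : RingedSpace.{u}} (f : X ⟶ Y) (g : Y ⟶ Z) (M : Modules X) :
    (pushforwardComp f g _ rfl).hom.app M = 𝟙 ((pushforward (f ≫ g)).obj M) := by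
  rfl

lemma pushforwardId_inv_app {X : RingedSpace.{u}} (M : Modules X) :
    (pushforwardId (𝟙 X) rfl).inv.app M = 𝟙 M := by
  rfl

lemma pushforwardComp_assoc {X Y Z W : RingedSpace.{u}} (f : X ⟶ Y) (g : Y ⟶ Z) (h : Z ⟶ W)
    (fg : X ⟶ Z) (gh : Y ⟶ W) (fgh : X ⟶ W) (e₁ : f ≫ g = fg) (e₂ : g ≫ h = gh)
    (e₃ : fg ≫ h = fgh) (e₄ : f ≫ gh = fgh) (M : Modules X) :
    (pushforwardComp g h gh e₂).hom.app ((pushforward f).obj M) ≫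
        (pushforwardComp f gh fgh e₄).hom.app M =
      (pushforward h).map ((pushforwardComp f g fg e₁).hom.app M) ≫
        (pushforwardComp fg h fgh e₃).hom.app M := by
  subst e₁ e₂ e₃
  ext U x
  rfl

lemma pushforwardComp_id {X Y : RingedSpace.{u}} (f : X ⟶ Y) (g : Y ⟶ Y) (hg : g = 𝟙 Y)
    (e : f ≫ g = f) (M : Modules X) :
    (pushforwardId g hg).inv.app ((pushforward f).obj M) ≫
      (pushforwardComp f g f e).hom.app M = 𝟙 _ := by
  subst hg
  ext U x
  rfl

/-- The canonical isomorphism `h^* ≅ f^* g^*` for `h = f ≫ g`, mate of `pushforwardComp`. -/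
def pullbackComp {X Y Z : RingedSpace.{u}} (f : X ⟶ Y) (g : Y ⟶ Z) (h : X ⟶ Z)
    (e : f ≫ g = h) : pullback h ≅ pullback g ⋙ pullback f :=
  (Adjunction.leftAdjointCompIso (pullbackAdj g) (pullbackAdj f) (pullbackAdj h)
    (pushforwardComp f g h e)).symm

/-- The canonical isomorphism of `f^*` with the identity functor for `f = 𝟙 X`. -/
def pullbackId {X : RingedSpace.{u}} (f : X ⟶ X) (e : f = 𝟙 X) :
    pullback f ≅ 𝟭 (Modules X) :=
  (pullbackAdj f).leftAdjointIdIso (pushforwardId f e)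

lemma homEquiv_leftAdjointCompIso_inv {C₀ C₁ C₂ : Type*} [Category* C₀] [Category* C₁] [Category* C₂]
    {F₀₁ : C₀ ⥤ C₁} {F₁₂ : C₁ ⥤ C₂} {F₀₂ : C₀ ⥤ C₂}
    {G₁₀ : C₁ ⥤ C₀} {G₂₁ : C₂ ⥤ C₁} {G₂₀ : C₂ ⥤ C₀}
    (adj₀₁ : F₀₁ ⊣ G₁₀) (adj₁₂ : F₁₂ ⊣ G₂₁) (adj₀₂ : F₀₂ ⊣ G₂₀) (e : G₂₁ ⋙ G₁₀ ≅ G₂₀)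
    (G : C₀) {M : C₁} {F : C₂} (a : F₀₁.obj G ⟶ M) (b : F₁₂.obj M ⟶ F) :
    adj₀₂.homEquiv _ _
        ((Adjunction.leftAdjointCompIso adj₀₁ adj₁₂ adj₀₂ e).inv.app G ≫ F₁₂.map a ≫ b) =
      adj₀₁.homEquiv _ _ a ≫ G₁₀.map (adj₁₂.homEquiv _ _ b) ≫ e.hom.app F := by
  have h := unit_conjugateEquiv (adj₀₁.comp adj₁₂) adj₀₂
    (Adjunction.leftAdjointCompIso adj₀₁ adj₁₂ adj₀₂ e).inv G
  rw [Adjunction.conjugateEquiv_leftAdjointCompIso_inv] at h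
  simp only [Adjunction.homEquiv_unit, Functor.map_comp]
  rw [← reassoc_of% h]
  have h₂ := e.hom.naturality (F₁₂.map a ≫ b)
  simp only [Functor.map_comp, Functor.comp_map] at h₂
  rw [← h₂]
  simp only [Adjunction.comp_unit_app, Category.assoc, ← Functor.map_comp_assoc]
  simp only [← Adjunction.unit_naturality_assoc, Functor.comp_obj, Functor.map_comp, Category.assoc]

lemma homEquiv_pullbackComp {X Y Z : RingedSpace.{u}} (f : X ⟶ Y) (g : Y ⟶ Z) (h : X ⟶ Z)
    (e : f ≫ g = h) (G : Modules Z) {M : Modules Y} {F : Modules X}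
    (a : (pullback g).obj G ⟶ M) (b : (pullback f).obj M ⟶ F) :
    (pullbackAdj h).homEquiv _ _ ((pullbackComp f g h e).hom.app G ≫ (pullback f).map a ≫ b) =
      (pullbackAdj g).homEquiv _ _ a ≫ (pushforward g).map ((pullbackAdj f).homEquiv _ _ b) ≫
        (pushforwardComp f g h e).hom.app F := by
  exact homEquiv_leftAdjointCompIso_inv (pullbackAdj g) (pullbackAdj f) (pullbackAdj h)
    (pushforwardComp f g h e) G a b

lemma homEquiv_leftAdjointIdIso_hom {C : Type*} [Category* C] {F G : C ⥤ C} (adj : F ⊣ G)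
    (e : G ≅ 𝟭 C) (M : C) :
    adj.homEquiv M M ((adj.leftAdjointIdIso e).hom.app M) = e.inv.app M := by
  have h := unit_conjugateEquiv .id adj (adj.leftAdjointIdIso e).hom M
  rw [Adjunction.conjugateEquiv_leftAdjointIdIso_hom] at h
  rw [Adjunction.homEquiv_unit]
  exact h.symm.trans (Category.id_comp _)

lemma homEquiv_pullbackId {X : RingedSpace.{u}} (f : X ⟶ X) (e : f = 𝟙 X) (G : Modules X) :
    (pullbackAdj f).homEquiv G G ((pullbackId f e).hom.app G) =
      (pushforwardId f e).inv.app G :=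
  homEquiv_leftAdjointIdIso_hom (pullbackAdj f) (pushforwardId f e) G

/-! ### Inverse systems of ringed spaces and systems of modules on them -/

section System

variable {L : Type u} [Preorder L]

/-- The transition morphism `v_{lm} : X_m ⟶ X_l`, for `l ≤ m`. -/
def transition (X : Lᵒᵖ ⥤ RingedSpace.{u}) {l m : L} (h : l ≤ m) :
    X.obj (op m) ⟶ X.obj (op l) :=
  X.map (homOfLE h).op

lemma transition_refl (X : Lᵒᵖ ⥤ RingedSpace.{u}) (l : L) :
    transition X (le_refl l) = 𝟙 (X.obj (op l)) :=
  X.map_id (op l)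

lemma transition_trans (X : Lᵒᵖ ⥤ RingedSpace.{u}) {l m n : L} (h : l ≤ m) (h' : m ≤ n) :
    transition X h' ≫ transition X h = transition X (h.trans h') :=
  (X.map_comp (homOfLE h').op (homOfLE h).op).symm

lemma proj_transition {X : Lᵒᵖ ⥤ RingedSpace.{u}} (c : Cone X) {l m : L} (h : l ≤ m) :
    c.π.app (op m) ≫ transition X h = c.π.app (op l) :=
  c.w (homOfLE h).op

lemma pullback_unit {X Y : RingedSpace.{u}} (f : X ⟶ Y) (g : Y ⟶ Y) (hg : g = 𝟙 Y)
    (e : f ≫ g = f) (G : Modules Y) :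
    (pullbackComp f g f e).hom.app G ≫ (pullback f).map ((pullbackId g hg).hom.app G) =
      𝟙 ((pullback f).obj G) := by
  apply ((pullbackAdj f).homEquiv G ((pullback f).obj G)).injective
  have h := homEquiv_pullbackComp f g f e G (M := G) (F := (pullback f).obj G)
    ((pullbackId g hg).hom.app G) (𝟙 ((pullback f).obj G))
  rw [homEquiv_pullbackId, Category.comp_id] at h
  have hn := (pushforwardId g hg).inv.naturality
    ((pullbackAdj f).homEquiv G ((pullback f).obj G) (𝟙 ((pullback f).obj G)))
  rw [Functor.id_map] at hn
  rw [← reassoc_of% hn, pushforwardComp_id f g hg e] at h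
  exact h.trans (Category.comp_id _)

lemma pullback_assoc {X Y Z W : RingedSpace.{u}} (f : X ⟶ Y) (g : Y ⟶ Z) (h : Z ⟶ W)
    (fg : X ⟶ Z) (gh : Y ⟶ W) (fgh : X ⟶ W) (e₁ : f ≫ g = fg) (e₂ : g ≫ h = gh)
    (e₃ : fg ≫ h = fgh) (e₄ : f ≫ gh = fgh) {G : Modules W} {M : Modules Z} {N : Modules Y}
    (a : (pullback h).obj G ⟶ M) (b : (pullback g).obj M ⟶ N) :
    (pullbackComp f gh fgh e₄).hom.app G ≫ (pullback f).map
      ((pullbackComp g h gh e₂).hom.app G ≫ (pullback g).map a ≫ b) =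
    ((pullbackComp fg h fgh e₃).hom.app G ≫ (pullback fg).map a) ≫
      (pullbackComp f g fg e₁).hom.app M ≫ (pullback f).map b := by
  apply ((pullbackAdj fgh).homEquiv G ((pullback f).obj N)).injective
  have h₁ := homEquiv_pullbackComp f gh fgh e₄ G (M := N) (F := (pullback f).obj N)
    ((pullbackComp g h gh e₂).hom.app G ≫ (pullback g).map a ≫ b) (𝟙 ((pullback f).obj N))
  have h₂ := homEquiv_pullbackComp fg h fgh e₃ G (M := M) (F := (pullback f).obj N) a
    ((pullbackComp f g fg e₁).hom.app M ≫ (pullback f).map b ≫ 𝟙 ((pullback f).obj N))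
  rw [homEquiv_pullbackComp g h gh e₂ G a b] at h₁
  rw [homEquiv_pullbackComp f g fg e₁ M b (𝟙 ((pullback f).obj N))] at h₂
  rw [Category.comp_id] at h₁ h₂
  have hn := (pushforwardComp g h gh e₂).hom.naturality
    ((pullbackAdj f).homEquiv N ((pullback f).obj N) (𝟙 ((pullback f).obj N)))
  rw [Category.assoc, h₁, h₂]
  simp only [Category.assoc, Functor.map_comp]
  rw [← pushforwardComp_assoc f g h fg gh fgh e₁ e₂ e₃ e₄, ← reassoc_of% hn]

/-- The compatibilities of a system of modules: `φ_{ll}` is the identity (up to the canonical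
isomorphism) and `φ_{ln} = φ_{mn} ∘ v_{mn}^* φ_{lm}` for `l ≤ m ≤ n`. -/
structure IsModuleSystem (X : Lᵒᵖ ⥤ RingedSpace.{u}) (obj : ∀ l : L, Modules (X.obj (op l)))
    (map : ∀ ⦃l m : L⦄ (h : l ≤ m), (pullback (transition X h)).obj (obj l) ⟶ obj m) : Prop where
  map_refl (l : L) : map (le_refl l) = (pullbackId _ (transition_refl X l)).hom.app (obj l)
  map_trans ⦃l m n : L⦄ (h : l ≤ m) (h' : m ≤ n) :
    map (h.trans h') =
      (pullbackComp (transition X h') (transition X h) (transition X (h.trans h'))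
        (transition_trans X h h')).hom.app (obj l) ≫
      (pullback (transition X h')).map (map h) ≫ map h'

/-- A system of modules on an inverse system `X` of ringed spaces: an `O_{X_l}`-module `F_l` for
every index `l` and compatible morphisms `φ_{lm} : v_{lm}^* F_l ⟶ F_m` for `l ≤ m`. -/
structure ModuleSystem (X : Lᵒᵖ ⥤ RingedSpace.{u}) where
  obj (l : L) : Modules (X.obj (op l))
  map ⦃l m : L⦄ (h : l ≤ m) : (pullback (transition X h)).obj (obj l) ⟶ obj m
  isModuleSystem : IsModuleSystem X obj map

namespace ModuleSystem

variable {X : Lᵒᵖ ⥤ RingedSpace.{u}} (S : ModuleSystem X) (c : Cone X)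

/-- The morphism `v_l^* F_l ≅ v_m^* v_{lm}^* F_l ⟶ v_m^* F_m` induced by `φ_{lm}`, for a cone with
projections `v_l`. -/
def pulledBackMap {l m : L} (h : l ≤ m) :
    (pullback (c.π.app (op l))).obj (S.obj l) ⟶ (pullback (c.π.app (op m))).obj (S.obj m) :=
  (pullbackComp (c.π.app (op m)) (transition X h) (c.π.app (op l))
    (proj_transition c h)).hom.app (S.obj l) ≫ (pullback (c.π.app (op m))).map (S.map h)

lemma pulledBackMap_refl (l : L) : S.pulledBackMap c (le_refl l) = 𝟙 _ := by
  rw [pulledBackMap, S.isModuleSystem.map_refl]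
  exact pullback_unit (c.π.app (op l)) (transition X (le_refl l)) (transition_refl X l)
    (proj_transition c (le_refl l)) (S.obj l)

lemma pulledBackMap_trans {l m n : L} (h : l ≤ m) (h' : m ≤ n) :
    S.pulledBackMap c (l := l) (m := n) (h.trans h') =
      S.pulledBackMap c (l := l) (m := m) h ≫ S.pulledBackMap c (l := m) (m := n) h' := by
  rw [pulledBackMap, pulledBackMap, pulledBackMap, S.isModuleSystem.map_trans h h']
  exact pullback_assoc (c.π.app (op n)) (transition X h') (transition X h)
    (c.π.app (op m)) (transition X (h.trans h')) (c.π.app (op l))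
    (proj_transition c h') (transition_trans X h h')
    (proj_transition c h) (proj_transition c (h.trans h')) (S.map h) (S.map h')

/-- The direct system `l ↦ v_l^* F_l` of modules on the vertex of a cone. -/
def pulledBack : L ⥤ Modules c.pt where
  obj l := (pullback (c.π.app (op l))).obj (S.obj l)
  map i := S.pulledBackMap c (leOfHom i)
  map_id l := S.pulledBackMap_refl c l
  map_comp i j := S.pulledBackMap_trans c (leOfHom i) (leOfHom j)

end ModuleSystem

end System

/-! ### Local cohomology -/

/-- The underlying sheaf of abelian groups of an `O_X`-module. -/
def toAb (X : RingedSpace.{u}) : Modules X ⥤ TopCat.Sheaf AddCommGrpCat.{u} X.carrier :=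
  SheafOfModules.toSheaf (structureSheaf X)

/-- An open subset `U` of `X` together with a subset `Z` of `U` that is closed in `U`. -/
@[ext]
structure SupportPair (X : TopCat.{u}) where
  U : Opens X
  Z : Set X
  subset : Z ⊆ U
  isClosed : IsClosed ((fun x : U => (x : X)) ⁻¹' Z)

namespace SupportPair

variable {X Y : TopCat.{u}}

lemma isOpen_diff (P : SupportPair X) : IsOpen ((P.U : Set X) \ P.Z) := by
  have h := P.U.isOpen.isOpenMap_subtype_val _ P.isClosed.isOpen_compl
  convert h using 1
  ext x
  simp [and_comm]

/-- The open subset `U ∖ Z`. -/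
def compl (P : SupportPair X) : Opens X := ⟨(P.U : Set X) \ P.Z, P.isOpen_diff⟩

lemma compl_le (P : SupportPair X) : P.compl ≤ P.U := fun _ h => h.1

/-- The preimage `(f⁻¹ U, f⁻¹ Z)`. -/
def comap (f : X ⟶ Y) (P : SupportPair Y) : SupportPair X where
  U := (Opens.map f).obj P.U
  Z := f ⁻¹' P.Z
  subset := fun _ h => P.subset h
  isClosed := by
    let g : (Opens.map f).obj P.U → P.U := fun x => ⟨f x.1, x.2⟩
    have hg : Continuous g := by
      apply Continuous.subtype_mk
      exact f.hom.continuous.comp continuous_subtype_val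
    exact P.isClosed.preimage hg

end SupportPair

/-- The functor `Γ_Z(X, -)` for `Z` closed in the open subset `U`: the group of the sections over
`U` whose restriction to `U ∖ Z` is zero. -/
def sectionsWithSupport {X : TopCat.{u}} (P : SupportPair X) :
    TopCat.Sheaf AddCommGrpCat.{u} X ⥤ AddCommGrpCat.{u} where
  obj F := AddCommGrpCat.of (F.obj.map (homOfLE P.compl_le).op).hom.ker
  map {F G} a := AddCommGrpCat.ofHom
    (((a.hom.app (op P.U)).hom.comp (AddSubgroup.subtype _)).codRestrict _ (by
      rintro ⟨s, hs⟩
      have h := ConcreteCategory.congr_hom (a.hom.naturality (homOfLE P.compl_le).op) s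
      rw [AddMonoidHom.mem_ker] at hs ⊢
      refine h.symm.trans ?_
      exact (congrArg (a.hom.app (op P.compl)).hom hs).trans (map_zero _)))
  map_id F := by ext; rfl
  map_comp a b := by ext; rfl

instance {X : TopCat.{u}} (P : SupportPair X) : (sectionsWithSupport P).Additive where
  map_add {F G a b} := by ext; rfl

instance {X Y : TopCat.{u}} (f : X ⟶ Y) :
    (TopCat.Sheaf.pushforward AddCommGrpCat.{u} f).Additive where

instance {X Y : TopCat.{u}} (f : X ⟶ Y) :
    PreservesFiniteLimits (TopCat.Sheaf.pullback AddCommGrpCat.{u} f) :=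
  Functor.sheafPullbackConstruction.preservesFiniteLimits (Opens.map f) AddCommGrpCat.{u}
    (Opens.grothendieckTopology Y) (Opens.grothendieckTopology X)

lemma injective_pushforward {X Y : TopCat.{u}} (f : X ⟶ Y)
    (J : TopCat.Sheaf AddCommGrpCat.{u} X) [Injective J] :
    Injective ((TopCat.Sheaf.pushforward AddCommGrpCat.{u} f).obj J) :=
  Injective.injective_of_adjoint (TopCat.Sheaf.pullbackPushforwardAdjunction AddCommGrpCat.{u} f) J

/-- A morphism from `A` into a complex of injectives extends to any resolution of `A`. -/
lemma exists_lift {C : Type*} [Category* C] [Abelian C] {A : C} (I : InjectiveResolution A)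
    (K : CochainComplex C ℕ) (hK : ∀ n, Injective (K.X n)) (e : A ⟶ K.X 0)
    (he : e ≫ K.d 0 1 = 0) :
    ∃ t : I.cocomplex ⟶ K, I.ι.f 0 ≫ t.f 0 = e := by
  let j : A ⟶ I.cocomplex.X 0 := I.ι.f 0
  have : Mono j := InjectiveResolution.instMonoFNatι I 0
  let t₀ : I.cocomplex.X 0 ⟶ K.X 0 := Injective.factorThru e j
  have ht₀ : I.ι.f 0 ≫ t₀ = e := Injective.comp_factorThru e j
  let t₁ : I.cocomplex.X 1 ⟶ K.X 1 := I.exact₀.descToInjective (t₀ ≫ K.d 0 1)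
    ((Category.assoc _ _ _).symm.trans ((congrArg (· ≫ K.d 0 1) ht₀).trans he))
  have ht₁ : I.cocomplex.d 0 1 ≫ t₁ = t₀ ≫ K.d 0 1 := I.exact₀.comp_descToInjective _ _
  refine ⟨CochainComplex.mkHom _ _ t₀ t₁ ht₁.symm fun n ⟨g, g', w⟩ =>
    ⟨(I.exact_succ n).descToInjective (g' ≫ K.d (n + 1) (n + 2)) (by
      dsimp
      rw [← reassoc_of% w, K.d_comp_d, comp_zero]),
      ((I.exact_succ n).comp_descToInjective _ _).symm⟩, ?_⟩
  simpa using ht₀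

section PullbackMap

variable {X Y : TopCat.{u}} (f : X ⟶ Y)
  {G : TopCat.Sheaf AddCommGrpCat.{u} Y} {F : TopCat.Sheaf AddCommGrpCat.{u} X}
  (a : G ⟶ (TopCat.Sheaf.pushforward AddCommGrpCat.{u} f).obj F)

/-- A morphism `G ⟶ f_* F` extends to injective resolutions, `I ⟶ f_* J`. -/
lemma exists_resolution_lift (I : InjectiveResolution G) (J : InjectiveResolution F) :
    ∃ t : I.cocomplex ⟶ ((TopCat.Sheaf.pushforward AddCommGrpCat.{u} f).mapHomologicalComplex
        (ComplexShape.up ℕ)).obj J.cocomplex,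
      I.ι.f 0 ≫ t.f 0 = a ≫ (TopCat.Sheaf.pushforward AddCommGrpCat.{u} f).map (J.ι.f 0) := by
  refine exists_lift I _ (fun n => injective_pushforward f (J.cocomplex.X n)) _ ?_
  have h := congrArg (TopCat.Sheaf.pushforward AddCommGrpCat.{u} f).map J.ι_f_zero_comp_complex_d
  rw [Functor.map_comp, Functor.map_zero] at h
  exact (Category.assoc _ _ _).trans ((congrArg (a ≫ ·) h).trans comp_zero)

/-- `Γ_Z(Y, f_* -) = Γ_{f⁻¹ Z}(X, -)`. -/
def sectionsComparison (P : SupportPair Y) (Q : SupportPair X) (h : Q = P.comap f) :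
    TopCat.Sheaf.pushforward AddCommGrpCat.{u} f ⋙ sectionsWithSupport P ≅
      sectionsWithSupport Q :=
  eqToIso (by subst h; rfl)

/-- A morphism of complexes `I ⟶ f_* J` extending `a : G ⟶ f_* F`; it is unique up to homotopy. -/
def resolutionLift (I : InjectiveResolution G) (J : InjectiveResolution F) :
    I.cocomplex ⟶ ((TopCat.Sheaf.pushforward AddCommGrpCat.{u} f).mapHomologicalComplex
        (ComplexShape.up ℕ)).obj J.cocomplex :=
  (exists_resolution_lift f a I J).choose

/-- The morphism of complexes `Γ_Z(Y, I) ⟶ Γ_Z(Y, f_* J) = Γ_{f⁻¹ Z}(X, J)`. -/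
def sectionsLift (P : SupportPair Y) (Q : SupportPair X) (h : Q = P.comap f)
   (I : InjectiveResolution G) (J : InjectiveResolution F) :
    ((sectionsWithSupport P).mapHomologicalComplex (ComplexShape.up ℕ)).obj I.cocomplex ⟶
      ((sectionsWithSupport Q).mapHomologicalComplex (ComplexShape.up ℕ)).obj J.cocomplex :=
  ((sectionsWithSupport P).mapHomologicalComplex (ComplexShape.up ℕ)).map (resolutionLift f a I J) ≫
    (NatTrans.mapHomologicalComplex (sectionsComparison f P Q h).hom (ComplexShape.up ℕ)).app
      J.cocomplex

/-- The canonical map `H^i_Z(Y, G) ⟶ H^i_{f⁻¹ Z}(X, F)` attached to a morphism `G ⟶ f_* F`, computed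
with injective resolutions of `G` and of `F`. Here `H^i_Z` is the `i`-th right derived functor
of `Γ_Z` on sheaves of abelian groups. -/
def localCohomologyMap (P : SupportPair Y) (Q : SupportPair X) (h : Q = P.comap f) (i : ℕ) :
    ((sectionsWithSupport P).rightDerived i).obj G ⟶
      ((sectionsWithSupport Q).rightDerived i).obj F :=
  ((injectiveResolution G).isoRightDerivedObj (sectionsWithSupport P) i).hom ≫
    HomologicalComplex.homologyMap
      (sectionsLift f a P Q h (injectiveResolution G) (injectiveResolution F)) i ≫
    ((injectiveResolution F).isoRightDerivedObj (sectionsWithSupport Q) i).inv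

end PullbackMap

lemma rightDerived_map_add {C D : Type*} [Category* C] [Category* D] [Abelian C] [Abelian D]
    [HasInjectiveResolutions C] (F : C ⥤ D) [F.Additive] (n : ℕ) {X Y : C} (f g : X ⟶ Y) :
    (F.rightDerived n).map (f + g) = (F.rightDerived n).map f + (F.rightDerived n).map g := by
  let I := injectiveResolution X
  let J := injectiveResolution Y
  have hf := InjectiveResolution.desc_commutes f J I
  have hg := InjectiveResolution.desc_commutes g J I
  rw [F.rightDerived_map_eq n f _ hf, F.rightDerived_map_eq n g _ hg,
    F.rightDerived_map_eq n (f + g)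
      (InjectiveResolution.desc f J I + InjectiveResolution.desc g J I) (by
        rw [Preadditive.comp_add, hf, hg, Functor.map_add, Preadditive.add_comp])]
  simp only [Functor.map_add, Functor.comp_map, Preadditive.comp_add, Preadditive.add_comp]

/-- The ring `Γ(X, O_X)`. -/
abbrev globalSections (X : RingedSpace.{u}) : CommRingCat.{u} := X.presheaf.obj (op ⊤)

/-- The ring homomorphism `Γ(Y, O_Y) → Γ(X, O_X)` of a morphism `X ⟶ Y`. -/
def globalSectionsMap {X Y : RingedSpace.{u}} (f : X ⟶ Y) :
    globalSections Y →+* globalSections X :=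
  (f.hom.c.app (op ⊤)).hom

/-- Restriction of global functions to an open subset. -/
def restrictGlobal {X : RingedSpace.{u}} (U : (Opens X.carrier)ᵒᵖ) :
    globalSections X →+* (structureSheaf X).obj.obj U :=
  (X.presheaf.map (homOfLE le_top : U.unop ⟶ ⊤).op).hom

lemma map_restrictGlobal {X : RingedSpace.{u}} {U V : (Opens X.carrier)ᵒᵖ} (i : U ⟶ V)
    (r : globalSections X) :
    (structureSheaf X).obj.map i (restrictGlobal U r) = restrictGlobal V r :=
  (ConcreteCategory.congr_hom
    (X.presheaf.map_comp (homOfLE le_top : U.unop ⟶ ⊤).op i) r).symm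

/-- Multiplication by a global function, as an endomorphism of an `O_X`-module. -/
def scalar {X : RingedSpace.{u}} (F : Modules X) (r : globalSections X) :
    (toAb X).obj F ⟶ (toAb X).obj F where
  hom :=
    { app := fun U => AddCommGrpCat.ofHom
        (DistribSMul.toAddMonoidHom (F.val.obj U) (restrictGlobal U r))
      naturality := fun U V i => by
        ext s
        have h := F.val.map_smul i (restrictGlobal U r) s
        rw [map_restrictGlobal] at h
        exact h.symm }

lemma scalar_ext {X : RingedSpace.{u}} (F : Modules X)
    {a b : (toAb X).obj F ⟶ (toAb X).obj F}
    (h : ∀ (U : (Opens X.carrier)ᵒᵖ) (s : F.val.obj U), (a.hom.app U).hom s = (b.hom.app U).hom s) :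
    a = b := by
  apply Sheaf.hom_ext
  apply NatTrans.ext
  funext U
  apply AddCommGrpCat.hom_ext
  exact AddMonoidHom.ext (h U)

lemma scalar_one {X : RingedSpace.{u}} (F : Modules X) : scalar F 1 = 𝟙 _ :=
  scalar_ext F fun U s =>
    (congrArg (· • s) (map_one (restrictGlobal U))).trans (one_smul _ s)

lemma scalar_mul {X : RingedSpace.{u}} (F : Modules X) (r r' : globalSections X) :
    scalar F (r * r') = scalar F r' ≫ scalar F r :=
  scalar_ext F fun U s =>
    (congrArg (· • s) (map_mul (restrictGlobal U) r r')).trans (mul_smul _ _ s)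

lemma scalar_add {X : RingedSpace.{u}} (F : Modules X) (r r' : globalSections X) :
    scalar F (r + r') = scalar F r + scalar F r' :=
  scalar_ext F fun U s =>
    (congrArg (· • s) (map_add (restrictGlobal U) r r')).trans (add_smul _ _ s)

/-- The local cohomology group `H^i_Z(X, F)` of an `O_X`-module `F`, with the `A`-module structure
coming from a ring homomorphism `A → Γ(X, O_X)`. -/
def LocalCohomology {A : Type*} [Ring A] {X : RingedSpace.{u}} (_ : A →+* globalSections X)
    (P : SupportPair X.carrier) (F : Modules X) (i : ℕ) : Type u :=
  ((sectionsWithSupport P).rightDerived i).obj ((toAb X).obj F)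

namespace LocalCohomology

variable {A : Type*} [Ring A] {X : RingedSpace.{u}} (ρ : A →+* globalSections X)
    (P : SupportPair X.carrier) (F : Modules X) (i : ℕ)

instance : AddCommGroup (LocalCohomology ρ P F i) :=
  inferInstanceAs (AddCommGroup (((sectionsWithSupport P).rightDerived i).obj ((toAb X).obj F)))

/-- `a : A` acts through the endomorphism of `F` given by the scalar `ρ a`. -/
def action (a : A) : LocalCohomology ρ P F i →+ LocalCohomology ρ P F i :=
  (((sectionsWithSupport P).rightDerived i).map (scalar F (ρ a))).hom

lemma action_one : action ρ P F i 1 = AddMonoidHom.id _ := by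
  rw [action, map_one, scalar_one, CategoryTheory.Functor.map_id]
  rfl

lemma action_mul (a b : A) :
    action ρ P F i (a * b) = (action ρ P F i a).comp (action ρ P F i b) := by
  rw [action, map_mul, scalar_mul, Functor.map_comp]
  rfl

lemma action_add (a b : A) :
    action ρ P F i (a + b) = action ρ P F i a + action ρ P F i b := by
  rw [action, map_add, scalar_add, rightDerived_map_add]
  rfl

lemma action_zero : action ρ P F i 0 = 0 := by
  have h := action_add ρ P F i 0 0
  rwa [add_zero, left_eq_add] at h

instance : Module A (LocalCohomology ρ P F i) :=
  Module.compHom _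
    ({ toFun := action ρ P F i
       map_one' := action_one ρ P F i
       map_mul' := action_mul ρ P F i
       map_zero' := action_zero ρ P F i
       map_add' := action_add ρ P F i } : A →+* AddMonoid.End (LocalCohomology ρ P F i))

end LocalCohomology

/-- The morphism `G ⟶ f_* F` of sheaves of abelian groups given by `φ : f^* G ⟶ F`. -/
def moduleComparison {X Y : RingedSpace.{u}} (f : X ⟶ Y) {G : Modules Y} {F : Modules X}
    (φ : (pullback f).obj G ⟶ F) :
    (toAb Y).obj G ⟶ (TopCat.Sheaf.pushforward AddCommGrpCat.{u} f.hom.base).obj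
      ((toAb X).obj F) :=
  (toAb Y).map ((pullbackAdj f).homEquiv G F φ)

/-- The canonical map `H^i_Z(Y, G) → H^i_{f⁻¹ Z}(X, F)` given by `φ : f^* G ⟶ F`. -/
def LocalCohomology.pullbackMap {A : Type*} [Ring A] {X Y : RingedSpace.{u}} (f : X ⟶ Y)
    {ρ' : A →+* globalSections Y} {ρ : A →+* globalSections X}
    {P : SupportPair Y.carrier} {Q : SupportPair X.carrier} (h : Q = P.comap f.hom.base)
    {G : Modules Y} {F : Modules X} (φ : (pullback f).obj G ⟶ F) (i : ℕ) :
    LocalCohomology ρ' P G i →+ LocalCohomology ρ Q F i :=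
  (localCohomologyMap f.hom.base (moduleComparison f φ) P Q h i).hom

/-! ### The direct system of local cohomology groups -/

section LocalCohomologySystem

variable {L : Type u} [Preorder L] {X : Lᵒᵖ ⥤ RingedSpace.{u}} (S : ModuleSystem X)
  {A : Type w} [Ring A] (ρ : ∀ l : L, A →+* globalSections (X.obj (op l)))
  {α : L} (Pα : SupportPair (X.obj (op α)).carrier) (i : ℕ)

/-- The pair `(U_l, Z_l) = (v_{αl}⁻¹ U_α, v_{αl}⁻¹ Z_α)` on `X_l`, for `l ≥ α`. -/
def stagePair (l : Set.Ici α) : SupportPair (X.obj (op l.1)).carrier :=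
  Pα.comap (transition X l.2).hom.base

lemma stagePair_comap {l m : Set.Ici α} (h : l ≤ m) :
    stagePair Pα m = (stagePair Pα l).comap (transition X (l := l.1) (m := m.1) h).hom.base := by
  have e := transition_trans X (l := α) (m := l.1) (n := m.1) l.2 h
  exact (congrArg (fun g => Pα.comap g.hom.base) e).symm

lemma stagePair_comap_proj (c : Cone X) (l : Set.Ici α) :
    Pα.comap (c.π.app (op α)).hom.base =
      (stagePair Pα l).comap (c.π.app (op l.1)).hom.base := by
  have e := proj_transition c (l := α) (m := l.1) l.2
  exact (congrArg (fun g => Pα.comap g.hom.base) e).symm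

/-- The `A`-module `H^i_{Z_l}(X_l, F_l)`, for `l ≥ α`. -/
abbrev stageCohomology (l : Set.Ici α) : Type u :=
  LocalCohomology (ρ l.1) (stagePair Pα l) (S.obj l.1) i

/-- The canonical map `H^i_{Z_l}(X_l, F_l) → H^i_{Z_m}(X_m, F_m)`, for `α ≤ l ≤ m`. -/
def stageMap (l m : Set.Ici α) (h : l ≤ m) :
    stageCohomology S ρ Pα i l →+ stageCohomology S ρ Pα i m :=
  LocalCohomology.pullbackMap (transition X (l := l.1) (m := m.1) h) (stagePair_comap Pα h)
    (S.map (l := l.1) (m := m.1) h) i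

variable {c : Cone X} (t : Cocone (S.pulledBack c)) (P : SupportPair c.pt.carrier)

/-- The `A`-module `H^i_Z(X, F)`; since the `ρ l` are compatible and the index set is directed,
the homomorphism `A → Γ(X_α, O_{X_α}) → Γ(X, O_X)` does not depend on `α`. -/
abbrev limitCohomology (α : L) : Type u :=
  LocalCohomology ((globalSectionsMap (c.π.app (op α))).comp (ρ α)) P t.pt i

variable {P}

/-- The canonical map `H^i_{Z_l}(X_l, F_l) → H^i_Z(X, F)`, for `l ≥ α`. -/
def limitMap (hP : P = Pα.comap (c.π.app (op α)).hom.base) (l : Set.Ici α) :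
    stageCohomology S ρ Pα i l →+ limitCohomology S ρ i t P α :=
  LocalCohomology.pullbackMap (c.π.app (op l.1)) (hP.trans (stagePair_comap_proj Pα c l))
    (t.ι.app l.1) i

end LocalCohomologySystem

end LocalCohomologyLimits

end

open LocalCohomologyLimits

noncomputable section

namespace LocalCohomologyLimits

/-! ### Homology of complexes of abelian groups, elementwise -/

section AbHomology

variable {ι : Type*} {s : ComplexShape ι} (K : HomologicalComplex AddCommGrpCat.{u} s) (i : ι)

/-! The open subsets of all the `X_λ` are the objects `(λ, V)` of one site (`Stage`,
`stageTopology`), and the system of modules becomes a single sheaf of abelian groups on it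
(`stageSheaf`). One injective resolution is chosen on this site. Restricting it to `X_λ` and pulling
it back to `X` gives resolutions of `F_λ` and of `F` linked by honest maps of complexes. The theorem
then reduces to a termwise statement on sections with support, because directed colimits of abelian
groups are exact.

Both operations are exact: restriction to `X_λ` has adjoints on both sides, and the inverse image on
`X` is exact because directedness makes `stagePreimage` flat. The terms obtained need not be
injective, but they are quasi-flasque, that is, restriction between quasi-compact opens is
surjective. At a stage this is `map_surjective_of_injective`; on `X` it is
`isQuasiFlasque_stagePullback`, where sections over quasi-compact opens are first moved to a stage.
Quasi-flasque sheaves are adapted to `Γ_Z` when `U` and `U - Z` are quasi-compact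
(`isAdaptedClass_sectionsWithSupport`), so these resolutions compute local cohomology
(`IsAdaptedClass.isIso_homologyMap`). By `toRightDerived_localCohomologyMap` the canonical pullback
maps are those induced by the maps of resolutions.

The topological input is that the constructible topology of a spectral space is compact Hausdorff
and that quasi-compact opens are clopen in it. Compactness of products yields points of the limit
(`exists_compatible_mem`), hence the descent to a stage of inclusions (`exists_transOpens_le`).
Quasi-compact opens descend too (`exists_projOpens_eq`), which gives part 1, and so do sections over
them and the vanishing of such sections (`StageMap.IsPresentation.exists_section_over`,
`StageMap.IsPresentation.exists_sres_eq_zero`).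

The algebraic input is that the inverse image of `stageSheaf` is `F` as an abelian sheaf
(`exists_stagePullback_iso`). The universal property of `X` among ringed spaces shows that `O_X` is
the sheafified colimit of the functions at the stages (`isIso_ringSheafDesc`). Hence the sheafified
colimit of the modules is an `O_X`-module, and it has the universal property of the colimit of the
`v_λ^* F_λ`. Linearity over `A` is naturality of the pullback maps
(`rightDerived_map_localCohomologyMap`) applied to multiplication by scalars. -/

lemma exists_cycle (x : K.homology i) :
    ∃ z : K.cycles i, (K.homologyπ i).hom z = x :=
  (AddCommGrpCat.epi_iff_surjective _).1 inferInstance x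

variable {K i}

lemma d_iCycles_apply (z : K.cycles i) (j : ι) : (K.d i j).hom ((K.iCycles i).hom z) = 0 := by
  rw [← AddMonoidHom.comp_apply, ← AddCommGrpCat.hom_comp, K.iCycles_d]; rfl

lemma exists_cycle_of_d_eq_zero (x : K.X i) (hx : (K.d i (s.next i)).hom x = 0) :
    ∃ z : K.cycles i, (K.iCycles i).hom z = x :=
  ⟨(K.sc i).abCyclesIso.inv.hom ⟨x, hx⟩, (K.sc i).abCyclesIso_inv_apply_iCycles ⟨x, hx⟩⟩

lemma iCycles_injective : Function.Injective (K.iCycles i).hom :=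
  (AddCommGrpCat.mono_iff_injective _).1 inferInstance

lemma homologyπ_eq_zero_iff (z : K.cycles i) :
    (K.homologyπ i).hom z = 0 ↔ ∃ y, (K.d (s.prev i) i).hom y = (K.iCycles i).hom z := by
  constructor
  · intro hz
    have h : (ShortComplex.mk (K.toCycles (s.prev i) i) (K.homologyπ i) (by simp)).Exact :=
      ShortComplex.exact_of_g_is_cokernel _ (K.homologyIsCokernel (s.prev i) i rfl)
    obtain ⟨y, hy⟩ := (ShortComplex.ab_exact_iff _).1 h z hz
    refine ⟨y, ?_⟩
    rw [← hy]
    exact (ConcreteCategory.congr_hom (K.toCycles_i (s.prev i) i) y).symm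
  · rintro ⟨y, hy⟩
    have : z = (K.toCycles (s.prev i) i).hom y := by
      apply iCycles_injective
      rw [← hy]
      exact (ConcreteCategory.congr_hom (K.toCycles_i (s.prev i) i) y).symm
    rw [this]
    exact ConcreteCategory.congr_hom (K.toCycles_comp_homologyπ (s.prev i) i) y

variable {M : HomologicalComplex AddCommGrpCat.{u} s} (φ : K ⟶ M)

lemma homologyMap_homologyπ_apply (z : K.cycles i) :
    (HomologicalComplex.homologyMap φ i).hom ((K.homologyπ i).hom z) =
      (M.homologyπ i).hom ((HomologicalComplex.cyclesMap φ i).hom z) :=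
  ConcreteCategory.congr_hom (HomologicalComplex.homologyπ_naturality φ i) z

lemma iCycles_cyclesMap_apply (z : K.cycles i) :
    (M.iCycles i).hom ((HomologicalComplex.cyclesMap φ i).hom z) =
      (φ.f i).hom ((K.iCycles i).hom z) :=
  ConcreteCategory.congr_hom (HomologicalComplex.cyclesMap_i φ i) z

/-- Here and in `homologyMap_surjective_of` the hypothesis is put on elements of the complexes, in
the form in which exactness of a homotopy fiber supplies it. -/
lemma homologyMap_injective_of
    (h : ∀ (x : K.X i) (y : M.X (s.prev i)), (K.d i (s.next i)).hom x = 0 →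
      (φ.f i).hom x = (M.d (s.prev i) i).hom y → ∃ x', (K.d (s.prev i) i).hom x' = x) :
    Function.Injective (HomologicalComplex.homologyMap φ i).hom := by
  rw [injective_iff_map_eq_zero]
  intro a ha
  obtain ⟨z, rfl⟩ := exists_cycle K i a
  rw [homologyMap_homologyπ_apply, homologyπ_eq_zero_iff] at ha
  obtain ⟨y, hy⟩ := ha
  rw [iCycles_cyclesMap_apply] at hy
  rw [homologyπ_eq_zero_iff]
  exact h _ y (d_iCycles_apply z _) hy.symm

lemma homologyMap_surjective_of
    (h : ∀ y : M.X i, (M.d i (s.next i)).hom y = 0 → ∃ (x : K.X i) (y' : M.X (s.prev i)),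
      (K.d i (s.next i)).hom x = 0 ∧ (φ.f i).hom x = y + (M.d (s.prev i) i).hom y') :
    Function.Surjective (HomologicalComplex.homologyMap φ i).hom := by
  intro b
  obtain ⟨w, rfl⟩ := exists_cycle M i b
  obtain ⟨x, y', hx, hxy⟩ := h _ (d_iCycles_apply w _)
  obtain ⟨z, rfl⟩ := exists_cycle_of_d_eq_zero x hx
  refine ⟨(K.homologyπ i).hom z, ?_⟩
  rw [homologyMap_homologyπ_apply, ← sub_eq_zero, ← map_sub, homologyπ_eq_zero_iff]
  refine ⟨y', ?_⟩
  rw [map_sub, iCycles_cyclesMap_apply, hxy, add_sub_cancel_left]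

end AbHomology

/-! ### Resolutions -/

section Resolutions

variable {C : Type*} [Category* C] [Abelian C]

/-- The complex `K` is a right resolution of `G` with augmentation `ε`. -/
structure IsResolution {G : C} (K : CochainComplex C ℕ) (ε : G ⟶ K.X 0) : Prop where
  mono : Mono ε
  w : ε ≫ K.d 0 1 = 0
  exact_zero : (ShortComplex.mk ε (K.d 0 1) w).Exact
  exact_succ (n : ℕ) : (ShortComplex.mk (K.d n (n + 1)) (K.d (n + 1) (n + 2))
    (K.d_comp_d _ _ _)).Exact

lemma isResolution_injectiveResolution {G : C} (I : InjectiveResolution G) :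
    IsResolution I.cocomplex (I.ι.f 0 : G ⟶ I.cocomplex.X 0) where
  mono := InjectiveResolution.instMonoFNatι I 0
  w := I.ι_f_zero_comp_complex_d
  exact_zero := I.exact₀
  exact_succ n := I.exact_succ n

/-- Restriction and inverse image turn `stageSheaf` into sheaves only isomorphic to the ones to be
resolved; this lemma absorbs the isomorphism. -/
lemma IsResolution.precomp_iso {G G' : C} {K : CochainComplex C ℕ} {ε : G ⟶ K.X 0}
    (h : IsResolution K ε) (e : G' ⟶ G) [IsIso e] : IsResolution K (e ≫ ε) where
  mono := by have := h.mono; infer_instance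
  w := by rw [Category.assoc, h.w, comp_zero]
  exact_zero := by
    let S : ShortComplex C := ShortComplex.mk (e ≫ ε) (K.d 0 1) (by rw [Category.assoc, h.w, comp_zero])
    let φ : S ≅ ShortComplex.mk ε (K.d 0 1) h.w :=
      ShortComplex.isoMk (asIso e : G' ≅ G) (Iso.refl _) (Iso.refl _)
        (by simp [S]) (by simp [S])
    exact (ShortComplex.exact_iff_of_iso φ).2 h.exact_zero
  exact_succ := h.exact_succ

lemma IsResolution.map {D : Type*} [Category* D] [Abelian D] {G : C} {K : CochainComplex C ℕ}
    {ε : G ⟶ K.X 0} (h : IsResolution K ε) (F : C ⥤ D) [F.Additive] [F.PreservesHomology]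
    [F.PreservesMonomorphisms] :
    IsResolution ((F.mapHomologicalComplex _).obj K) (F.map ε) where
  mono := by have := h.mono; exact F.map_mono ε
  w := (F.map_comp _ _).symm.trans ((congrArg F.map h.w).trans (F.map_zero _ _))
  exact_zero := h.exact_zero.map F
  exact_succ n := (h.exact_succ n).map F

variable {G : C} {K : CochainComplex C ℕ} {ε : G ⟶ K.X 0}

/-- A morphism from `G` into a complex of injectives extends to any resolution of `G`. -/
lemma IsResolution.exists_lift (hK : IsResolution K ε) (M : CochainComplex C ℕ)
    (hM : ∀ n, Injective (M.X n)) (e : G ⟶ M.X 0) (he : e ≫ M.d 0 1 = 0) :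
    ∃ t : K ⟶ M, ε ≫ t.f 0 = e := by
  have := hK.mono
  let t₀ : K.X 0 ⟶ M.X 0 := Injective.factorThru e ε
  have ht₀ : ε ≫ t₀ = e := Injective.comp_factorThru e ε
  let t₁ : K.X 1 ⟶ M.X 1 := hK.exact_zero.descToInjective (t₀ ≫ M.d 0 1)
    (by rw [reassoc_of% ht₀, he])
  have ht₁ : K.d 0 1 ≫ t₁ = t₀ ≫ M.d 0 1 := hK.exact_zero.comp_descToInjective _ _
  refine ⟨CochainComplex.mkHom _ _ t₀ t₁ ht₁.symm fun n ⟨g, g', w⟩ =>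
    ⟨(hK.exact_succ n).descToInjective (g' ≫ M.d (n + 1) (n + 2)) (by
      dsimp
      rw [← reassoc_of% w, M.d_comp_d, comp_zero]),
      ((hK.exact_succ n).comp_descToInjective _ _).symm⟩, ?_⟩
  simpa using ht₀

/-- A morphism from a resolution to a complex of injectives that vanishes on the resolved object
is null-homotopic. -/
def IsResolution.homotopyZero (hK : IsResolution K ε) {M : CochainComplex C ℕ}
    (hM : ∀ n, Injective (M.X n)) (t : K ⟶ M) (ht : ε ≫ t.f 0 = 0) : Homotopy t 0 :=
  let h₀ : K.X 1 ⟶ M.X 0 := hK.exact_zero.descToInjective (t.f 0) ht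
  have e₀ : K.d 0 1 ≫ h₀ = t.f 0 := hK.exact_zero.comp_descToInjective _ _
  let h₁ : K.X 2 ⟶ M.X 1 := (hK.exact_succ 0).descToInjective (t.f 1 - h₀ ≫ M.d 0 1)
    (by dsimp; rw [Preadditive.comp_sub, reassoc_of% e₀, ← t.comm, sub_self])
  have e₁ : K.d 1 2 ≫ h₁ = t.f 1 - h₀ ≫ M.d 0 1 := (hK.exact_succ 0).comp_descToInjective _ _
  Homotopy.mkCoinductive _ h₀ e₀.symm h₁ (by rw [e₁]; abel) fun n ⟨g, g', w⟩ =>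
    ⟨(hK.exact_succ (n + 1)).descToInjective (t.f (n + 2) - g' ≫ M.d _ _) (by
        dsimp
        rw [Preadditive.comp_sub, ← t.comm, w]
        simp), by
      rw [(hK.exact_succ (n + 1)).comp_descToInjective]; abel⟩

/-- Two extensions to a resolution of the same morphism into a complex of injectives are
homotopic. -/
def IsResolution.homotopy (hK : IsResolution K ε) {M : CochainComplex C ℕ}
    (hM : ∀ n, Injective (M.X n)) (t t' : K ⟶ M) (ht : ε ≫ t.f 0 = ε ≫ t'.f 0) :
    Homotopy t t' :=
  Homotopy.equivSubZero.symm (hK.homotopyZero hM (t - t') (by simp [ht]))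

/-! ### Acyclic resolutions compute derived functors -/

section Fiber

variable (K) (M : CochainComplex C ℕ)

/-- The objects `K⁰, K¹ ⊞ M⁰, K² ⊞ M¹, …` of the homotopy fiber of a morphism of complexes. -/
def fiberX : ℕ → C
  | 0 => K.X 0
  | n + 1 => K.X (n + 1) ⊞ M.X n

/-- The first projection of the homotopy fiber. -/
def fiberFst : ∀ n, fiberX K M n ⟶ K.X n
  | 0 => 𝟙 (K.X 0)
  | n + 1 => (biprod.fst : K.X (n + 1) ⊞ M.X n ⟶ _)

/-- The second projection of the homotopy fiber. -/
def fiberSnd (n : ℕ) : fiberX K M (n + 1) ⟶ M.X n :=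
  (biprod.snd : K.X (n + 1) ⊞ M.X n ⟶ _)

/-- The first projection of the homotopy fiber is an isomorphism in degree zero. -/
def fiberZero : K.X 0 ⟶ fiberX K M 0 := 𝟙 (K.X 0)

variable {K M}

/-- The morphism into the homotopy fiber with given components. -/
def fiberLift {A : C} {n : ℕ} (k : A ⟶ K.X (n + 1)) (m : A ⟶ M.X n) :
    A ⟶ fiberX K M (n + 1) :=
  (biprod.lift k m : A ⟶ K.X (n + 1) ⊞ M.X n)

@[simp]
lemma fiberLift_fst {A : C} {n : ℕ} (k : A ⟶ K.X (n + 1)) (m : A ⟶ M.X n) :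
    fiberLift k m ≫ fiberFst K M (n + 1) = k :=
  biprod.lift_fst k m

@[simp]
lemma fiberLift_fst_assoc {A B : C} {n : ℕ} (k : A ⟶ K.X (n + 1)) (m : A ⟶ M.X n)
    (f : K.X (n + 1) ⟶ B) : fiberLift k m ≫ fiberFst K M (n + 1) ≫ f = k ≫ f := by
  rw [← Category.assoc, fiberLift_fst]

@[simp]
lemma fiberLift_snd {A : C} {n : ℕ} (k : A ⟶ K.X (n + 1)) (m : A ⟶ M.X n) :
    fiberLift k m ≫ fiberSnd K M n = m :=
  biprod.lift_snd k m

@[simp]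
lemma fiberLift_snd_assoc {A B : C} {n : ℕ} (k : A ⟶ K.X (n + 1)) (m : A ⟶ M.X n)
    (f : M.X n ⟶ B) : fiberLift k m ≫ fiberSnd K M n ≫ f = m ≫ f := by
  rw [← Category.assoc, fiberLift_snd]

@[simp]
lemma fiberZero_fst : fiberZero K M ≫ fiberFst K M 0 = 𝟙 _ := Category.id_comp (𝟙 (K.X 0))

@[simp]
lemma fiberZero_fst_assoc {B : C} (f : K.X 0 ⟶ B) : fiberZero K M ≫ fiberFst K M 0 ≫ f = f := by
  rw [← Category.assoc, fiberZero_fst, Category.id_comp]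

@[simp]
lemma fiberFst_zero : fiberFst K M 0 ≫ fiberZero K M = 𝟙 _ := Category.id_comp (𝟙 (K.X 0))

lemma fiber_hom_ext {A : C} {n : ℕ} {x y : A ⟶ fiberX K M (n + 1)}
    (h₁ : x ≫ fiberFst K M (n + 1) = y ≫ fiberFst K M (n + 1))
    (h₂ : x ≫ fiberSnd K M n = y ≫ fiberSnd K M n) : x = y :=
  biprod.hom_ext (X := K.X (n + 1)) (Y := M.X n) _ _ h₁ h₂

variable (K M) in
/-- The second projection followed by the differential. -/
def fiberSndD : ∀ n, fiberX K M n ⟶ M.X n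
  | 0 => 0
  | n + 1 => fiberSnd K M n ≫ M.d n (n + 1)

lemma fiberSndD_succ (n : ℕ) : fiberSndD K M (n + 1) = fiberSnd K M n ≫ M.d n (n + 1) := rfl

lemma fiberSndD_d (n : ℕ) : fiberSndD K M n ≫ M.d n (n + 1) = 0 := by
  cases n <;> simp [fiberSndD]

variable (t : K ⟶ M)

/-- The differential of the homotopy fiber. -/
def fiberD (n : ℕ) : fiberX K M n ⟶ fiberX K M (n + 1) :=
  fiberLift (fiberFst K M n ≫ K.d n (n + 1)) (fiberFst K M n ≫ t.f n - fiberSndD K M n)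

@[simp]
lemma fiberD_fst (n : ℕ) :
    fiberD t n ≫ fiberFst K M (n + 1) = fiberFst K M n ≫ K.d n (n + 1) :=
  fiberLift_fst _ _

@[simp]
lemma fiberD_fst_assoc (n : ℕ) {B : C} (f : K.X (n + 1) ⟶ B) :
    fiberD t n ≫ fiberFst K M (n + 1) ≫ f = fiberFst K M n ≫ K.d n (n + 1) ≫ f := by
  rw [← Category.assoc, fiberD_fst, Category.assoc]

@[simp]
lemma fiberD_snd (n : ℕ) :
    fiberD t n ≫ fiberSnd K M n = fiberFst K M n ≫ t.f n - fiberSndD K M n :=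
  fiberLift_snd _ _

@[simp]
lemma fiberD_snd_assoc (n : ℕ) {B : C} (f : M.X n ⟶ B) :
    fiberD t n ≫ fiberSnd K M n ≫ f = (fiberFst K M n ≫ t.f n - fiberSndD K M n) ≫ f := by
  rw [← Category.assoc, fiberD_snd]

lemma fiberD_comp (n : ℕ) : fiberD t n ≫ fiberD t (n + 1) = 0 := by
  apply fiber_hom_ext
  · simp
  · simp [fiberSndD_succ, fiberSndD_d]

/-- An element of `K⁰` killed by `d` comes from `G`; if `t` kills it as well, it is zero because
`ε'` is a monomorphism. -/
lemma mono_fiberD_zero {ε' : G ⟶ M.X 0} (hK : IsResolution K ε) (hM : IsResolution M ε')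
    (ht : ε ≫ t.f 0 = ε') : Mono (fiberD t 0) := by
  rw [Preadditive.mono_iff_cancel_zero]
  intro A x hx
  have h₁ : (x ≫ fiberFst K M 0) ≫ K.d 0 1 = 0 := by
    simpa using hx =≫ fiberFst K M 1
  have h₂ : (x ≫ fiberFst K M 0) ≫ t.f 0 = 0 := by
    simpa [fiberSndD] using hx =≫ fiberSnd K M 0
  have := hK.mono
  have := hM.mono
  obtain ⟨g, hg⟩ : ∃ g : A ⟶ G, g ≫ ε = x ≫ fiberFst K M 0 :=
    ⟨hK.exact_zero.lift _ h₁, hK.exact_zero.lift_f _ h₁⟩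
  have hg₀ : g = 0 := by
    rw [← cancel_mono ε', ← ht, reassoc_of% hg, ← Category.assoc, h₂, zero_comp]
  have := hg.symm =≫ fiberZero K M
  simpa [hg₀] using this

/-- For a cocycle `(k, m)` one has `k = d k'` locally, and `t k' - m` is then a cocycle of `M`.
Exactness of `M` turns it into a correction of `k'` or into a second component. -/
lemma exact_fiberD {ε' : G ⟶ M.X 0} (hK : IsResolution K ε) (hM : IsResolution M ε')
    (ht : ε ≫ t.f 0 = ε') (n : ℕ) :
    (ShortComplex.mk (fiberD t n) (fiberD t (n + 1)) (fiberD_comp t n)).Exact := by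
  rw [ShortComplex.exact_iff_exact_up_to_refinements]
  intro A x hx
  dsimp only at x hx
  obtain ⟨k, hk₀⟩ : ∃ k, k = x ≫ fiberFst K M (n + 1) := ⟨_, rfl⟩
  obtain ⟨m, hm₀⟩ : ∃ m, m = x ≫ fiberSnd K M n := ⟨_, rfl⟩
  have hk : k ≫ K.d (n + 1) (n + 2) = 0 := by
    simpa [hk₀] using hx =≫ fiberFst K M (n + 2)
  have hm : k ≫ t.f (n + 1) = m ≫ M.d n (n + 1) := by
    have := hx =≫ fiberSnd K M (n + 1)
    rw [Category.assoc, fiberD_snd, Preadditive.comp_sub, fiberSndD, zero_comp, sub_eq_zero] at this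
    simpa [hk₀, hm₀] using this
  obtain ⟨A₁, π₁, _, k', hk'⟩ := (hK.exact_succ n).exact_up_to_refinements k hk
  dsimp only at k' hk'
  have hd : (k' ≫ t.f n - π₁ ≫ m) ≫ M.d n (n + 1) = 0 := by
    rw [Preadditive.sub_comp, Category.assoc, Category.assoc, t.comm, ← hm, ← reassoc_of% hk',
      sub_self]
  -- In degree zero the fiber has no second component, so the defect, which comes from `G`, is
  -- removed by changing `k'`. In higher degrees the defect is a coboundary and its primitive serves
  -- as second component.
  cases n with
  | zero =>
    have := hM.mono
    obtain ⟨g, hg⟩ : ∃ g : A₁ ⟶ G, g ≫ ε' = k' ≫ t.f 0 - π₁ ≫ m :=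
      ⟨hM.exact_zero.lift _ hd, hM.exact_zero.lift_f _ hd⟩
    refine ⟨A₁, π₁, inferInstance, (k' - g ≫ ε) ≫ fiberZero K M, fiber_hom_ext ?_ ?_⟩
    · simp [← hk₀, hk', hK.w]
    · simp [← hm₀, fiberSndD, ht, hg]
  | succ n =>
    obtain ⟨A₂, π₂, _, m', hm'⟩ := (hM.exact_succ n).exact_up_to_refinements _ hd
    dsimp only at m' hm'
    refine ⟨A₂, π₂ ≫ π₁, inferInstance, fiberLift (π₂ ≫ k') m', fiber_hom_ext ?_ ?_⟩
    · simp [← hk₀, hk']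
    · simp [← hm₀, fiberSndD, ← hm']

end Fiber

/-- A class of objects on which an additive functor to abelian groups behaves like an exact
functor. -/
structure IsAdaptedClass (Γ : C ⥤ AddCommGrpCat.{u}) (A : ObjectProperty C) : Prop where
  left_exact ⦃S : ShortComplex C⦄ (hS : S.ShortExact) (x : Γ.obj S.X₂)
    (hx : (Γ.map S.g).hom x = 0) : ∃ y, (Γ.map S.f).hom y = x
  injective ⦃S : ShortComplex C⦄ (hS : S.ShortExact) : Function.Injective (Γ.map S.f).hom
  surjective ⦃S : ShortComplex C⦄ (hS : S.ShortExact) (h₁ : A S.X₁) :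
    Function.Surjective (Γ.map S.g).hom
  quotient ⦃S : ShortComplex C⦄ (hS : S.ShortExact) (h₁ : A S.X₁) (h₂ : A S.X₂) : A S.X₃
  zero ⦃Z : C⦄ (hZ : IsZero Z) : A Z
  biprod ⦃Z Z' : C⦄ (hZ : A Z) (hZ' : A Z') : A (Z ⊞ Z')

section Adapted

variable {Γ : C ⥤ AddCommGrpCat.{u}} [Γ.Additive] {A : ObjectProperty C}

/-- Dimension shifting: the kernels start from zero and stay in the class, since each is a quotient
of an adapted object by an adapted kernel. So `Γ` is exact on each of the short exact pieces. -/
lemma IsAdaptedClass.exact_map (hA : IsAdaptedClass Γ A) (E : ℕ → C) (d : ∀ n, E n ⟶ E (n + 1))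
    (hd : ∀ n, d n ≫ d (n + 1) = 0) (h₀ : Mono (d 0))
    (h : ∀ n, (ShortComplex.mk (d n) (d (n + 1)) (hd n)).Exact) (hE : ∀ n, A (E n)) :
    Function.Injective (Γ.map (d 0)).hom ∧
    ∀ n (x : Γ.obj (E (n + 1))), (Γ.map (d (n + 1))).hom x = 0 →
      ∃ y, (Γ.map (d n)).hom y = x := by
  -- These are `0 ⟶ ker dₙ ⟶ Eₙ ⟶ ker dₙ₊₁ ⟶ 0`.
  let S (n : ℕ) : ShortComplex C :=
    ShortComplex.mk (kernel.ι (d n)) (kernel.lift (d (n + 1)) (d n) (hd n)) (by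
      rw [← cancel_mono (kernel.ι _)]; simp)
  have hS (n : ℕ) : (S n).ShortExact := by
    have : Epi (S n).g := by
      have := (h n).epi_kernelLift
      exact this
    have : Mono (S n).f := inferInstanceAs (Mono (kernel.ι (d n)))
    refine ⟨ShortComplex.exact_of_f_is_kernel _ ?_⟩
    refine KernelFork.IsLimit.ofι' _ _ fun {A} k hk => ?_
    have hk' : k ≫ d n = 0 := by
      have := hk =≫ kernel.ι (d (n + 1))
      simpa [S] using this
    exact ⟨kernel.lift _ k hk', kernel.lift_ι _ k hk'⟩
  have hker (n : ℕ) : A (S n).X₁ := by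
    induction n with
    | zero => exact hA.zero (isZero_kernel_of_mono (d 0))
    | succ n ih => exact hA.quotient (hS n) ih (hE n)
  have hfac (n : ℕ) : d n = (S n).g ≫ (S (n + 1)).f := by simp [S]
  have hfac' (n : ℕ) (y : Γ.obj (E n)) :
      (Γ.map (d n)).hom y = (Γ.map (S (n + 1)).f).hom ((Γ.map (S n).g).hom y) := by
    conv_lhs => rw [hfac, Γ.map_comp]
    rfl
  constructor
  · rw [injective_iff_map_eq_zero]
    intro x hx
    rw [hfac'] at hx
    have h1 := hA.injective (hS 1) (hx.trans (map_zero _).symm)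
    obtain ⟨y, rfl⟩ := hA.left_exact (hS 0) x h1
    have : (S 0).f = 0 := (isZero_kernel_of_mono (d 0)).eq_of_src _ _
    rw [this, Γ.map_zero]
    rfl
  · intro n x hx
    rw [hfac'] at hx
    have h1 := hA.injective (hS (n + 2)) (hx.trans (map_zero _).symm)
    obtain ⟨y, rfl⟩ := hA.left_exact (hS (n + 1)) x h1
    obtain ⟨z, rfl⟩ := hA.surjective (hS n) (hker n) y
    exact ⟨z, hfac' n z⟩

/-- A morphism of resolutions by adapted objects induces isomorphisms in cohomology. -/
lemma IsAdaptedClass.isIso_homologyMap (hA : IsAdaptedClass Γ A) {M : CochainComplex C ℕ}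
    {ε' : G ⟶ M.X 0} (hK : IsResolution K ε) (hM : IsResolution M ε') (t : K ⟶ M)
    (ht : ε ≫ t.f 0 = ε') (hKA : ∀ n, A (K.X n)) (hMA : ∀ n, A (M.X n)) (i : ℕ) :
    IsIso (HomologicalComplex.homologyMap
      ((Γ.mapHomologicalComplex (ComplexShape.up ℕ)).map t) i) := by
  have hF (n : ℕ) : A (fiberX K M n) := by
    cases n with
    | zero => exact hKA 0
    | succ n => exact hA.biprod (hKA _) (hMA _)
  -- The fiber is an exact complex of adapted objects, so it remains exact after `Γ`; what follows
  -- rewrites this exactness in terms of `K` and `M`.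
  obtain ⟨h₀, h₁⟩ := hA.exact_map (fiberX K M) (fiberD t) (fiberD_comp t)
    (mono_fiberD_zero t hK hM ht) (exact_fiberD t hK hM ht) hF
  have map_comp {X Y Z : C} (f : X ⟶ Y) (g : Y ⟶ Z) (x : Γ.obj X) :
      (Γ.map g).hom ((Γ.map f).hom x) = (Γ.map (f ≫ g)).hom x := by rw [Γ.map_comp]; rfl
  have map_sub {X Y : C} (f g : X ⟶ Y) (x : Γ.obj X) :
      (Γ.map (f - g)).hom x = (Γ.map f).hom x - (Γ.map g).hom x := by rw [Γ.map_sub]; rfl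
  have ext {n : ℕ} {z z' : Γ.obj (fiberX K M (n + 1))}
      (h : (Γ.map (fiberFst K M (n + 1))).hom z = (Γ.map (fiberFst K M (n + 1))).hom z')
      (h' : (Γ.map (fiberSnd K M n)).hom z = (Γ.map (fiberSnd K M n)).hom z') : z = z' := by
    have key (z : Γ.obj (fiberX K M (n + 1))) : z =
        (Γ.map (fiberLift (𝟙 _) 0)).hom ((Γ.map (fiberFst K M (n + 1))).hom z) +
          (Γ.map (fiberLift 0 (𝟙 _))).hom ((Γ.map (fiberSnd K M n)).hom z) := by
      rw [map_comp, map_comp, ← AddMonoidHom.add_apply, ← AddCommGrpCat.hom_add, ← Γ.map_add]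
      have : fiberFst K M (n + 1) ≫ fiberLift (𝟙 _) 0 + fiberSnd K M n ≫ fiberLift 0 (𝟙 _) =
          𝟙 (fiberX K M (n + 1)) := fiber_hom_ext (by simp) (by simp)
      rw [this, Γ.map_id]
      rfl
    rw [key z, key z', h, h']
  have mk {n : ℕ} (k : Γ.obj (K.X (n + 1))) (m : Γ.obj (M.X n)) :
      ∃ z : Γ.obj (fiberX K M (n + 1)), (Γ.map (fiberFst K M (n + 1))).hom z = k ∧
        (Γ.map (fiberSnd K M n)).hom z = m := by
    refine ⟨(Γ.map (fiberLift (𝟙 _) 0)).hom k + (Γ.map (fiberLift 0 (𝟙 _))).hom m, ?_, ?_⟩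
    · rw [map_add, map_comp, map_comp]
      simp
    · rw [map_add, map_comp, map_comp]
      simp
  -- The pair `(k, m)` is a cocycle of the fiber. The components of its primitive are `k'` and `y`,
  -- with `y = 0` in degree zero, where there is no second component.
  have key (n : ℕ) (k : Γ.obj (K.X (n + 1))) (m : Γ.obj (M.X n))
      (hk : (Γ.map (K.d (n + 1) (n + 2))).hom k = 0)
      (hm : (Γ.map (t.f (n + 1))).hom k = (Γ.map (M.d n (n + 1))).hom m) :
      ∃ k' : Γ.obj (K.X n), (Γ.map (K.d n (n + 1))).hom k' = k ∧
        ∃ y, (Γ.map (t.f n)).hom k' =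
          m + (Γ.map (M.d ((ComplexShape.up ℕ).prev n) n)).hom y := by
    obtain ⟨z, rfl, rfl⟩ := mk k m
    obtain ⟨w, hw⟩ := h₁ n z (ext
      (by rw [map_comp, fiberD_fst, ← map_comp, hk, map_zero])
      (by rw [map_comp, fiberD_snd, map_sub, ← map_comp, hm, fiberSndD, ← map_comp, sub_self,
            map_zero]))
    rw [← hw]
    refine ⟨(Γ.map (fiberFst K M n)).hom w, by rw [map_comp, map_comp, fiberD_fst], ?_⟩
    rw [map_comp, map_comp, fiberD_snd, map_sub]
    cases n with
    | zero => exact ⟨0, by simp [fiberSndD]⟩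
    | succ n =>
      rw [CochainComplex.prev_nat_succ]
      exact ⟨(Γ.map (fiberSnd K M n)).hom w, by rw [fiberSndD, map_comp, sub_add_cancel]⟩
  have hnext (n : ℕ) (x : Γ.obj (K.X n))
      (hx : (Γ.map (K.d n ((ComplexShape.up ℕ).next n))).hom x = 0) :
      (Γ.map (K.d n (n + 1))).hom x = 0 := by
    rwa [CochainComplex.next] at hx
  -- Injectivity in degree zero is not a case of `key`; it uses the injectivity at the start of the
  -- fiber.
  have hinj₀ (x : Γ.obj (K.X 0)) (hx : (Γ.map (K.d 0 1)).hom x = 0)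
      (hx' : (Γ.map (t.f 0)).hom x = 0) : x = 0 := by
    have hz : (Γ.map (fiberZero K M)).hom x = 0 := by
      refine h₀ (ext ?_ ?_)
      · rw [map_comp, map_comp, fiberD_fst, fiberZero_fst_assoc, hx, map_zero, map_zero]
      · rw [map_comp, map_comp, fiberD_snd, Preadditive.comp_sub, fiberZero_fst_assoc, map_sub, hx',
          fiberSndD, comp_zero, Γ.map_zero, map_zero, map_zero]
        simp
    have := congrArg (Γ.map (fiberFst K M 0)).hom hz
    rw [map_comp, fiberZero_fst, Γ.map_id, map_zero] at this
    exact this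
  rw [ConcreteCategory.isIso_iff_bijective]
  constructor
  · refine homologyMap_injective_of _ fun x y hx hxy => ?_
    replace hx : (Γ.map (K.d i (i + 1))).hom x = 0 := hnext i x hx
    cases i with
    | zero =>
      have hxy' : (Γ.map (t.f 0)).hom x = 0 := by
        refine hxy.trans ?_
        have : M.d ((ComplexShape.up ℕ).prev 0) 0 = 0 := M.shape _ _ (by simp)
        refine (congrArg (fun f => (Γ.map f).hom y) this).trans ?_
        rw [Γ.map_zero]
        rfl
      exact ⟨0, (map_zero _).trans (hinj₀ x hx hxy').symm⟩
    | succ n =>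
      revert y
      rw [CochainComplex.prev_nat_succ]
      intro y hxy
      obtain ⟨k', hk', -⟩ := key n x y hx hxy
      exact ⟨k', hk'⟩
  · refine homologyMap_surjective_of _ fun y hy => ?_
    rw [CochainComplex.next] at hy ⊢
    -- Surjectivity is `key` for `k = 0` and `m` the given cocycle.
    obtain ⟨k', hk', y', hy'⟩ := key i 0 y (map_zero _) ((map_zero _).trans hy.symm)
    exact ⟨k', y', hk', hy'⟩

end Adapted

section Derived

variable [HasInjectiveResolutions C] (Γ : C ⥤ AddCommGrpCat.{u}) [Γ.Additive]

lemma IsResolution.exists_toInjectiveResolution (hK : IsResolution K ε) :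
    ∃ t : K ⟶ (injectiveResolution G).cocomplex, ε ≫ t.f 0 = (injectiveResolution G).ι.f 0 :=
  hK.exists_lift _ (injectiveResolution G).injective _
    (injectiveResolution G).ι_f_zero_comp_complex_d

/-- A morphism from a resolution to the chosen injective resolution. -/
def IsResolution.toInjectiveResolution (hK : IsResolution K ε) :
    K ⟶ (injectiveResolution G).cocomplex :=
  hK.exists_toInjectiveResolution.choose

lemma IsResolution.toInjectiveResolution_f_zero (hK : IsResolution K ε) :
    ε ≫ hK.toInjectiveResolution.f 0 = (injectiveResolution G).ι.f 0 :=
  hK.exists_toInjectiveResolution.choose_spec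

/-- The canonical map from the cohomology of `Γ` of a resolution to the derived functors. -/
def IsResolution.toRightDerived (hK : IsResolution K ε) (i : ℕ) :
    ((Γ.mapHomologicalComplex (ComplexShape.up ℕ)).obj K).homology i ⟶
      (Γ.rightDerived i).obj G :=
  HomologicalComplex.homologyMap
    ((Γ.mapHomologicalComplex (ComplexShape.up ℕ)).map hK.toInjectiveResolution) i ≫
    ((injectiveResolution G).isoRightDerivedObj Γ i).inv

variable {Γ} in
-- By `hinj` the chosen injective resolution is itself a resolution by adapted objects, so it can be
-- compared with `K` through `isIso_homologyMap`.
lemma IsAdaptedClass.isIso_toRightDerived {A : ObjectProperty C} (hA : IsAdaptedClass Γ A)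
    (hinj : ∀ I : C, Injective I → A I) (hK : IsResolution K ε) (hKA : ∀ n, A (K.X n)) (i : ℕ) :
    IsIso (hK.toRightDerived Γ i) := by
  have := hA.isIso_homologyMap hK (isResolution_injectiveResolution (injectiveResolution G))
    hK.toInjectiveResolution hK.toInjectiveResolution_f_zero hKA
    (fun n => hinj _ ((injectiveResolution G).injective n)) i
  exact @IsIso.comp_isIso _ _ _ _ _ _ _ this (Iso.isIso_inv _)

end Derived

end Resolutions

/-! ### Independence of the pullback map from the resolutions -/

section LocalCohomologyMap

variable {X Y : TopCat.{u}} (f : X ⟶ Y)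
  {G : TopCat.Sheaf AddCommGrpCat.{u} Y} {F : TopCat.Sheaf AddCommGrpCat.{u} X}
  (a : G ⟶ (TopCat.Sheaf.pushforward AddCommGrpCat.{u} f).obj F)
  {K : CochainComplex (TopCat.Sheaf AddCommGrpCat.{u} Y) ℕ} {ε : G ⟶ K.X 0}
  {M : CochainComplex (TopCat.Sheaf AddCommGrpCat.{u} X) ℕ} {ε' : F ⟶ M.X 0}

/-- The morphism `Γ_Z(Y, K) ⟶ Γ_{f⁻¹ Z}(X, M)` of a morphism `K ⟶ f_* M` of complexes. -/
def sectionsMap (P : SupportPair Y) (Q : SupportPair X) (h : Q = P.comap f)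
    (s : K ⟶ ((TopCat.Sheaf.pushforward AddCommGrpCat.{u} f).mapHomologicalComplex
        (ComplexShape.up ℕ)).obj M) :
    ((sectionsWithSupport P).mapHomologicalComplex (ComplexShape.up ℕ)).obj K ⟶
      ((sectionsWithSupport Q).mapHomologicalComplex (ComplexShape.up ℕ)).obj M :=
  ((sectionsWithSupport P).mapHomologicalComplex (ComplexShape.up ℕ)).map s ≫
    (NatTrans.mapHomologicalComplex (sectionsComparison f P Q h).hom (ComplexShape.up ℕ)).app M

lemma resolutionLift_spec (I : InjectiveResolution G) (J : InjectiveResolution F) :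
    I.ι.f 0 ≫ (resolutionLift f a I J).f 0 =
      a ≫ (TopCat.Sheaf.pushforward AddCommGrpCat.{u} f).map (J.ι.f 0) :=
  (exists_resolution_lift f a I J).choose_spec

lemma comp_iso_inv_hom_comp {C : Type*} [Category* C] {K I M J D D' : C} {p : K ⟶ I}
    {eG : D ≅ I} {q : I ⟶ J} {eF : D' ≅ J} {r : K ⟶ M} {s : M ⟶ J} (w : p ≫ q = r ≫ s) :
    (p ≫ eG.inv) ≫ eG.hom ≫ q ≫ eF.inv = r ≫ s ≫ eF.inv := by
  rw [Category.assoc, eG.inv_hom_id_assoc, reassoc_of% w]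

/-- The map `H^i_Z(Y, G) ⟶ H^i_{f⁻¹ Z}(X, F)` can be computed with arbitrary resolutions. -/
lemma toRightDerived_localCohomologyMap (hK : IsResolution K ε) (hM : IsResolution M ε')
    (s : K ⟶ ((TopCat.Sheaf.pushforward AddCommGrpCat.{u} f).mapHomologicalComplex
        (ComplexShape.up ℕ)).obj M)
    (hs : ε ≫ s.f 0 = a ≫ (TopCat.Sheaf.pushforward AddCommGrpCat.{u} f).map ε')
    (P : SupportPair Y) (Q : SupportPair X) (h : Q = P.comap f) (i : ℕ) :
    hK.toRightDerived (sectionsWithSupport P) i ≫ localCohomologyMap f a P Q h i =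
      HomologicalComplex.homologyMap (sectionsMap f P Q h s) i ≫
        hM.toRightDerived (sectionsWithSupport Q) i := by
  let fK := (TopCat.Sheaf.pushforward AddCommGrpCat.{u} f).mapHomologicalComplex
    (ComplexShape.up ℕ)
  let ΓP := (sectionsWithSupport P).mapHomologicalComplex (ComplexShape.up ℕ)
  let ΓQ := (sectionsWithSupport Q).mapHomologicalComplex (ComplexShape.up ℕ)
  let u := resolutionLift f a (injectiveResolution G) (injectiveResolution F)
  -- Both composites extend `a` followed by the augmentation of the direct image. The target
  -- consists of injectives, because direct images of injectives are injective, so the extensions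
  -- are homotopic.
  have H : Homotopy (hK.toInjectiveResolution ≫ u) (s ≫ fK.map hM.toInjectiveResolution) := by
    refine hK.homotopy (fun n => injective_pushforward f _) _ _ ?_
    have h₁ := hK.toInjectiveResolution_f_zero
    have h₂ := resolutionLift_spec f a (injectiveResolution G) (injectiveResolution F)
    have h₃ := congrArg (TopCat.Sheaf.pushforward AddCommGrpCat.{u} f).map
      hM.toInjectiveResolution_f_zero
    rw [Functor.map_comp] at h₃
    rw [HomologicalComplex.comp_f, HomologicalComplex.comp_f, ← Category.assoc,
      ← Category.assoc, h₁, hs]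
    refine h₂.trans ?_
    rw [← h₃]
    exact (Category.assoc _ _ _).symm
  have key : HomologicalComplex.homologyMap (ΓP.map hK.toInjectiveResolution) i ≫
      HomologicalComplex.homologyMap (ΓP.map u) i =
      HomologicalComplex.homologyMap (ΓP.map s) i ≫
      HomologicalComplex.homologyMap (ΓP.map (fK.map hM.toInjectiveResolution)) i := by
    rw [← HomologicalComplex.homologyMap_comp, ← HomologicalComplex.homologyMap_comp,
      ← Functor.map_comp, ← Functor.map_comp]
    exact ((sectionsWithSupport P).mapHomotopy H).homologyMap_eq i
  let ν (N : CochainComplex (TopCat.Sheaf AddCommGrpCat.{u} X) ℕ) :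
      ΓP.obj (fK.obj N) ⟶ ΓQ.obj N :=
    (NatTrans.mapHomologicalComplex (sectionsComparison f P Q h).hom (ComplexShape.up ℕ)).app N
  have nat : ΓP.map (fK.map hM.toInjectiveResolution) ≫ ν _ =
      ν M ≫ ΓQ.map hM.toInjectiveResolution :=
    (NatTrans.mapHomologicalComplex (sectionsComparison f P Q h).hom
      (ComplexShape.up ℕ)).naturality hM.toInjectiveResolution
  have final : HomologicalComplex.homologyMap (ΓP.map hK.toInjectiveResolution) i ≫
      HomologicalComplex.homologyMap (ΓP.map u ≫ ν _) i =
      HomologicalComplex.homologyMap (ΓP.map s ≫ ν M) i ≫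
      HomologicalComplex.homologyMap (ΓQ.map hM.toInjectiveResolution) i := by
    rw [HomologicalComplex.homologyMap_comp, HomologicalComplex.homologyMap_comp,
      reassoc_of% key, Category.assoc, ← HomologicalComplex.homologyMap_comp,
      ← HomologicalComplex.homologyMap_comp, nat, HomologicalComplex.homologyMap_comp,
      HomologicalComplex.homologyMap_comp]
  exact comp_iso_inv_hom_comp (eG := (injectiveResolution G).isoRightDerivedObj _ i)
    (eF := (injectiveResolution F).isoRightDerivedObj _ i) final

end LocalCohomologyMap

/-! ### The constructible topology of a spectral space -/

section Constructible

variable {Y Z : Type*} [TopologicalSpace Y] [TopologicalSpace Z]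

lemma isOpen_ofTopology_preimage {s : Set Y} (h : IsOpen s) (hc : IsCompact s) :
    IsOpen (WithTopology.ofTopology (t := constructibleTopology Y) ⁻¹' s) :=
  WithConstructibleTopology.isOpen_iff.2 (hc.isOpen_constructibleTopology_of_isOpen h)

/-- With `isOpen_ofTopology_preimage`, quasi-compact opens are clopen in the constructible topology.
Differences `V ∖ W` with `V` quasi-compact open and `W` open are then closed there, so that
compactness applies to them. -/
lemma isClosed_ofTopology_preimage {s : Set Y} (h : IsOpen s) (hc : IsCompact s) :
    IsClosed (WithTopology.ofTopology (t := constructibleTopology Y) ⁻¹' s) := by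
  rw [← isOpen_compl_iff]
  exact WithConstructibleTopology.isOpen_iff.2
    (IsCompact.isOpen_constructibleTopology_of_isClosed (s := sᶜ) (by rwa [compl_compl])
      h.isClosed_compl)

lemma continuous_ofConstructibleTopology [PrespectralSpace Y] :
    Continuous (WithTopology.ofTopology (t := constructibleTopology Y)) :=
  PrespectralSpace.isTopologicalBasis.continuous_iff.2
    fun _ hs => isOpen_ofTopology_preimage hs.1 hs.2

/-- Some quasi-compact open contains exactly one of two distinct points, and this set is clopen in
the constructible topology. -/
instance [T0Space Y] [PrespectralSpace Y] : T2Space (WithConstructibleTopology Y) where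
  t2 := by
    intro x y hxy
    have hne : x.ofTopology ≠ y.ofTopology := fun h => hxy (WithTopology.ofTopology_injective _ h)
    obtain ⟨U, hU, hxor⟩ := exists_isOpen_xor_mem hne
    rcases hxor with ⟨hx, hy⟩ | ⟨hy, hx⟩
    · obtain ⟨W, hW, hxW, hWU⟩ :=
        PrespectralSpace.isTopologicalBasis.exists_subset_of_mem_open hx hU
      exact ⟨_, _, isOpen_ofTopology_preimage hW.1 hW.2,
        (isClosed_ofTopology_preimage hW.1 hW.2).isOpen_compl, hxW, fun h => hy (hWU h),
        disjoint_compl_right⟩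
    · obtain ⟨W, hW, hyW, hWU⟩ :=
        PrespectralSpace.isTopologicalBasis.exists_subset_of_mem_open hy hU
      exact ⟨_, _, (isClosed_ofTopology_preimage hW.1 hW.2).isOpen_compl,
        isOpen_ofTopology_preimage hW.1 hW.2, fun h => hx (hWU h), hyW,
        disjoint_compl_left⟩

/-- A spectral map is continuous for the constructible topologies. -/
lemma _root_.IsSpectralMap.continuous_constructibleTopology {f : Y → Z} (hf : IsSpectralMap f) :
    Continuous (fun y : WithConstructibleTopology Y =>
      (WithTopology.toTopology (constructibleTopology Z) (f y.ofTopology))) := by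
  have h : @Continuous _ _ _ (constructibleTopology Z)
      (fun y : WithConstructibleTopology Y => f y.ofTopology) := by
    rw [continuous_generateFrom_iff]
    rintro s (⟨ho, hc⟩ | ⟨ho, hc⟩)
    · exact isOpen_ofTopology_preimage (s := f ⁻¹' s) (ho.preimage hf.continuous)
        (hf.isCompact_preimage_of_isOpen ho hc)
    · have := isClosed_ofTopology_preimage (s := f ⁻¹' sᶜ)
        (ho.isOpen_compl.preimage hf.continuous)
        (hf.isCompact_preimage_of_isOpen ho.isOpen_compl hc)
      rw [← isOpen_compl_iff] at this
      convert this using 1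
      ext x
      simp
  exact @Continuous.comp _ _ _ _ (constructibleTopology Z) _ _ _
    (WithTopology.continuous_toTopology _) h

end Constructible

/-! ### Inverse limits of spectral spaces -/

section SpectralLimit

variable {L : Type*} [Preorder L] {Y : L → Type*}
  [∀ l, TopologicalSpace (Y l)] [∀ l, SpectralSpace (Y l)]
  {v : ∀ ⦃l m : L⦄, l ≤ m → Y m → Y l}
  
/-- Equalizers of continuous maps into a Hausdorff space are closed; both properties hold for the
constructible topologies, not for the original ones. -/
lemma isClosed_compatible (hv : ∀ ⦃l m : L⦄ (h : l ≤ m), IsSpectralMap (v h)) {l m : L}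
    (h : l ≤ m) :
    IsClosed {x : ∀ l, WithConstructibleTopology (Y l) |
      v h (x m).ofTopology = (x l).ofTopology} := by
  have h₁ := (hv h).continuous_constructibleTopology.comp
    (continuous_apply (A := fun l => WithConstructibleTopology (Y l)) m)
  have h₂ := continuous_apply (A := fun l => WithConstructibleTopology (Y l)) l
  convert isClosed_eq h₁ h₂ using 1
  ext x
  exact ⟨fun e => congrArg (WithTopology.toTopology (constructibleTopology (Y l))) e,
    fun e => congrArg WithTopology.ofTopology e⟩

/-- If all members `v_{αl}⁻¹ C` of an inverse system of constructibly closed subsets are nonempty,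
so is their limit. -/
lemma exists_compatible_mem [IsDirectedOrder L]
    (hv : ∀ ⦃l m : L⦄ (h : l ≤ m), IsSpectralMap (v h))
    (v_trans : ∀ ⦃l m n : L⦄ (h : l ≤ m) (h' : m ≤ n) (y : Y n),
      v h (v h' y) = v (h.trans h') y)
    {α : L} (C : Set (Y α))
    (hC : IsClosed (WithTopology.ofTopology (t := constructibleTopology (Y α)) ⁻¹' C))
    (hne : ∀ ⦃m : L⦄ (h : α ≤ m), (v h ⁻¹' C).Nonempty) :
    ∃ x : ∀ l, Y l, (∀ ⦃l m : L⦄ (h : l ≤ m), v h (x m) = x l) ∧ x α ∈ C := by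
  classical
  -- Compatibility is imposed only on the indices below `m`, so one point of `Y m` suffices to
  -- produce an element. The sets decrease with `m`, and a point in their intersection is compatible
  -- throughout.
  let K (m : Set.Ici α) : Set (∀ l, WithConstructibleTopology (Y l)) :=
    {x | (∀ (l : L) (h : l ≤ m.1), v h (x m.1).ofTopology = (x l).ofTopology) ∧
      (x α).ofTopology ∈ C}
  have hcl (m : Set.Ici α) : IsClosed (K m) := by
    have : K m = (⋂ (l : L) (h : l ≤ m.1), {x : ∀ l, WithConstructibleTopology (Y l) |
        v h (x m.1).ofTopology = (x l).ofTopology}) ∩ {x | (x α).ofTopology ∈ C} := by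
      ext x
      simp [K]
    rw [this]
    exact (isClosed_iInter fun l => isClosed_iInter fun h => isClosed_compatible hv h).inter
      (hC.preimage (continuous_apply (A := fun l => WithConstructibleTopology (Y l)) α))
  have hnonempty (l : L) : Nonempty (Y l) := by
    obtain ⟨m, hm, hm'⟩ := exists_ge_ge α l
    obtain ⟨y, -⟩ := hne hm
    exact ⟨v hm' y⟩
  have hK (m : Set.Ici α) : (K m).Nonempty := by
    obtain ⟨y, hy⟩ := hne m.2
    -- Coordinates not below `m` are unconstrained in `K m` and receive an arbitrary value.
    refine ⟨fun l => .toTopology _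
      (if h : l ≤ m.1 then v h y else (hnonempty l).some), fun l h => ?_, ?_⟩
    · have e : v h (v (le_refl m.1) y) = v h y := v_trans _ _ _
      simpa [h] using e
    · have e : α ≤ m.1 := m.2
      simpa [e] using hy
  have hdir : Directed (· ⊇ ·) K := by
    intro m n
    obtain ⟨k, hk, hk'⟩ := exists_ge_ge m.1 n.1
    have key (m : Set.Ici α) (hk : m.1 ≤ k) : K ⟨k, le_trans m.2 hk⟩ ⊆ K m := by
      refine fun x hx => ⟨fun l h => ?_, hx.2⟩
      rw [← hx.1 l (h.trans hk), ← hx.1 m.1 hk, v_trans]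
    exact ⟨⟨k, le_trans m.2 hk⟩, key m hk, key n hk'⟩
  have : Nonempty (Set.Ici α) := ⟨⟨α, le_refl α⟩⟩
  obtain ⟨x, hx⟩ := IsCompact.nonempty_iInter_of_directed_nonempty_isCompact_isClosed K hdir hK
    (fun m => (hcl m).isCompact) hcl
  rw [Set.mem_iInter] at hx
  refine ⟨fun l => (x l).ofTopology, fun l m h => ?_, (hx ⟨α, le_refl α⟩).2⟩
  -- The index `m` need not lie above `α`, so compatibility is read off at a common upper bound.
  obtain ⟨k, hk, hk'⟩ := exists_ge_ge α m
  have h₁ := (hx ⟨k, hk⟩).1 m hk'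
  have h₂ := (hx ⟨k, hk⟩).1 l (h.trans hk')
  change v h (x m).ofTopology = (x l).ofTopology
  rw [← h₁, ← h₂, v_trans]

variable {X : Type*} [TopologicalSpace X] {π : ∀ l, X → Y l}

/-- The preimage in the limit of a quasi-compact open subset is quasi-compact. -/
lemma isCompact_preimage_of_limit (hv : ∀ ⦃l m : L⦄ (h : l ≤ m), IsSpectralMap (v h))
    (hind : ‹TopologicalSpace X› = ⨅ l, (inferInstance : TopologicalSpace (Y l)).induced (π l))
    (hπ : ∀ x : ∀ l, Y l, (∀ ⦃l m : L⦄ (h : l ≤ m), v h (x m) = x l) → ∃ y, ∀ l, π l y = x l)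
    (hw : ∀ ⦃l m : L⦄ (h : l ≤ m) (y : X), v h (π m y) = π l y)
    (hinj : ∀ y y' : X, (∀ l, π l y = π l y') → y = y')
    {l : L} {U : Set (Y l)} (hU : IsOpen U) (hc : IsCompact U) : IsCompact (π l ⁻¹' U) := by
  choose s hs using hπ
  -- `T` is the set of compatible families, closed in a product of compact spaces.
  let T : Set (∀ l, WithConstructibleTopology (Y l)) :=
    (⋂ (l : L) (m : L) (h : l ≤ m), {x | v h (x m).ofTopology = (x l).ofTopology})
  have hT : IsClosed T := isClosed_iInter fun l => isClosed_iInter fun m => isClosed_iInter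
    fun h => isClosed_compatible hv h
  have mem (x : T) ⦃l m : L⦄ (h : l ≤ m) : v h (x.1 m).ofTopology = (x.1 l).ofTopology := by
    have := x.2
    simp only [T, Set.mem_iInter] at this
    exact this l m h
  have : CompactSpace T := isCompact_iff_compactSpace.1 hT.isCompact
  let σ : T → X := fun x => s (fun l => (x.1 l).ofTopology) (mem x)
  -- The topology of `X` is induced by the projections, and the constructible topologies are finer
  -- than the original ones.
  have hσ : Continuous σ := by
    rw [hind, continuous_iInf_rng]
    intro k
    rw [continuous_induced_rng]
    have e : π k ∘ σ = fun x => (x.1 k).ofTopology := by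
      funext x
      exact hs _ (mem x) k
    rw [e]
    exact continuous_ofConstructibleTopology.comp
      ((continuous_apply (A := fun l => WithConstructibleTopology (Y l)) k).comp
        continuous_subtype_val)
  -- Since `U` is clopen for the constructible topology, the preimage is the continuous image of a
  -- closed part of the compact space `T`.
  have e : π l ⁻¹' U = σ '' {x : T | (x.1 l).ofTopology ∈ U} := by
    ext y
    constructor
    · intro hy
      refine ⟨⟨fun k => .toTopology _ (π k y), ?_⟩, hy, ?_⟩
      · simp only [T, Set.mem_iInter]
        exact fun l m h => hw h y
      · exact hinj _ _ fun k => hs _ _ k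
    · rintro ⟨x, hx, rfl⟩
      have : π l (σ x) = (x.1 l).ofTopology := hs _ (mem x) l
      rw [Set.mem_preimage, this]
      exact hx
  rw [e]
  refine IsCompact.image (IsClosed.isCompact ?_) hσ
  exact (isClosed_ofTopology_preimage hU hc).preimage
    ((continuous_apply (A := fun l => WithConstructibleTopology (Y l)) l).comp
        continuous_subtype_val)

end SpectralLimit

/-! ### The underlying space of a limit of ringed spaces -/

section Space

/-- A topological space with the zero sheaf of rings. -/
def zeroRinged (T : TopCat.{u}) : RingedSpace.{u, u} where
  carrier := T
  presheaf := (CategoryTheory.Functor.const _).obj (CommRingCat.of PUnit)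
  IsSheaf := Presheaf.isSheaf_of_isTerminal _ CommRingCat.punitIsTerminal

/-- A continuous map, as a morphism from the space with the zero sheaf of rings. -/
def zeroRingedHom {T : TopCat.{u}} {Y : RingedSpace.{u, u}} (f : T ⟶ Y.carrier) :
    zeroRinged T ⟶ Y where
  hom :=
    { base := f
      c := { app _ := CommRingCat.punitIsTerminal.from _
             naturality _ _ _ := CommRingCat.punitIsTerminal.hom_ext _ _ } }

/-- A ring has exactly one homomorphism to the zero ring, so a morphism out of `zeroRinged T` is
just a continuous map. Thus `zeroRinged` behaves as a left adjoint of the forgetful functor, which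
is why that functor preserves limits. -/
lemma zeroRinged_hom_ext {T : TopCat.{u}} {Y : RingedSpace.{u, u}} {f g : zeroRinged T ⟶ Y}
    (h : f.hom.base = g.hom.base) : f = g := by
  refine SheafedSpace.ext f g h ?_
  apply NatTrans.ext
  funext U
  exact CommRingCat.punitIsTerminal.hom_ext _ _

variable {J : Type u} [Category.{u} J] {X : J ⥤ RingedSpace.{u, u}} {c : Cone X}

/-- A cone of spaces, as a cone of ringed spaces whose vertex carries the zero sheaf of rings. -/
def zeroRingedCone (s : Cone (X ⋙ SheafedSpace.forget CommRingCat.{u})) : Cone X where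
  pt := zeroRinged s.pt
  π :=
    { app j := zeroRingedHom (s.π.app j)
      naturality _ _ f := zeroRinged_hom_ext (s.π.naturality f) }

/-- The underlying space of a limit of ringed spaces is the limit of the underlying spaces. -/
def isLimitSpace (hc : IsLimit c) : IsLimit ((SheafedSpace.forget CommRingCat.{u}).mapCone c) where
  lift s := (hc.lift (zeroRingedCone s)).hom.base
  fac s j := congrArg (fun f : zeroRinged s.pt ⟶ X.obj j => f.hom.base)
    (hc.fac (zeroRingedCone s) j)
  uniq s m hm :=
    congrArg (fun f : zeroRinged s.pt ⟶ c.pt => f.hom.base)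
      (hc.uniq (zeroRingedCone s) (zeroRingedHom m) fun j => zeroRinged_hom_ext (hm j))

end Space

/-! ### Quasi-compact open subsets of a limit -/

/-- The map on opens given by a projection from a cone. -/
abbrev projOpens {L : Type u} [Preorder L] {X : Lᵒᵖ ⥤ RingedSpace.{u, u}} (c : Cone X) (l : L) :
    Opens (X.obj (op l)).carrier ⥤ Opens c.pt.carrier :=
  Opens.map (c.π.app (op l)).hom.base

/-- The map on opens given by a transition morphism. -/
abbrev transOpens {L : Type u} [Preorder L] (X : Lᵒᵖ ⥤ RingedSpace.{u, u}) {l m : L} (h : l ≤ m) :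
    Opens (X.obj (op l)).carrier ⥤ Opens (X.obj (op m)).carrier :=
  Opens.map (transition X h).hom.base

section Limit

variable {L : Type u} [Preorder L] {X : Lᵒᵖ ⥤ RingedSpace.{u, u}} {c : Cone X}

lemma proj_base (c : Cone X) {l m : L} (h : l ≤ m) (x : c.pt.carrier) :
    (transition X h).hom.base ((c.π.app (op m)).hom.base x) = (c.π.app (op l)).hom.base x :=
  congrArg (fun f : c.pt ⟶ X.obj (op l) => f.hom.base x) (proj_transition c h)

lemma transition_base (X : Lᵒᵖ ⥤ RingedSpace.{u, u}) {l m n : L} (h : l ≤ m) (h' : m ≤ n)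
    (x : (X.obj (op n)).carrier) :
    (transition X h).hom.base ((transition X h').hom.base x) =
      (transition X (h.trans h')).hom.base x :=
  congrArg (fun f : X.obj (op n) ⟶ X.obj (op l) => f.hom.base x) (transition_trans X h h')

lemma projOpens_transOpens (c : Cone X) {l m : L} (h : l ≤ m)
    (V : Opens (X.obj (op l)).carrier) :
    (projOpens c m).obj ((transOpens X h).obj V) = (projOpens c l).obj V := by
  ext x
  change (transition X h).hom.base ((c.π.app (op m)).hom.base x) ∈ V ↔ _
  rw [proj_base]
  rfl

lemma transOpens_transOpens (X : Lᵒᵖ ⥤ RingedSpace.{u, u}) {l m n : L} (h : l ≤ m) (h' : m ≤ n)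
    (V : Opens (X.obj (op l)).carrier) :
    (transOpens X h').obj ((transOpens X h).obj V) = (transOpens X (h.trans h')).obj V := by
  ext x
  change (transition X h).hom.base ((transition X h').hom.base x) ∈ V ↔ _
  rw [transition_base]
  rfl

lemma transOpens_refl (X : Lᵒᵖ ⥤ RingedSpace.{u, u}) (l : L)
    (V : Opens (X.obj (op l)).carrier) : (transOpens X (le_refl l)).obj V = V := by
  ext x
  change (transition X (le_refl l)).hom.base x ∈ V ↔ _
  rw [transition_refl]
  rfl

lemma limit_topology_eq (hc : IsLimit c) :
    c.pt.carrier.str = ⨅ l : L, TopologicalSpace.induced (c.π.app (op l)).hom.base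
      (X.obj (op l)).carrier.str := by
  have h := TopCat.induced_of_isLimit _ (isLimitSpace hc)
  refine h.trans ?_
  exact (Equiv.iInf_comp (g := fun j : Lᵒᵖ => TopologicalSpace.induced
    (fun x : c.pt.carrier => (c.π.app j).hom.base x)
    (X.obj j).carrier.str) Opposite.equivToOpposite).symm

/-- A compatible family is a cone with vertex a one-point space. -/
lemma exists_limit_point (hc : IsLimit c) (x : ∀ l : L, (X.obj (op l)).carrier)
    (hx : ∀ ⦃l m : L⦄ (h : l ≤ m), (transition X h).hom.base (x m) = x l) :
    ∃ y : c.pt.carrier, ∀ l, (c.π.app (op l)).hom.base y = x l := by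
  let s : Cone (X ⋙ SheafedSpace.forget CommRingCat.{u}) :=
    { pt := TopCat.of PUnit
      π :=
        { app j := TopCat.ofHom (ContinuousMap.const _ (x j.unop))
          naturality i j f := by
            ext
            exact (hx (leOfHom f.unop)).symm } }
  refine ⟨(isLimitSpace hc).lift s PUnit.unit, fun l => ?_⟩
  exact ConcreteCategory.congr_hom ((isLimitSpace hc).fac s (op l)) PUnit.unit

lemma limit_point_ext (hc : IsLimit c) (y y' : c.pt.carrier)
    (h : ∀ l : L, (c.π.app (op l)).hom.base y = (c.π.app (op l)).hom.base y') : y = y' := by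
  have := (isLimitSpace hc).hom_ext
    (f := (TopCat.ofHom (ContinuousMap.const PUnit.{u + 1} y)))
    (f' := (TopCat.ofHom (ContinuousMap.const PUnit.{u + 1} y'))) (fun j => by
      ext
      exact h j.unop)
  exact ConcreteCategory.congr_hom this PUnit.unit

lemma isCompact_transOpens (hv : ∀ (l m : L) (h : l ≤ m), IsSpectralMap (transition X h).hom.base)
    {l m : L} (h : l ≤ m) {V : Opens (X.obj (op l)).carrier}
    (hV : IsCompact (V : Set (X.obj (op l)).carrier)) :
    IsCompact ((transOpens X h).obj V : Set (X.obj (op m)).carrier) :=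
  (hv l m h).isCompact_preimage_of_isOpen V.isOpen hV

lemma isCompact_projOpens (hc : IsLimit c) (hX : ∀ l : L, SpectralSpace (X.obj (op l)).carrier)
    (hv : ∀ (l m : L) (h : l ≤ m), IsSpectralMap (transition X h).hom.base)
    {l : L} {V : Opens (X.obj (op l)).carrier} (hV : IsCompact (V : Set (X.obj (op l)).carrier)) :
    IsCompact ((projOpens c l).obj V : Set c.pt.carrier) :=
  isCompact_preimage_of_limit (Y := fun l => (X.obj (op l)).carrier)
    (v := fun _ _ h => (transition X h).hom.base)
    (π := fun l (x : c.pt.carrier) => (c.π.app (op l)).hom.base x)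
    (fun _ _ h => hv _ _ h) (limit_topology_eq hc) (fun x hx => exists_limit_point hc x hx)
    (fun _ _ h y => proj_base c h y) (limit_point_ext hc) V.isOpen hV

variable [IsDirectedOrder L]

/-- An inclusion between the preimages in the limit of a quasi-compact open and of an open subset
of one of the spaces holds at a later stage. -/
lemma exists_transOpens_le (hc : IsLimit c)
    (hX : ∀ l : L, SpectralSpace (X.obj (op l)).carrier)
    (hv : ∀ (l m : L) (h : l ≤ m), IsSpectralMap (transition X h).hom.base)
    {l : L} {V W : Opens (X.obj (op l)).carrier} (hV : IsCompact (V : Set (X.obj (op l)).carrier))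
    (h : (projOpens c l).obj V ≤ (projOpens c l).obj W) :
    ∃ (m : L) (hm : l ≤ m), (transOpens X hm).obj V ≤ (transOpens X hm).obj W := by
  by_contra hcon
  -- If the inclusion fails at every later stage, `V ∖ W` has nonempty preimage at each of them. The
  -- resulting compatible family is a point of the limit lying over `V` but not over `W`.
  have hne : ∀ ⦃m : L⦄ (hm : l ≤ m),
      ((transition X hm).hom.base ⁻¹' ((V : Set (X.obj (op l)).carrier) \ W)).Nonempty := by
    intro m hm
    have h' : ¬ ((transOpens X hm).obj V ≤ (transOpens X hm).obj W) := fun h' => hcon ⟨m, hm, h'⟩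
    obtain ⟨x, hx, hx'⟩ := Set.not_subset.1 h'
    exact ⟨x, hx, hx'⟩
  have hcl : IsClosed (WithTopology.ofTopology
      (t := constructibleTopology (X.obj (op l)).carrier) ⁻¹'
        ((V : Set (X.obj (op l)).carrier) \ W)) :=
    (isClosed_ofTopology_preimage V.isOpen hV).inter
      (W.isOpen.preimage continuous_ofConstructibleTopology).isClosed_compl
  obtain ⟨x, hx, hxl⟩ := exists_compatible_mem (Y := fun l => (X.obj (op l)).carrier)
    (v := fun _ _ h => (transition X h).hom.base) (fun _ _ h => hv _ _ h)
    (fun _ _ _ h h' y => transition_base X h h' y) _ hcl hne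
  obtain ⟨y, hy⟩ := exists_limit_point hc x hx
  have hyV : y ∈ (projOpens c l).obj V := by
    change (c.π.app (op l)).hom.base y ∈ V
    rw [hy]
    exact hxl.1
  have hyW : (c.π.app (op l)).hom.base y ∈ W := h hyV
  rw [hy] at hyW
  exact hxl.2 hyW

variable [Nonempty L]

/-- In a cofiltered limit the preimages of basic opens form a basis, provided the bases are stable
under finite intersections and transition maps. For quasi-compact opens this is what spectrality of
the spaces and of the maps gives. -/
lemma exists_stage_le (hc : IsLimit c) (hX : ∀ l : L, SpectralSpace (X.obj (op l)).carrier)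
    (hv : ∀ (l m : L) (h : l ≤ m), IsSpectralMap (transition X h).hom.base)
    (W : Opens c.pt.carrier) (x : c.pt.carrier) (hx : x ∈ W) :
    ∃ (l : L) (V : Opens (X.obj (op l)).carrier), IsCompact (V : Set (X.obj (op l)).carrier) ∧
      x ∈ (projOpens c l).obj V ∧ (projOpens c l).obj V ≤ W := by
  have B := TopCat.isTopologicalBasis_cofiltered_limit.{u, u, u} _ _ (isLimitSpace hc)
    (fun j => {U : Set (X.obj j).carrier | IsOpen U ∧ IsCompact U})
    (fun j => (hX j.unop).isTopologicalBasis)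
    (fun j => ⟨isOpen_univ, (hX j.unop).isCompact_univ⟩)
    (fun j U₁ U₂ h₁ h₂ => ⟨h₁.1.inter h₂.1,
      (hX j.unop).inter_isCompact U₁ U₂ h₁.1 h₁.2 h₂.1 h₂.2⟩)
    (fun i j f V hV => ⟨hV.1.preimage (X.map f).hom.base.hom.continuous,
      (hv _ _ (leOfHom f.unop)).isCompact_preimage_of_isOpen hV.1 hV.2⟩)
  obtain ⟨_, ⟨j, V, hV, rfl⟩, hxV, hVW⟩ := B.exists_subset_of_mem_open hx W.isOpen
  exact ⟨j.unop, ⟨V, hV.1⟩, hV.2, hxV, hVW⟩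

/-- Every quasi-compact open subset of the limit comes from a stage. -/
lemma exists_projOpens_eq (hc : IsLimit c)
    (hX : ∀ l : L, SpectralSpace (X.obj (op l)).carrier)
    (hv : ∀ (l m : L) (h : l ≤ m), IsSpectralMap (transition X h).hom.base)
    (W : Opens c.pt.carrier) (hW : IsCompact (W : Set c.pt.carrier)) :
    ∃ (l : L) (V : Opens (X.obj (op l)).carrier), IsCompact (V : Set (X.obj (op l)).carrier) ∧
      (projOpens c l).obj V = W := by
  -- The induction is on sets covered by one open of one stage inside `W`; directedness allows two
  -- such opens to be joined.
  let p (T : Set c.pt.carrier) : Prop := ∃ (l : L) (V : Opens (X.obj (op l)).carrier),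
    IsCompact (V : Set (X.obj (op l)).carrier) ∧ T ⊆ (projOpens c l).obj V ∧
      (projOpens c l).obj V ≤ W
  have hp : p W := by
    refine hW.induction_on (p := p) ?_ ?_ ?_ ?_
    · refine ⟨Classical.arbitrary L, ⊥, isCompact_empty, Set.empty_subset _, ?_⟩
      exact fun _ h => h.elim
    · rintro S T h ⟨l, V, hV, hT, hle⟩
      exact ⟨l, V, hV, h.trans hT, hle⟩
    · rintro S T ⟨l, V, hV, hS, hle⟩ ⟨l', V', hV', hT, hle'⟩
      obtain ⟨m, hm, hm'⟩ := exists_ge_ge l l'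
      refine ⟨m, (transOpens X hm).obj V ⊔ (transOpens X hm').obj V',
        (isCompact_transOpens hv hm hV).union (isCompact_transOpens hv hm' hV'), ?_, ?_⟩
      · rintro x (hx | hx)
        · have := hS hx
          rw [← projOpens_transOpens c hm] at this
          exact Or.inl this
        · have := hT hx
          rw [← projOpens_transOpens c hm'] at this
          exact Or.inr this
      · rintro x (hx | hx)
        · exact hle (projOpens_transOpens c hm V ▸ hx)
        · exact hle' (projOpens_transOpens c hm' V' ▸ hx)
    · intro x hx
      obtain ⟨l, V, hV, hxV, hle⟩ := exists_stage_le hc hX hv W x hx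
      exact ⟨(projOpens c l).obj V, mem_nhdsWithin_of_mem_nhds
        (((projOpens c l).obj V).isOpen.mem_nhds hxV), l, V, hV, subset_rfl, hle⟩
  obtain ⟨l, V, hV, h, h'⟩ := hp
  exact ⟨l, V, hV, le_antisymm h' h⟩

/-- Both opens descend to a common stage, whose space is quasi-separated. -/
lemma isCompact_inter_of_limit (hc : IsLimit c)
    (hX : ∀ l : L, SpectralSpace (X.obj (op l)).carrier)
    (hv : ∀ (l m : L) (h : l ≤ m), IsSpectralMap (transition X h).hom.base)
    (W W' : Opens c.pt.carrier) (hW : IsCompact (W : Set c.pt.carrier))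
    (hW' : IsCompact (W' : Set c.pt.carrier)) :
    IsCompact ((W ⊓ W' : Opens c.pt.carrier) : Set c.pt.carrier) := by
  obtain ⟨l, V, hV, rfl⟩ := exists_projOpens_eq hc hX hv W hW
  obtain ⟨l', V', hV', rfl⟩ := exists_projOpens_eq hc hX hv W' hW'
  obtain ⟨m, hm, hm'⟩ := exists_ge_ge l l'
  rw [← projOpens_transOpens c hm, ← projOpens_transOpens c hm']
  have h := (hX m).inter_isCompact _ _ ((transOpens X hm).obj V).isOpen
    (isCompact_transOpens hv hm hV) ((transOpens X hm').obj V').isOpen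
    (isCompact_transOpens hv hm' hV')
  exact isCompact_projOpens hc hX hv
    (V := (transOpens X hm).obj V ⊓ (transOpens X hm').obj V') h

/-- A support pair with quasi-compact members on the limit comes from a stage. -/
theorem exists_stage_supportPair (hc : IsLimit c)
    (hX : ∀ l : L, SpectralSpace (X.obj (op l)).carrier)
    (hv : ∀ (l m : L) (h : l ≤ m), IsSpectralMap (transition X h).hom.base)
    (P : SupportPair c.pt.carrier) (hU : IsCompact (P.U : Set c.pt.carrier))
    (hUZ : IsCompact ((P.U : Set c.pt.carrier) \ P.Z)) :
    ∃ (α : L) (Pα : SupportPair (X.obj (op α)).carrier),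
      IsCompact (Pα.U : Set (X.obj (op α)).carrier) ∧
      IsCompact ((Pα.U : Set (X.obj (op α)).carrier) \ Pα.Z) ∧
      P = Pα.comap (c.π.app (op α)).hom.base := by
  obtain ⟨l, V, hV, hVU⟩ := exists_projOpens_eq hc hX hv P.U hU
  obtain ⟨l', V', hV', hVU'⟩ := exists_projOpens_eq hc hX hv P.compl hUZ
  obtain ⟨m, hm, hm'⟩ := exists_ge_ge l l'
  let A := (transOpens X hm).obj V
  -- The two descended opens need not be nested at stage `m`. Intersecting with `A` forces `B ≤ A`
  -- and changes nothing in the limit; `A ∖ B` is the required closed set.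
  let B := (transOpens X hm').obj V' ⊓ A
  have hA : IsCompact (A : Set (X.obj (op m)).carrier) := isCompact_transOpens hv hm hV
  have hB : IsCompact (B : Set (X.obj (op m)).carrier) :=
    (hX m).inter_isCompact _ _ ((transOpens X hm').obj V').isOpen
      (isCompact_transOpens hv hm' hV') A.isOpen hA
  have hpA : (projOpens c m).obj A = P.U := (projOpens_transOpens c hm V).trans hVU
  have hpB : (projOpens c m).obj B = P.compl := by
    have e : (projOpens c m).obj B =
        (projOpens c m).obj ((transOpens X hm').obj V') ⊓ (projOpens c m).obj A := rfl
    rw [e, projOpens_transOpens, hVU', hpA]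
    exact inf_eq_left.2 P.compl_le
  have hdiff : (A : Set (X.obj (op m)).carrier) \ ((A : Set (X.obj (op m)).carrier) \ B) = B := by
    rw [Set.sdiff_sdiff_cancel_left]
    exact fun x hx => hx.2
  refine ⟨m, ⟨A, (A : Set (X.obj (op m)).carrier) \ B, Set.sdiff_subset, ?_⟩, hA, ?_, ?_⟩
  · have : (fun x : A => (x : (X.obj (op m)).carrier)) ⁻¹'
        ((A : Set (X.obj (op m)).carrier) \ B) = (Subtype.val ⁻¹' (B : Set _))ᶜ := by
      ext x
      simp
    rw [this]
    exact (B.isOpen.preimage continuous_subtype_val).isClosed_compl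
  · change IsCompact ((A : Set (X.obj (op m)).carrier) \ ((A : Set (X.obj (op m)).carrier) \ B))
    rw [hdiff]
    exact hB
  · refine SupportPair.ext hpA.symm ?_
    have hZ : P.Z = (P.U : Set c.pt.carrier) \ P.compl := by
      change P.Z = (P.U : Set c.pt.carrier) \ ((P.U : Set c.pt.carrier) \ P.Z)
      rw [Set.sdiff_sdiff_cancel_left P.subset]
    rw [hZ, ← hpA, ← hpB]
    rfl

end Limit

/-! ### Sections of presheaves of abelian groups -/

section Sections

variable {T : TopCat.{u}}

/-- Restriction of sections. -/
def res (F : (Opens T)ᵒᵖ ⥤ AddCommGrpCat.{u}) {V W : Opens T} (h : V ≤ W) :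
    F.obj (op W) →+ F.obj (op V) :=
  (F.map (homOfLE h).op).hom

/-- The map on sections over `W`. -/
def secMap {F G : (Opens T)ᵒᵖ ⥤ AddCommGrpCat.{u}} (a : F ⟶ G) (W : Opens T) :
    F.obj (op W) →+ G.obj (op W) :=
  (a.app (op W)).hom

@[simp]
lemma res_refl (F : (Opens T)ᵒᵖ ⥤ AddCommGrpCat.{u}) {W : Opens T} (h : W ≤ W)
    (s : F.obj (op W)) : res F h s = s :=
  ConcreteCategory.congr_hom (F.map_id (op W)) s

@[simp]
lemma res_res (F : (Opens T)ᵒᵖ ⥤ AddCommGrpCat.{u}) {U V W : Opens T} (h : U ≤ V) (h' : V ≤ W)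
    (s : F.obj (op W)) : res F h (res F h' s) = res F (h.trans h') s :=
  (ConcreteCategory.congr_hom (F.map_comp (homOfLE h').op (homOfLE h).op) s).symm

lemma secMap_res {F G : (Opens T)ᵒᵖ ⥤ AddCommGrpCat.{u}} (a : F ⟶ G) {V W : Opens T} (h : V ≤ W)
    (s : F.obj (op W)) : secMap a V (res F h s) = res G h (secMap a W s) :=
  ConcreteCategory.congr_hom (a.naturality (homOfLE h).op) s

lemma secMap_comp {F G H : (Opens T)ᵒᵖ ⥤ AddCommGrpCat.{u}} (a : F ⟶ G) (b : G ⟶ H)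
    (W : Opens T) (s : F.obj (op W)) : secMap (a ≫ b) W s = secMap b W (secMap a W s) :=
  rfl

/-- Sections of a sheaf agree if they agree locally. -/
lemma section_ext (F : TopCat.Sheaf AddCommGrpCat.{u} T) {W : Opens T} (s t : F.obj.obj (op W))
    (h : ∀ x ∈ W, ∃ (V : Opens T) (hV : V ≤ W), x ∈ V ∧ res F.obj hV s = res F.obj hV t) :
    s = t := by
  choose V hV hx e using h
  refine F.eq_of_locally_eq' (fun x : W => V x.1 x.2) W (fun x => homOfLE (hV x.1 x.2)) ?_ s t
    (fun x => e x.1 x.2)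
  intro x hxW
  exact Opens.mem_iSup.2 ⟨⟨x, hxW⟩, hx x hxW⟩

lemma section_ext_sup (F : TopCat.Sheaf AddCommGrpCat.{u} T) {W V V' : Opens T}
    (hV : V ≤ W) (hV' : V' ≤ W) (hW : W ≤ V ⊔ V')
    (s t : F.obj.obj (op W)) (h : res F.obj hV s = res F.obj hV t)
    (h' : res F.obj hV' s = res F.obj hV' t) : s = t := by
  refine section_ext F s t fun x hx => ?_
  rcases hW hx with hx | hx
  · exact ⟨V, hV, hx, h⟩
  · exact ⟨V', hV', hx, h'⟩

lemma subsingleton_sections_bot (F : TopCat.Sheaf AddCommGrpCat.{u} T) :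
    Subsingleton (F.obj.obj (op (⊥ : Opens T))) :=
  ⟨fun s t => section_ext F s t fun _ hx => hx.elim⟩

/-- Gluing of a compatible family of sections. -/
lemma exists_glue (F : TopCat.Sheaf AddCommGrpCat.{u} T) {ι : Type u} (V : ι → Opens T)
    (W : Opens T) (hV : ∀ i, V i ≤ W) (hW : W ≤ iSup V) (s : ∀ i, F.obj.obj (op (V i)))
    (hs : ∀ i j, res F.obj (inf_le_left : V i ⊓ V j ≤ V i) (s i) =
      res F.obj (inf_le_right : V i ⊓ V j ≤ V j) (s j)) :
    ∃ t : F.obj.obj (op W), ∀ i, res F.obj (hV i) t = s i := by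
  obtain ⟨t, ht, -⟩ := F.existsUnique_gluing' V W (fun i => homOfLE (hV i)) hW s hs
  exact ⟨t, ht⟩

lemma exists_glue_sup (F : TopCat.Sheaf AddCommGrpCat.{u} T) {V V' : Opens T}
    (s : F.obj.obj (op V)) (s' : F.obj.obj (op V'))
    (h : res F.obj (inf_le_left : V ⊓ V' ≤ V) s = res F.obj (inf_le_right : V ⊓ V' ≤ V') s') :
    ∃ t : F.obj.obj (op (V ⊔ V')), res F.obj le_sup_left t = s ∧ res F.obj le_sup_right t = s' := by
  let U : ULift.{u} Bool → Opens T := fun b => if b.down then V else V'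
  let sf : ∀ b, F.obj.obj (op (U b)) := fun
    | ⟨true⟩ => s
    | ⟨false⟩ => s'
  have hle : ∀ b, U b ≤ V ⊔ V' := fun
    | ⟨true⟩ => le_sup_left
    | ⟨false⟩ => le_sup_right
  obtain ⟨t, ht⟩ := exists_glue F U (V ⊔ V') hle
    (sup_le (le_iSup U ⟨true⟩) (le_iSup U ⟨false⟩)) sf (by
      rintro ⟨_ | _⟩ ⟨_ | _⟩
      · rfl
      · have h' := congrArg (res F.obj (le_inf inf_le_right inf_le_left : V' ⊓ V ≤ V ⊓ V')) h
        rw [res_res, res_res] at h'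
        exact h'.symm
      · exact h
      · rfl)
  exact ⟨t, ht ⟨true⟩, ht ⟨false⟩⟩

variable {S : ShortComplex (TopCat.Sheaf AddCommGrpCat.{u} T)}

lemma secMap_injective_of_mono {F G : TopCat.Sheaf AddCommGrpCat.{u} T} (a : F ⟶ G) [Mono a]
    (W : Opens T) : Function.Injective (secMap a.hom W) := by
  have : Mono a.hom := inferInstanceAs (Mono ((TopCat.Sheaf.forget AddCommGrpCat.{u} T).map a))
  have := (NatTrans.mono_iff_mono_app a.hom).1 this (op W)
  exact (AddCommGrpCat.mono_iff_injective _).1 this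

lemma exists_secMap_eq_of_shortExact (hS : S.ShortExact) {W : Opens T} (s : S.X₂.obj.obj (op W))
    (h : secMap S.g.hom W s = 0) : ∃ t, secMap S.f.hom W t = s := by
  have := hS.mono_f
  exact TopCat.Sheaf.sections_exact_of_left_exact hS.1 hS.2 s h

lemma secMap_secMap_of_shortComplex {W : Opens T} (s : S.X₁.obj.obj (op W)) :
    secMap S.g.hom W (secMap S.f.hom W s) = 0 :=
  congrArg (fun a : S.X₁ ⟶ S.X₃ => secMap a.hom W s) S.zero

lemma exists_local_lift {F G : TopCat.Sheaf AddCommGrpCat.{u} T} (g : F ⟶ G) [hg : Epi g]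
    {W : Opens T} (s : G.obj.obj (op W)) (x : T) (hx : x ∈ W) :
    ∃ (V : Opens T) (h : V ≤ W) (t : F.obj.obj (op V)), x ∈ V ∧
      secMap g.hom V t = res G.obj h s := by
  have := (TopCat.Sheaf.isLocallySurjective_iff_epi g).mpr hg
  obtain ⟨V, h, ⟨t, ht⟩, hV⟩ := (TopCat.Presheaf.isLocallySurjective_iff g.hom).mp this W s x hx
  exact ⟨V, h, t, hV, ht⟩

end Sections

/-! ### Quasi-flasque sheaves -/

section QuasiFlasque

variable {T : TopCat.{u}}

/-- A sheaf whose restriction maps between quasi-compact open subsets are surjective. -/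
def IsQuasiFlasque : ObjectProperty (TopCat.Sheaf AddCommGrpCat.{u} T) := fun F =>
  ∀ (V W : Opens T) (h : V ≤ W), IsCompact (V : Set T) → IsCompact (W : Set T) →
    Function.Surjective (res F.obj h)

variable (T) in
/-- The space has a basis of quasi-compact open subsets, stable under intersections. -/
structure HasCompactBasis : Prop where
  exists_le (W : Opens T) (x : T) (hx : x ∈ W) :
    ∃ V : Opens T, IsCompact (V : Set T) ∧ x ∈ V ∧ V ≤ W
  inter (V W : Opens T) (hV : IsCompact (V : Set T)) (hW : IsCompact (W : Set T)) :
    IsCompact ((V ⊓ W : Opens T) : Set T)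

variable {S : ShortComplex (TopCat.Sheaf AddCommGrpCat.{u} T)}

/-- On the overlap the two lifts differ by a section of `S.X₁`, which extends to `W'` because the
overlap is quasi-compact. Only `t'` is corrected, so the lift over `W` is kept unchanged. -/
lemma exists_lift_sup (hT : HasCompactBasis T) (hS : S.ShortExact) (h₁ : IsQuasiFlasque S.X₁)
    {W W' : Opens T} (hW : IsCompact (W : Set T)) (hW' : IsCompact (W' : Set T))
    (s : S.X₃.obj.obj (op (W ⊔ W'))) (t : S.X₂.obj.obj (op W)) (t' : S.X₂.obj.obj (op W'))
    (ht : secMap S.g.hom W t = res S.X₃.obj le_sup_left s)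
    (ht' : secMap S.g.hom W' t' = res S.X₃.obj le_sup_right s) :
    ∃ r : S.X₂.obj.obj (op (W ⊔ W')), secMap S.g.hom _ r = s ∧
      res S.X₂.obj le_sup_left r = t := by
  obtain ⟨a, ha⟩ := exists_secMap_eq_of_shortExact hS
    (res S.X₂.obj (inf_le_left : W ⊓ W' ≤ W) t - res S.X₂.obj (inf_le_right : W ⊓ W' ≤ W') t') (by
      rw [map_sub, secMap_res, secMap_res, ht, ht', res_res, res_res, sub_self])
  obtain ⟨b, hb⟩ := h₁ _ _ (inf_le_right : W ⊓ W' ≤ W') (hT.inter W W' hW hW') hW' a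
  obtain ⟨r, hr, hr'⟩ := exists_glue_sup S.X₂ t (t' + secMap S.f.hom W' b) (by
    rw [map_add, ← secMap_res, hb, ha, add_sub_cancel])
  refine ⟨r, ?_, hr⟩
  refine section_ext_sup S.X₃ le_sup_left le_sup_right le_rfl _ _ ?_ ?_
  · rw [← secMap_res, hr, ht]
  · rw [← secMap_res, hr', map_add, secMap_secMap_of_shortComplex, add_zero, ht']

/-- In a short exact sequence whose kernel is quasi-flasque, a section over a quasi-compact open
subset lifts, with a prescribed lift over a smaller quasi-compact open subset. -/
lemma exists_lift_extending (hT : HasCompactBasis T) (hS : S.ShortExact)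
    (h₁ : IsQuasiFlasque S.X₁) {D W : Opens T} (h : D ≤ W) (hD : IsCompact (D : Set T))
    (hW : IsCompact (W : Set T)) (s : S.X₃.obj.obj (op W)) (t : S.X₂.obj.obj (op D))
    (ht : secMap S.g.hom D t = res S.X₃.obj h s) :
    ∃ r : S.X₂.obj.obj (op W), secMap S.g.hom W r = s ∧ res S.X₂.obj h r = t := by
  have := hS.epi_g
  -- The lift is required over an open set containing `D`, and to extend `t`. The induction
  -- therefore starts at `D` itself and never alters the prescribed values.
  let p (A : Set T) : Prop := ∃ (V : Opens T) (hV : V ≤ W) (hDV : D ≤ V)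
    (r : S.X₂.obj.obj (op V)), IsCompact (V : Set T) ∧ A ⊆ V ∧
      secMap S.g.hom V r = res S.X₃.obj hV s ∧ res S.X₂.obj hDV r = t
  have hp : p W := by
    refine hW.induction_on (p := p) ?_ ?_ ?_ ?_
    · exact ⟨D, h, le_rfl, t, hD, Set.empty_subset _, ht, res_refl _ _ _⟩
    · rintro A B hAB ⟨V, hV, hDV, r, hVc, hB, hr, hr'⟩
      exact ⟨V, hV, hDV, r, hVc, hAB.trans hB, hr, hr'⟩
    · rintro A B ⟨V, hV, hDV, r, hVc, hA, hr, hr'⟩ ⟨V', hV', hDV', q, hVc', hB, hq, hq'⟩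
      obtain ⟨b, hb, hb'⟩ := exists_lift_sup hT hS h₁ hVc hVc'
        (res S.X₃.obj (sup_le hV hV') s) r q (by rw [hr, res_res]) (by rw [hq, res_res])
      refine ⟨V ⊔ V', sup_le hV hV', hDV.trans le_sup_left, b, hVc.union hVc',
        Set.union_subset_union hA hB, hb, ?_⟩
      rw [← hr', ← hb', res_res]
    · intro x hx
      obtain ⟨V, hV, q, hxV, hq⟩ := exists_local_lift S.g s x hx
      obtain ⟨V', hVc', hxV', hV'⟩ := hT.exists_le V x hxV
      obtain ⟨b, hb, hb'⟩ := exists_lift_sup hT hS h₁ hD hVc'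
        (res S.X₃.obj (sup_le h (hV'.trans hV)) s) t (res S.X₂.obj hV' q)
        (by rw [ht, res_res]) (by rw [secMap_res, hq, res_res, res_res])
      exact ⟨V', mem_nhdsWithin_of_mem_nhds (V'.isOpen.mem_nhds hxV'), D ⊔ V',
        sup_le h (hV'.trans hV), le_sup_left, b, hD.union hVc', Set.subset_union_right, hb, hb'⟩
  obtain ⟨V, hV, hDV, r, -, hWV, hr, hr'⟩ := hp
  obtain rfl : V = W := le_antisymm hV hWV
  exact ⟨r, hr.trans (res_refl _ _ _), hr'⟩

/-- The case `D = ⊥` of `exists_lift_extending`. -/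
lemma secMap_surjective (hT : HasCompactBasis T) (hS : S.ShortExact) (h₁ : IsQuasiFlasque S.X₁)
    {W : Opens T} (hW : IsCompact (W : Set T)) : Function.Surjective (secMap S.g.hom W) := by
  intro s
  have := subsingleton_sections_bot S.X₃
  obtain ⟨r, hr, -⟩ := exists_lift_extending hT hS h₁ (bot_le : ⊥ ≤ W) isCompact_empty hW s 0
    (Subsingleton.elim _ _)
  exact ⟨r, hr⟩

/-- A section of the quotient over `V` lifts to `S.X₂`, extends there to `W`, and can be mapped
back. -/
lemma IsQuasiFlasque.quotient (hT : HasCompactBasis T) (hS : S.ShortExact)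
    (h₁ : IsQuasiFlasque S.X₁) (h₂ : IsQuasiFlasque S.X₂) : IsQuasiFlasque S.X₃ := by
  intro V W h hV hW s
  obtain ⟨t, rfl⟩ := secMap_surjective hT hS h₁ hV s
  obtain ⟨r, rfl⟩ := h₂ V W h hV hW t
  exact ⟨secMap S.g.hom W r, (secMap_res _ _ _).symm⟩

lemma isQuasiFlasque_biprod {F G : TopCat.Sheaf AddCommGrpCat.{u} T} (hF : IsQuasiFlasque F)
    (hG : IsQuasiFlasque G) : IsQuasiFlasque (F ⊞ G) := by
  intro V W h hV hW s
  obtain ⟨a, ha⟩ := hF V W h hV hW (secMap (biprod.fst : F ⊞ G ⟶ F).hom V s)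
  obtain ⟨b, hb⟩ := hG V W h hV hW (secMap (biprod.snd : F ⊞ G ⟶ G).hom V s)
  refine ⟨secMap (biprod.inl : F ⟶ F ⊞ G).hom W a + secMap (biprod.inr : G ⟶ F ⊞ G).hom W b, ?_⟩
  rw [map_add, ← secMap_res, ← secMap_res, ha, hb, ← secMap_comp, ← secMap_comp]
  exact congrArg (fun a : F ⊞ G ⟶ F ⊞ G => secMap a.hom V s)
    (biprod.total : (biprod.fst : F ⊞ G ⟶ F) ≫ biprod.inl + biprod.snd ≫ biprod.inr = 𝟙 (F ⊞ G))

/-- Quasi-flasque sheaves are adapted to sections with quasi-compact support pairs. -/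
theorem isAdaptedClass_sectionsWithSupport (hT : HasCompactBasis T) (P : SupportPair T)
    (hU : IsCompact (P.U : Set T)) (hUZ : IsCompact ((P.U : Set T) \ P.Z)) :
    IsAdaptedClass (sectionsWithSupport P) IsQuasiFlasque where
  left_exact S hS := by
    rintro ⟨x, hx⟩ hx'
    have hx'' : secMap S.g.hom P.U x = 0 := congrArg Subtype.val hx'
    obtain ⟨y, hy⟩ := exists_secMap_eq_of_shortExact hS x hx''
    have hy' : res S.X₁.obj P.compl_le y = 0 := by
      have := hS.mono_f
      apply secMap_injective_of_mono S.f
      rw [secMap_res, hy, map_zero]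
      exact hx
    exact ⟨⟨y, hy'⟩, Subtype.ext hy⟩
  injective S hS := by
    rintro ⟨x, hx⟩ ⟨y, hy⟩ hxy
    have := hS.mono_f
    exact Subtype.ext (secMap_injective_of_mono S.f P.U (congrArg Subtype.val hxy))
  -- The lift is prescribed to be `0` on `U ∖ Z`, so it again has support in `Z`.
  surjective S hS h₁ := by
    rintro ⟨x, hx⟩
    obtain ⟨r, hr, hr'⟩ := exists_lift_extending hT hS h₁ P.compl_le hUZ hU x 0
      ((map_zero _).trans (Eq.symm hx))
    exact ⟨⟨r, hr'⟩, Subtype.ext hr⟩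
  quotient S hS h₁ h₂ := h₁.quotient hT hS h₂
  zero Z hZ := by
    intro V W h hV hW s
    refine ⟨0, ?_⟩
    have e : s = 0 := congrArg (fun a : Z ⟶ Z => secMap a.hom V s) (hZ.eq_of_src (𝟙 Z) 0)
    rw [e, map_zero]
  biprod F G hF hG := isQuasiFlasque_biprod hF hG

end QuasiFlasque

/-! ### Injective sheaves of abelian groups on a site -/

section Injective

variable {C : Type u} [SmallCategory C] {J : GrothendieckTopology C}

/-- Restriction of sections of an injective sheaf of abelian groups along a monomorphism is
surjective. -/
lemma map_surjective_of_injective (I : Sheaf J AddCommGrpCat.{u}) [Injective I] {V W : C}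
    (f : V ⟶ W) [Mono f] : Function.Surjective (I.obj.map f.op).hom := by
  -- Maps to `I` from the sheaf of free abelian groups on a representable are the sections of `I`.
  -- That sheaf is obtained by operations preserving monomorphisms, so injectivity of `I` yields the
  -- extension.
  let adj := (AddCommGrpCat.adj.{u}.whiskerRight Cᵒᵖ).comp (sheafificationAdjunction J AddCommGrpCat.{u})
  let Φ := (Functor.whiskeringRight Cᵒᵖ _ _).obj AddCommGrpCat.free.{u} ⋙
    presheafToSheaf J AddCommGrpCat.{u}
  have : Mono (((Functor.whiskeringRight Cᵒᵖ _ _).obj AddCommGrpCat.free.{u}).map (yoneda.map f)) := by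
    rw [NatTrans.mono_iff_mono_app]
    intro U
    have : Mono ((yoneda.map f).app U) := inferInstance
    exact inferInstanceAs (Mono (AddCommGrpCat.free.map ((yoneda.map f).app U)))
  have hm : Mono (Φ.map (yoneda.map f)) :=
    inferInstanceAs (Mono ((presheafToSheaf J AddCommGrpCat.{u}).map _))
  intro s
  let φ : yoneda.obj V ⟶ I.obj ⋙ forget AddCommGrpCat.{u} := yonedaEquiv.symm s
  let ψ : Φ.obj (yoneda.obj V) ⟶ I := (adj.homEquiv _ _).symm φ
  let χ : Φ.obj (yoneda.obj W) ⟶ I := Injective.factorThru ψ (Φ.map (yoneda.map f))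
  have hχ : Φ.map (yoneda.map f) ≫ χ = ψ := Injective.comp_factorThru _ _
  let ω : yoneda.obj W ⟶ I.obj ⋙ forget AddCommGrpCat.{u} := adj.homEquiv _ _ χ
  have hω : yoneda.map f ≫ ω = φ := by
    have := adj.homEquiv_naturality_left (yoneda.map f) χ
    refine this.symm.trans ?_
    rw [show ((Functor.whiskeringRight Cᵒᵖ _ _).obj AddCommGrpCat.free.{u} ⋙
      presheafToSheaf J AddCommGrpCat.{u}).map (yoneda.map f) ≫ χ = ψ from hχ]
    exact (adj.homEquiv _ _).apply_symm_apply φ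
  refine ⟨yonedaEquiv ω, ?_⟩
  have h₁ : yonedaEquiv (yoneda.map f ≫ ω) = s := by
    rw [hω]
    exact (yonedaEquiv (F := I.obj ⋙ forget AddCommGrpCat.{u})).apply_symm_apply s
  refine Eq.trans ?_ h₁
  exact (yonedaEquiv_naturality ω f)

lemma isQuasiFlasque_of_injective {T : TopCat.{u}} (I : TopCat.Sheaf AddCommGrpCat.{u} T)
    (hI : Injective I) : IsQuasiFlasque I := fun _ _ h _ _ =>
  @map_surjective_of_injective _ _ (Opens.grothendieckTopology T) I hI _ _ (homOfLE h) _

end Injective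

/-! ### The site of an inverse system of ringed spaces -/

section Site

variable {L : Type u} [Preorder L]

/-- An open subset of one of the spaces of an inverse system. -/
structure Stage (X : Lᵒᵖ ⥤ RingedSpace.{u, u}) where
  l : L
  V : Opens (X.obj (op l)).carrier

variable {X : Lᵒᵖ ⥤ RingedSpace.{u, u}}

/-- `(m, W) ≤ (l, V)` if `l ≤ m` and `W` is contained in the preimage of `V`. -/
instance : Preorder (Stage X) where
  le e e' := ∃ h : e'.l ≤ e.l, e.V ≤ (transOpens X h).obj e'.V
  le_refl e := ⟨le_refl _, (transOpens_refl X e.l e.V).ge⟩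
  le_trans e e' e'' := by
    rintro ⟨h₁, h₂⟩ ⟨h₁', h₂'⟩
    refine ⟨h₁'.trans h₁, h₂.trans ?_⟩
    rw [← transOpens_transOpens X h₁' h₁]
    exact fun x hx => h₂' hx

lemma Stage.mk_le_mk {l : L} {V V' : Opens (X.obj (op l)).carrier} (h : V ≤ V') :
    (⟨l, V⟩ : Stage X) ≤ ⟨l, V'⟩ :=
  ⟨le_refl l, h.trans (transOpens_refl X l V').ge⟩

lemma Stage.trans_le {l m : L} (h : l ≤ m) (V : Opens (X.obj (op l)).carrier) :
    (⟨m, (transOpens X h).obj V⟩ : Stage X) ≤ ⟨l, V⟩ :=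
  ⟨h, le_rfl⟩

lemma Stage.le_inf {e : Stage X} {l : L} {V V' : Opens (X.obj (op l)).carrier}
    (h : e ≤ ⟨l, V⟩) (h' : e ≤ ⟨l, V'⟩) : e ≤ ⟨l, V ⊓ V'⟩ :=
  ⟨h.1, fun _ hx => ⟨h.2 hx, h'.2 hx⟩⟩

variable (X) in
/-- The topology on the category of stages: `(l, V)` is covered by the members `(l, V')` of open
coverings of `V`. -/
def stageTopology : GrothendieckTopology (Stage X) where
  sieves e := {S | ∀ x ∈ e.V, ∃ (V : Opens (X.obj (op e.l)).carrier) (h : V ≤ e.V),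
    x ∈ V ∧ S.arrows (homOfLE (Stage.mk_le_mk h) : (⟨e.l, V⟩ : Stage X) ⟶ e)}
  top_mem' e x hx := ⟨e.V, le_rfl, hx, trivial⟩
  pullback_stable' e e' S f hS x hx := by
    have hf := leOfHom f
    obtain ⟨V, hV, hxV, h⟩ := hS _ (hf.2 hx)
    have hle : (⟨e'.l, e'.V ⊓ (transOpens X hf.1).obj V⟩ : Stage X) ≤ ⟨e.l, V⟩ :=
      ⟨hf.1, inf_le_right⟩
    refine ⟨e'.V ⊓ (transOpens X hf.1).obj V, inf_le_left, ⟨hx, hxV⟩, ?_⟩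
    have := S.downward_closed h (homOfLE hle)
    exact this
  transitive' e S hS R hR x hx := by
    obtain ⟨V, hV, hxV, h⟩ := hS x hx
    obtain ⟨V', hV', hxV', h'⟩ := hR h x hxV
    exact ⟨V', hV'.trans hV, hxV', h'⟩

variable (X) in
/-- The inclusion of the open subsets of one of the spaces. -/
def stageIncl (l : L) : Opens (X.obj (op l)).carrier ⥤ Stage X where
  obj V := ⟨l, V⟩
  map f := homOfLE (Stage.mk_le_mk (leOfHom f))

/-- A stage mapping to both `(l, Y₁)` and `(l, Y₂)` maps to `(l, Y₁ ⊓ Y₂)`, where compatibility is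
already known. -/
lemma compatiblePreserving_stageIncl (l : L) :
    CompatiblePreserving.{u} (stageTopology X) (stageIncl X l) where
  compatible F Z T x hx Y₁ Y₂ e f₁ f₂ g₁ g₂ hg₁ hg₂ _ := by
    have h := hx (homOfLE inf_le_left : Y₁ ⊓ Y₂ ⟶ Y₁) (homOfLE inf_le_right : Y₁ ⊓ Y₂ ⟶ Y₂)
      hg₁ hg₂ rfl
    let k : e ⟶ ⟨l, Y₁ ⊓ Y₂⟩ := homOfLE (Stage.le_inf (leOfHom f₁) (leOfHom f₂))
    have h' := congrArg (F.obj.map k.op) h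
    refine Eq.trans ?_ (h'.trans ?_)
    · exact ConcreteCategory.congr_hom (F.obj.map_comp _ k.op) (x g₁ hg₁)
    · exact (ConcreteCategory.congr_hom (F.obj.map_comp _ k.op) (x g₂ hg₂)).symm

lemma coverPreserving_stageIncl (l : L) :
    CoverPreserving (Opens.grothendieckTopology (X.obj (op l)).carrier) (stageTopology X)
      (stageIncl X l) where
  cover_preserve {U S} hS x hx := by
    obtain ⟨V, f, hf, hxV⟩ := hS x hx
    exact ⟨V, leOfHom f, hxV, V, f, 𝟙 _, hf, rfl⟩

instance (l : L) : (stageIncl X l).IsContinuous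
    (Opens.grothendieckTopology (X.obj (op l)).carrier) (stageTopology X) :=
  Functor.isContinuous_of_coverPreserving (compatiblePreserving_stageIncl l)
    (coverPreserving_stageIncl l)

/-- Coverings of `(l, V)` contain coverings by opens with the same index, so they restrict to
coverings of `V`. -/
instance (l : L) : (stageIncl X l).IsCocontinuous
    (Opens.grothendieckTopology (X.obj (op l)).carrier) (stageTopology X) where
  cover_lift {U S} hS x hx := by
    obtain ⟨V, h, hxV, hV⟩ := hS x hx
    exact ⟨V, homOfLE h, hV, hxV⟩

variable (X) in
/-- The category of sheaves of abelian groups on the site of stages. -/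
abbrev StageSheaf := Sheaf (stageTopology X) AddCommGrpCat.{u}

variable (X) in
/-- The restriction of a sheaf on the site of stages to one of the spaces. -/
def restrictStage (l : L) :
    StageSheaf X ⥤ TopCat.Sheaf AddCommGrpCat.{u} (X.obj (op l)).carrier :=
  (stageIncl X l).sheafPushforwardContinuous AddCommGrpCat.{u}
    (Opens.grothendieckTopology (X.obj (op l)).carrier) (stageTopology X)

/-- Cocontinuity provides a right adjoint and continuity a left adjoint, whence the exactness of
restriction to a stage. -/
instance (l : L) : (restrictStage X l).IsLeftAdjoint :=
  ((stageIncl X l).sheafAdjunctionCocontinuous AddCommGrpCat.{u}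
    (Opens.grothendieckTopology (X.obj (op l)).carrier) (stageTopology X)).isLeftAdjoint

instance (l : L) : (restrictStage X l).IsRightAdjoint :=
  inferInstanceAs ((stageIncl X l).sheafPushforwardContinuous AddCommGrpCat.{u}
    (Opens.grothendieckTopology (X.obj (op l)).carrier) (stageTopology X)).IsRightAdjoint

instance (l : L) : (restrictStage X l).Additive where

instance (l : L) : PreservesFiniteLimits (restrictStage X l) :=
  inferInstance

instance (l : L) : PreservesFiniteColimits (restrictStage X l) :=
  inferInstance

/-- The preimage in the vertex of a cone of an open subset of one of the spaces. -/
def stagePreimage (c : Cone X) : Stage X ⥤ Opens c.pt.carrier where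
  obj e := (projOpens c e.l).obj e.V
  map {e e'} f := homOfLE (by
    have hf := leOfHom f
    rw [← projOpens_transOpens c hf.1]
    exact fun x hx => hf.2 hx)

lemma stagePreimage_mono (c : Cone X) {e e' : Stage X} (h : e ≤ e') :
    (stagePreimage c).obj e ≤ (stagePreimage c).obj e' :=
  leOfHom ((stagePreimage c).map (homOfLE h))

lemma coverPreserving_stagePreimage (c : Cone X) :
    CoverPreserving (stageTopology X) (Opens.grothendieckTopology c.pt.carrier)
      (stagePreimage c) where
  cover_preserve {e S} hS x hx := by
    obtain ⟨V, h, hxV, hV⟩ := hS _ hx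
    exact ⟨(stagePreimage c).obj ⟨e.l, V⟩, (stagePreimage c).map (homOfLE (Stage.mk_le_mk h)),
      ⟨_, _, 𝟙 _, hV, rfl⟩, hxV⟩

variable [IsDirectedOrder L]

/-- Pull both opens back to a common index and intersect there; taking preimages in the vertex
commutes with both operations. -/
lemma Stage.exists_le_le (c : Cone X) (e e' : Stage X) : ∃ e'' : Stage X, e'' ≤ e ∧ e'' ≤ e' ∧
    (stagePreimage c).obj e ⊓ (stagePreimage c).obj e' ≤ (stagePreimage c).obj e'' := by
  obtain ⟨m, hm, hm'⟩ := exists_ge_ge e.l e'.l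
  refine ⟨⟨m, (transOpens X hm).obj e.V ⊓ (transOpens X hm').obj e'.V⟩, ⟨hm, inf_le_left⟩,
    ⟨hm', inf_le_right⟩, ?_⟩
  rintro x ⟨hx, hx'⟩
  refine ⟨?_, ?_⟩
  · have h := (projOpens_transOpens c hm e.V).ge hx
    exact h
  · have h := (projOpens_transOpens c hm' e'.V).ge hx'
    exact h

variable [Nonempty L]

/-- In a preorder, flatness only asks for common lower bounds and nonemptiness; the first is
`Stage.exists_le_le`, and a whole space gives the second. -/
instance (c : Cone X) : RepresentablyFlat (stagePreimage c) where
  cofiltered W :=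
    { cone_objs := fun a b => by
        obtain ⟨e, h₁, h₂, h₃⟩ := Stage.exists_le_le c a.right b.right
        exact ⟨StructuredArrow.mk (Y := e)
            (homOfLE ((le_inf (leOfHom a.hom) (leOfHom b.hom)).trans h₃)),
          StructuredArrow.homMk (homOfLE h₁) rfl, StructuredArrow.homMk (homOfLE h₂) rfl, trivial⟩
      cone_maps := fun a b f g => ⟨a, 𝟙 _, by
        rw [StructuredArrow.ext f g (Subsingleton.elim _ _)]⟩
      nonempty := ⟨StructuredArrow.mk (Y := (⟨Classical.arbitrary L, ⊤⟩ : Stage X))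
        (homOfLE fun _ _ => trivial)⟩ }

instance (c : Cone X) : (stagePreimage c).IsContinuous (stageTopology X)
    (Opens.grothendieckTopology c.pt.carrier) :=
  Functor.isContinuous_iff_coverPreserving.2 (coverPreserving_stagePreimage c)

/-- The direct image of a sheaf on the vertex of a cone. -/
def stagePushforward (c : Cone X) : TopCat.Sheaf AddCommGrpCat.{u} c.pt.carrier ⥤ StageSheaf X :=
  (stagePreimage c).sheafPushforwardContinuous AddCommGrpCat.{u} (stageTopology X)
    (Opens.grothendieckTopology c.pt.carrier)

/-- The inverse image on the vertex of a cone of a sheaf on the site of stages. -/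
def stagePullback (c : Cone X) : StageSheaf X ⥤ TopCat.Sheaf AddCommGrpCat.{u} c.pt.carrier :=
  Functor.sheafPullbackConstruction.sheafPullback (stagePreimage c) AddCommGrpCat.{u}
    (stageTopology X) (Opens.grothendieckTopology c.pt.carrier)

/-- The adjunction between inverse and direct image. -/
def stageAdj (c : Cone X) : stagePullback c ⊣ stagePushforward c :=
  Functor.sheafPullbackConstruction.sheafAdjunctionContinuous (stagePreimage c) AddCommGrpCat.{u}
    (stageTopology X) (Opens.grothendieckTopology c.pt.carrier)

instance (c : Cone X) : (stagePullback c).IsLeftAdjoint := (stageAdj c).isLeftAdjoint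

instance (c : Cone X) : PreservesFiniteColimits (stagePullback c) := inferInstance

/-- This is the consequence of flatness that makes the inverse image of a resolution a resolution.
-/
instance (c : Cone X) : PreservesFiniteLimits (stagePullback c) := by
  have := @reflectsLimits_of_reflectsIsomorphisms
  exact inferInstanceAs (PreservesFiniteLimits
    (Functor.sheafPullbackConstruction.sheafPullback (stagePreimage c) AddCommGrpCat.{u}
    (stageTopology X) (Opens.grothendieckTopology c.pt.carrier)))

instance (c : Cone X) : (stagePullback c).Additive :=
  Functor.additive_of_preserves_binary_products _

end Site

/-! ### Sheaves presented by sections at the stages -/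

section Presentation

variable {L : Type u} [Preorder L] {X : Lᵒᵖ ⥤ RingedSpace.{u, u}}

/-- Restriction of sections at the stages. -/
def sres (F : (Stage X)ᵒᵖ ⥤ AddCommGrpCat.{u}) {e e' : Stage X} (h : e ≤ e') :
    F.obj (op e') →+ F.obj (op e) :=
  (F.map (homOfLE h).op).hom

@[simp]
lemma sres_refl (F : (Stage X)ᵒᵖ ⥤ AddCommGrpCat.{u}) {e : Stage X} (h : e ≤ e)
    (s : F.obj (op e)) : sres F h s = s :=
  ConcreteCategory.congr_hom (F.map_id (op e)) s

@[simp]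
lemma sres_sres (F : (Stage X)ᵒᵖ ⥤ AddCommGrpCat.{u}) {e e' e'' : Stage X} (h : e ≤ e')
    (h' : e' ≤ e'') (s : F.obj (op e'')) : sres F h (sres F h' s) = sres F (h.trans h') s :=
  (ConcreteCategory.congr_hom (F.map_comp (homOfLE h').op (homOfLE h).op) s).symm

lemma stage_section_ext (F : StageSheaf X) {e : Stage X} (s t : F.obj.obj (op e))
    (h : ∀ x ∈ e.V, ∃ (V : Opens (X.obj (op e.l)).carrier) (hV : V ≤ e.V), x ∈ V ∧
      sres F.obj (Stage.mk_le_mk hV : (⟨e.l, V⟩ : Stage X) ≤ e) s =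
        sres F.obj (Stage.mk_le_mk hV : (⟨e.l, V⟩ : Stage X) ≤ e) t) : s = t :=
  section_ext ((restrictStage X e.l).obj F) (W := e.V) s t h

lemma stage_section_ext_sup (F : StageSheaf X) {l : L} {V V' : Opens (X.obj (op l)).carrier}
    (s t : F.obj.obj (op (⟨l, V ⊔ V'⟩ : Stage X)))
    (h : sres F.obj (Stage.mk_le_mk le_sup_left : (⟨l, V⟩ : Stage X) ≤ _) s =
      sres F.obj (Stage.mk_le_mk le_sup_left : (⟨l, V⟩ : Stage X) ≤ _) t)
    (h' : sres F.obj (Stage.mk_le_mk le_sup_right : (⟨l, V'⟩ : Stage X) ≤ _) s =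
      sres F.obj (Stage.mk_le_mk le_sup_right : (⟨l, V'⟩ : Stage X) ≤ _) t) : s = t :=
  section_ext_sup ((restrictStage X l).obj F) le_sup_left le_sup_right le_rfl s t h h'

lemma exists_stage_glue_sup (F : StageSheaf X) {l : L} {V V' : Opens (X.obj (op l)).carrier}
    (s : F.obj.obj (op (⟨l, V⟩ : Stage X))) (s' : F.obj.obj (op (⟨l, V'⟩ : Stage X)))
    (h : sres F.obj (Stage.mk_le_mk inf_le_left : (⟨l, V ⊓ V'⟩ : Stage X) ≤ _) s =
      sres F.obj (Stage.mk_le_mk inf_le_right : (⟨l, V ⊓ V'⟩ : Stage X) ≤ _) s') :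
    ∃ t : F.obj.obj (op (⟨l, V ⊔ V'⟩ : Stage X)),
      sres F.obj (Stage.mk_le_mk le_sup_left) t = s ∧
      sres F.obj (Stage.mk_le_mk le_sup_right) t = s' :=
  exists_glue_sup ((restrictStage X l).obj F) s s' h

/-- A family of maps from the sections of `F` at the stages to the sections of `N`, compatible with
restriction. -/
structure StageMap (c : Cone X) (F : (Stage X)ᵒᵖ ⥤ AddCommGrpCat.{u})
    (N : (Opens c.pt.carrier)ᵒᵖ ⥤ AddCommGrpCat.{u}) where
  map (e : Stage X) : F.obj (op e) →+ N.obj (op ((stagePreimage c).obj e))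
  map_sres {e e' : Stage X} (h : e ≤ e') (s : F.obj (op e')) :
    map e (sres F h s) = res N (stagePreimage_mono c h) (map e' s)

variable {c : Cone X}

/-- `N` is the presheaf colimit of the sections of `F` at the stages. -/
structure StageMap.IsColimitPresentation {F : (Stage X)ᵒᵖ ⥤ AddCommGrpCat.{u}}
    {N : (Opens c.pt.carrier)ᵒᵖ ⥤ AddCommGrpCat.{u}} (η : StageMap c F N) : Prop where
  exists_rep (W : Opens c.pt.carrier) (y : N.obj (op W)) : ∃ (e : Stage X)
    (h : W ≤ (stagePreimage c).obj e) (s : F.obj (op e)), y = res N h (η.map e s)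
  exists_eq_zero (W : Opens c.pt.carrier) (e : Stage X) (h : W ≤ (stagePreimage c).obj e)
    (s : F.obj (op e)) (hs : res N h (η.map e s) = 0) :
    ∃ (e' : Stage X) (h' : e' ≤ e), W ≤ (stagePreimage c).obj e' ∧ sres F h' s = 0

/-- `N` is the sheaf colimit of the sections of `F` at the stages. -/
structure StageMap.IsPresentation {F : (Stage X)ᵒᵖ ⥤ AddCommGrpCat.{u}}
    {N : (Opens c.pt.carrier)ᵒᵖ ⥤ AddCommGrpCat.{u}} (η : StageMap c F N) : Prop where
  exists_rep (W : Opens c.pt.carrier) (y : N.obj (op W)) (x : c.pt.carrier) (hx : x ∈ W) :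
    ∃ (e : Stage X) (h : (stagePreimage c).obj e ≤ W) (s : F.obj (op e)),
      x ∈ (stagePreimage c).obj e ∧ res N h y = η.map e s
  exists_eq_zero (e : Stage X) (s : F.obj (op e)) (hs : η.map e s = 0) (x : c.pt.carrier)
    (hx : x ∈ (stagePreimage c).obj e) :
    ∃ (e' : Stage X) (h' : e' ≤ e), x ∈ (stagePreimage c).obj e' ∧ sres F h' s = 0

/-- Composition with a morphism of presheaves. -/
def StageMap.comp {F : (Stage X)ᵒᵖ ⥤ AddCommGrpCat.{u}}
    {N N' : (Opens c.pt.carrier)ᵒᵖ ⥤ AddCommGrpCat.{u}} (η : StageMap c F N) (κ : N ⟶ N') :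
    StageMap c F N' where
  map e := (secMap κ _).comp (η.map e)
  map_sres h s := by
    rw [AddMonoidHom.comp_apply, η.map_sres, secMap_res]
    rfl

lemma exists_res_eq_zero_of_isLocallyInjective {T : TopCat.{u}}
    {N N' : (Opens T)ᵒᵖ ⥤ AddCommGrpCat.{u}} (κ : N ⟶ N')
    [hκ : CategoryTheory.Presheaf.IsLocallyInjective (Opens.grothendieckTopology T) κ]
    {W : Opens T} (y : N.obj (op W)) (hy : secMap κ W y = 0) (x : T) (hx : x ∈ W) :
    ∃ (V : Opens T) (h : V ≤ W), x ∈ V ∧ res N h y = 0 := by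
  obtain ⟨V, f, hf, hxV⟩ := hκ.equalizerSieve_mem (X := op W) y (0 : N.obj (op W))
    (hy.trans (map_zero (secMap κ W)).symm) x hx
  exact ⟨V, leOfHom f, hxV, Eq.trans hf (map_zero (N.map f.op).hom)⟩

lemma exists_secMap_eq_of_isLocallySurjective {T : TopCat.{u}}
    {N N' : (Opens T)ᵒᵖ ⥤ AddCommGrpCat.{u}} (κ : N ⟶ N')
    [hκ : CategoryTheory.Presheaf.IsLocallySurjective (Opens.grothendieckTopology T) κ]
    {W : Opens T} (y : N'.obj (op W)) (x : T) (hx : x ∈ W) :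
    ∃ (V : Opens T) (h : V ≤ W) (z : N.obj (op V)), x ∈ V ∧ secMap κ V z = res N' h y := by
  obtain ⟨V, f, ⟨z, hz⟩, hxV⟩ := hκ.imageSieve_mem (U := W) y x hx
  exact ⟨V, leOfHom f, z, hxV, hz⟩

/-- The open subsets coming from the stages form a basis of the topology of the vertex. -/
def HasStageBasis (c : Cone X) : Prop :=
  ∀ (W : Opens c.pt.carrier) (x : c.pt.carrier), x ∈ W →
    ∃ e : Stage X, x ∈ (stagePreimage c).obj e ∧ (stagePreimage c).obj e ≤ W

/-- A locally bijective map turns statements about presheaf sections into local ones; the stage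
basis then shrinks the neighbourhoods to ones that come from a stage. -/
lemma StageMap.IsColimitPresentation.comp [IsDirectedOrder L] {F : (Stage X)ᵒᵖ ⥤ AddCommGrpCat.{u}}
    {N N' : (Opens c.pt.carrier)ᵒᵖ ⥤ AddCommGrpCat.{u}} {η : StageMap c F N}
    (hη : η.IsColimitPresentation) (hc : HasStageBasis c) (κ : N ⟶ N')
    [CategoryTheory.Presheaf.IsLocallyInjective (Opens.grothendieckTopology c.pt.carrier) κ]
    [CategoryTheory.Presheaf.IsLocallySurjective (Opens.grothendieckTopology c.pt.carrier) κ] :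
    (η.comp κ).IsPresentation where
  exists_rep W y x hx := by
    obtain ⟨V, hV, z, hxV, hz⟩ := exists_secMap_eq_of_isLocallySurjective κ y x hx
    obtain ⟨e, he, s, rfl⟩ := hη.exists_rep V z
    obtain ⟨e', hxe', he'⟩ := hc V x hxV
    obtain ⟨e'', h₁, h₂, h₃⟩ := Stage.exists_le_le c e e'
    have hle : (stagePreimage c).obj e'' ≤ V := (stagePreimage_mono c h₂).trans he'
    refine ⟨e'', hle.trans hV, sres F h₁ s, h₃ ⟨he hxV, hxe'⟩, ?_⟩
    have := congrArg (res N' hle) hz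
    rw [res_res, ← secMap_res, res_res] at this
    rw [← this, map_sres]
    exact secMap_res κ _ _
  exists_eq_zero e s hs x hx := by
    obtain ⟨V, hV, hxV, h⟩ := exists_res_eq_zero_of_isLocallyInjective κ _ hs x hx
    obtain ⟨e', h', hVe', hs'⟩ := hη.exists_eq_zero V e hV s h
    exact ⟨e', h', hVe' hxV, hs'⟩

/-! ### Descent to a stage of sections over quasi-compact opens -/

section Sheaf

variable [IsDirectedOrder L] {F : StageSheaf X} {N : TopCat.Sheaf AddCommGrpCat.{u} c.pt.carrier}
  {η : StageMap c F.obj N.obj}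

/-- A section at a stage over a quasi-compact open subset that vanishes in the limit vanishes at a
later stage. -/
lemma StageMap.IsPresentation.exists_sres_eq_zero (hη : η.IsPresentation) (hc : IsLimit c)
    (hX : ∀ l : L, SpectralSpace (X.obj (op l)).carrier)
    (hv : ∀ (l m : L) (h : l ≤ m), IsSpectralMap (transition X h).hom.base)
    {l : L} {V : Opens (X.obj (op l)).carrier} (hV : IsCompact (V : Set (X.obj (op l)).carrier))
    (s : F.obj.obj (op (⟨l, V⟩ : Stage X))) (hs : η.map _ s = 0) :
    ∃ (m : L) (h : l ≤ m), sres F.obj (Stage.trans_le h V) s = 0 := by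
  -- A set has this property if it is covered by one open, at one later stage, on which `s` already
  -- vanishes.
  let p (A : Set c.pt.carrier) : Prop := ∃ (m : L) (h : l ≤ m) (W : Opens (X.obj (op m)).carrier)
    (hW : W ≤ (transOpens X h).obj V), A ⊆ (projOpens c m).obj W ∧
      sres F.obj ((Stage.mk_le_mk hW).trans (Stage.trans_le h V)) s = 0
  have hp : p ((projOpens c l).obj V) := by
    refine (isCompact_projOpens hc hX hv hV).induction_on (p := p) ?_ ?_ ?_ ?_
    · refine ⟨l, le_refl l, ⊥, bot_le, Set.empty_subset _, ?_⟩
      exact stage_section_ext F _ _ fun x hx => hx.elim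
    · rintro A B hAB ⟨m, h, W, hW, hB, hs'⟩
      exact ⟨m, h, W, hW, hAB.trans hB, hs'⟩
    · rintro A B ⟨m, h, W, hW, hA, hs₁⟩ ⟨m', h', W', hW', hB, hs₂⟩
      obtain ⟨n, hn, hn'⟩ := exists_ge_ge m m'
      have hle : (transOpens X hn).obj W ⊔ (transOpens X hn').obj W' ≤
          (transOpens X (h.trans hn)).obj V := by
        refine sup_le ?_ ?_
        · rw [← transOpens_transOpens X h hn]
          exact fun x hx => hW hx
        · rw [← transOpens_transOpens X h' hn']
          exact fun x hx => hW' hx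
      refine ⟨n, h.trans hn, _, hle, ?_, ?_⟩
      · rintro x (hx | hx)
        · exact Or.inl ((projOpens_transOpens c hn W).ge (hA hx))
        · exact Or.inr ((projOpens_transOpens c hn' W').ge (hB hx))
      · refine stage_section_ext_sup F _ _ ?_ ?_
        · rw [sres_sres, map_zero]
          have := congrArg (sres F.obj (Stage.trans_le hn W)) hs₁
          rwa [sres_sres, map_zero] at this
        · rw [sres_sres, map_zero]
          have := congrArg (sres F.obj (Stage.trans_le hn' W')) hs₂
          rwa [sres_sres, map_zero] at this
    · intro x hx
      obtain ⟨e', h', hxe', hs'⟩ := hη.exists_eq_zero _ s hs x hx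
      exact ⟨(stagePreimage c).obj e', mem_nhdsWithin_of_mem_nhds
        (((stagePreimage c).obj e').isOpen.mem_nhds hxe'), e'.l, h'.1, e'.V, h'.2,
        subset_rfl, hs'⟩
  obtain ⟨m, h, W, hW, hVW, hs'⟩ := hp
  -- The open `W` contains the whole preimage of `V` in the limit, hence, `V` being quasi-compact,
  -- already at a later stage.
  obtain ⟨n, hn, hle⟩ := exists_transOpens_le hc hX hv (isCompact_transOpens hv h hV) (W := W)
    ((projOpens_transOpens c h V).le.trans hVW)
  have hle' : (⟨n, (transOpens X (h.trans hn)).obj V⟩ : Stage X) ≤ ⟨m, W⟩ :=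
    ⟨hn, (transOpens_transOpens X h hn V).ge.trans hle⟩
  refine ⟨n, h.trans hn, ?_⟩
  have := congrArg (sres F.obj hle') hs'
  rwa [sres_sres, map_zero] at this

/-- A section over a quasi-compact open subset of the limit comes from a stage. -/
lemma StageMap.IsPresentation.exists_stage_section [Nonempty L] (hη : η.IsPresentation)
    (hc : IsLimit c) (hX : ∀ l : L, SpectralSpace (X.obj (op l)).carrier)
    (hv : ∀ (l m : L) (h : l ≤ m), IsSpectralMap (transition X h).hom.base)
    {W : Opens c.pt.carrier} (hW : IsCompact (W : Set c.pt.carrier)) (y : N.obj.obj (op W)) :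
    ∃ (e : Stage X) (h : (stagePreimage c).obj e ≤ W) (s : F.obj.obj (op e)),
      IsCompact (e.V : Set (X.obj (op e.l)).carrier) ∧ W ≤ (stagePreimage c).obj e ∧
      res N.obj h y = η.map e s := by
  -- Quasi-compactness of the open at the stage is carried through the induction, since gluing needs
  -- it for the overlaps.
  let p (A : Set c.pt.carrier) : Prop := ∃ (e : Stage X) (h : (stagePreimage c).obj e ≤ W)
    (s : F.obj.obj (op e)), IsCompact (e.V : Set (X.obj (op e.l)).carrier) ∧
      A ⊆ (stagePreimage c).obj e ∧ res N.obj h y = η.map e s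
  have hp : p W := by
    refine hW.induction_on (p := p) ?_ ?_ ?_ ?_
    · refine ⟨⟨Classical.arbitrary L, ⊥⟩, fun _ h => h.elim, 0, isCompact_empty,
        Set.empty_subset _, ?_⟩
      exact section_ext N _ _ fun x hx => hx.elim
    · rintro A B hAB ⟨e, h, s, he, hB, hs⟩
      exact ⟨e, h, s, he, hAB.trans hB, hs⟩
    · rintro A B ⟨⟨l, V⟩, h, s, he, hA, hs⟩ ⟨⟨l', V'⟩, h', s', he', hB, hs'⟩
      obtain ⟨m, hm, hm'⟩ := exists_ge_ge l l'
      have hVc := isCompact_transOpens hv hm he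
      have hVc' := isCompact_transOpens hv hm' he'
      have hI : IsCompact (((transOpens X hm).obj V ⊓ (transOpens X hm').obj V' :
          Opens (X.obj (op m)).carrier) : Set (X.obj (op m)).carrier) :=
        (hX m).inter_isCompact _ _ (Opens.isOpen _) hVc (Opens.isOpen _) hVc'
      have h₁ : (⟨m, (transOpens X hm).obj V ⊓ (transOpens X hm').obj V'⟩ : Stage X) ≤ ⟨l, V⟩ :=
        ⟨hm, inf_le_left⟩
      have h₂ : (⟨m, (transOpens X hm).obj V ⊓ (transOpens X hm').obj V'⟩ : Stage X) ≤ ⟨l', V'⟩ :=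
        ⟨hm', inf_le_right⟩
      -- The two sections agree on the overlap only in the limit. Their difference vanishes there,
      -- hence at a later stage, where the sections can be glued.
      obtain ⟨n, hn, hzero⟩ := hη.exists_sres_eq_zero hc hX hv hI
        (sres F.obj h₁ s - sres F.obj h₂ s') (by
          rw [map_sub, η.map_sres, η.map_sres, ← hs, ← hs', res_res, res_res, sub_self])
      rw [map_sub, sres_sres, sres_sres, sub_eq_zero] at hzero
      have k₁ : (⟨n, (transOpens X (hm.trans hn)).obj V⟩ : Stage X) ≤ ⟨l, V⟩ := Stage.trans_le _ _
      have k₂ : (⟨n, (transOpens X (hm'.trans hn)).obj V'⟩ : Stage X) ≤ ⟨l', V'⟩ :=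
        Stage.trans_le _ _
      have k : (⟨n, (transOpens X (hm.trans hn)).obj V ⊓ (transOpens X (hm'.trans hn)).obj V'⟩ :
          Stage X) ≤
          ⟨n, (transOpens X hn).obj ((transOpens X hm).obj V ⊓ (transOpens X hm').obj V')⟩ := by
        apply Stage.mk_le_mk
        rw [← transOpens_transOpens X hm hn, ← transOpens_transOpens X hm' hn]
        exact le_rfl
      obtain ⟨r, hr, hr'⟩ := exists_stage_glue_sup F (sres F.obj k₁ s) (sres F.obj k₂ s') (by
        rw [sres_sres, sres_sres]
        have := congrArg (sres F.obj k) hzero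
        rwa [sres_sres, sres_sres] at this)
      have p₁ : (projOpens c n).obj ((transOpens X (hm.trans hn)).obj V) = (projOpens c l).obj V :=
        projOpens_transOpens c (hm.trans hn) V
      have p₂ : (projOpens c n).obj ((transOpens X (hm'.trans hn)).obj V') =
        (projOpens c l').obj V' := projOpens_transOpens c (hm'.trans hn) V'
      have hle : (stagePreimage c).obj ⟨n, (transOpens X (hm.trans hn)).obj V ⊔
          (transOpens X (hm'.trans hn)).obj V'⟩ ≤ W := by
        rintro x (hx | hx)
        · exact h (p₁.le hx)
        · exact h' (p₂.le hx)
      refine ⟨⟨n, (transOpens X (hm.trans hn)).obj V ⊔ (transOpens X (hm'.trans hn)).obj V'⟩,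
        hle, r, (isCompact_transOpens hv _ he).union (isCompact_transOpens hv _ he'), ?_, ?_⟩
      · rintro x (hx | hx)
        · exact Or.inl (p₁.ge (hA hx))
        · exact Or.inr (p₂.ge (hB hx))
      · refine section_ext_sup N
          (stagePreimage_mono c (Stage.mk_le_mk le_sup_left :
            (⟨n, (transOpens X (hm.trans hn)).obj V⟩ : Stage X) ≤ _))
          (stagePreimage_mono c (Stage.mk_le_mk le_sup_right :
            (⟨n, (transOpens X (hm'.trans hn)).obj V'⟩ : Stage X) ≤ _)) ?_ _ _ ?_ ?_
        · exact fun x hx => hx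
        · rw [res_res, ← η.map_sres (Stage.mk_le_mk le_sup_left), hr, η.map_sres, ← hs, res_res]
        · rw [res_res, ← η.map_sres (Stage.mk_le_mk le_sup_right), hr', η.map_sres, ← hs', res_res]
    -- The local representative is restricted to a smaller quasi-compact open, as the induction
    -- property demands.
    · intro x hx
      obtain ⟨⟨l, V⟩, h, s, hxe, hs⟩ := hη.exists_rep W y x hx
      obtain ⟨V', ⟨hV'o, hV'c⟩, hxV', hV'⟩ :=
        (hX l).isTopologicalBasis.exists_subset_of_mem_open (show _ ∈ (V : Set _) from hxe) V.isOpen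
      have hle : (⟨l, ⟨V', hV'o⟩⟩ : Stage X) ≤ ⟨l, V⟩ := Stage.mk_le_mk hV'
      refine ⟨(stagePreimage c).obj ⟨l, ⟨V', hV'o⟩⟩, mem_nhdsWithin_of_mem_nhds
        (((stagePreimage c).obj ⟨l, ⟨V', hV'o⟩⟩).isOpen.mem_nhds hxV'), ⟨l, ⟨V', hV'o⟩⟩,
        (stagePreimage_mono c hle).trans h, sres F.obj hle s, hV'c, subset_rfl, ?_⟩
      rw [η.map_sres, ← hs, res_res]
  obtain ⟨e, h, s, he, hA, hs⟩ := hp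
  exact ⟨e, h, s, he, hA, hs⟩

/-- A section over the preimage of a quasi-compact open subset of one of the spaces comes from
a section over the preimage of that subset at a later stage. -/
lemma StageMap.IsPresentation.exists_section_over [Nonempty L] (hη : η.IsPresentation)
    (hc : IsLimit c) (hX : ∀ l : L, SpectralSpace (X.obj (op l)).carrier)
    (hv : ∀ (l m : L) (h : l ≤ m), IsSpectralMap (transition X h).hom.base)
    {l : L} {V : Opens (X.obj (op l)).carrier} (hV : IsCompact (V : Set (X.obj (op l)).carrier))
    (y : N.obj.obj (op ((projOpens c l).obj V))) :
    ∃ (m : L) (h : l ≤ m) (s : F.obj.obj (op (⟨m, (transOpens X h).obj V⟩ : Stage X))),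
      η.map _ s = res N.obj (stagePreimage_mono c (Stage.trans_le h V)) y := by
  obtain ⟨⟨k, V'⟩, h, s, he, h', hs⟩ :=
    hη.exists_stage_section hc hX hv (isCompact_projOpens hc hX hv hV) y
  obtain ⟨m, hm, hm'⟩ := exists_ge_ge l k
  -- The open found at stage `k` has the same preimage in the limit as `V`; from stage `n` on it
  -- contains the preimage of `V`, so the section can be restricted to it.
  obtain ⟨n, hn, hle⟩ := exists_transOpens_le hc hX hv (isCompact_transOpens hv hm hV)
    (W := (transOpens X hm').obj V') (by
      rw [projOpens_transOpens, projOpens_transOpens]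
      exact h')
  have hle' : (⟨n, (transOpens X (hm.trans hn)).obj V⟩ : Stage X) ≤ ⟨k, V'⟩ := by
    refine ⟨hm'.trans hn, ?_⟩
    rw [← transOpens_transOpens X hm hn, ← transOpens_transOpens X hm' hn]
    exact hle
  refine ⟨n, hm.trans hn, sres F.obj hle' s, ?_⟩
  rw [η.map_sres, ← hs, res_res]
  rfl

end Sheaf

/-- The maps on sections given by a morphism to a direct image. -/
def StageMap.ofHom [IsDirectedOrder L] [Nonempty L] {F : StageSheaf X}
    {N : TopCat.Sheaf AddCommGrpCat.{u} c.pt.carrier}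
    (a : F ⟶ (stagePushforward c).obj N) : StageMap c F.obj N.obj where
  map e := (a.hom.app (op e)).hom
  map_sres h s := ConcreteCategory.congr_hom (a.hom.naturality (homOfLE h).op) s

end Presentation

/-! ### The inverse image on the limit is presented by sections at the stages -/

section Unit

variable {L : Type u} [Preorder L] {X : Lᵒᵖ ⥤ RingedSpace.{u, u}} [IsDirectedOrder L] [Nonempty L]
  (c : Cone X)

/-- The maps from sections at the stages to the left Kan extension. -/
def lanStageMap (F : (Stage X)ᵒᵖ ⥤ AddCommGrpCat.{u}) :
    StageMap c F ((stagePreimage c).op.lan.obj F) where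
  map e := (((stagePreimage c).op.lanUnit.app F).app (op e)).hom
  map_sres h s := ConcreteCategory.congr_hom
    (((stagePreimage c).op.lanUnit.app F).naturality (homOfLE h).op) s

/-- The left Kan extension is pointwise the colimit over the stages whose preimage contains `W`.
This colimit is filtered by flatness, so elements have representatives and vanish at some term. -/
lemma isColimitPresentation_lanStageMap (F : (Stage X)ᵒᵖ ⥤ AddCommGrpCat.{u}) :
    (lanStageMap c F).IsColimitPresentation := by
  have H (W : Opens c.pt.carrier) :=
    Functor.isPointwiseLeftKanExtensionOfIsLeftKanExtension (F := F)
      ((stagePreimage c).op.lan.obj F) ((stagePreimage c).op.lanUnit.app F) (op W)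
  constructor
  · intro W y
    obtain ⟨j, s, hs⟩ := Concrete.isColimit_exists_rep _ (H W) y
    exact ⟨j.left.unop, leOfHom j.hom.unop, s, hs.symm⟩
  · intro W e h s hs
    let j : CostructuredArrow (stagePreimage c).op (op W) :=
      CostructuredArrow.mk (Y := op e) (homOfLE h).op
    have e₁ := Concrete.isColimit_exists_of_rep_eq _ (H W) (i := j) (j := j) s (0 : F.obj (op e))
      (Eq.trans hs (map_zero ((res ((stagePreimage c).op.lan.obj F) h).comp
        ((lanStageMap c F).map e))).symm)
    obtain ⟨k, f, g, hfg⟩ := e₁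
    refine ⟨k.left.unop, leOfHom f.left.unop, leOfHom k.hom.unop, ?_⟩
    exact Eq.trans hfg (map_zero (F.map g.left).hom)

/-- Through this formula the abstract unit is computed from representatives at the stages. -/
lemma stageAdj_unit_app (F : StageSheaf X) : ((stageAdj c).unit.app F).hom =
    (stagePreimage c).op.lanUnit.app F.obj ≫ Functor.whiskerLeft (stagePreimage c).op
      (toSheafify (Opens.grothendieckTopology c.pt.carrier)
        ((stagePreimage c).op.lan.obj F.obj)) := by
  have h := Adjunction.map_restrictFullyFaithful_unit_app
    (((stagePreimage c).op.lanAdjunction AddCommGrpCat.{u}).comp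
      (sheafificationAdjunction (Opens.grothendieckTopology c.pt.carrier) AddCommGrpCat.{u}))
    (fullyFaithfulSheafToPresheaf (stageTopology X) AddCommGrpCat.{u})
    (Functor.FullyFaithful.id _) (Iso.refl _) (Iso.refl _) F
    (L := stagePullback c) (R := stagePushforward c)
  refine Eq.trans h ?_
  rw [Adjunction.comp_unit_app, Functor.lanAdjunction_unit]
  refine Eq.trans (congrArg (_ ≫ ·) (Category.id_comp (𝟙 _))) ?_
  refine (Category.comp_id _).trans ?_
  rfl

/-- The maps from the sections at the stages to the sections of the inverse image. -/
def unitStageMap (F : StageSheaf X) : StageMap c F.obj ((stagePullback c).obj F).obj :=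
  StageMap.ofHom ((stageAdj c).unit.app F)

lemma isPresentation_unitStageMap (hc : HasStageBasis c) (F : StageSheaf X) :
    (unitStageMap c F).IsPresentation := by
  have h := (isColimitPresentation_lanStageMap c F.obj).comp hc
    (toSheafify (Opens.grothendieckTopology c.pt.carrier) ((stagePreimage c).op.lan.obj F.obj))
  have e : unitStageMap c F = (lanStageMap c F.obj).comp
    (toSheafify (Opens.grothendieckTopology c.pt.carrier)
      ((stagePreimage c).op.lan.obj F.obj)) := by
    have e' : (unitStageMap c F).map = ((lanStageMap c F.obj).comp
    (toSheafify (Opens.grothendieckTopology c.pt.carrier)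
      ((stagePreimage c).op.lan.obj F.obj))).map := by
      funext e
      exact congrArg (fun a => (a.app (op e)).hom) (stageAdj_unit_app c F)
    cases hu : unitStageMap c F
    cases hl : (lanStageMap c F.obj).comp
      (toSheafify (Opens.grothendieckTopology c.pt.carrier)
      ((stagePreimage c).op.lan.obj F.obj))
    rw [hu, hl] at e'
    cases e'
    rfl
  rw [e]
  exact h

end Unit

/-! ### Sections of modules -/

section ModuleSections

variable {X Y Z : RingedSpace.{u, u}}

/-- Restriction of functions. -/
def ores (Y : RingedSpace.{u, u}) {V W : Opens Y.carrier} (h : V ≤ W) :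
    Y.presheaf.obj (op W) →+* Y.presheaf.obj (op V) :=
  (Y.presheaf.map (homOfLE h).op).hom

@[simp]
lemma ores_refl {W : Opens Y.carrier} (h : W ≤ W) (r : Y.presheaf.obj (op W)) :
    ores Y h r = r :=
  ConcreteCategory.congr_hom (Y.presheaf.map_id (op W)) r

@[simp]
lemma ores_ores {U V W : Opens Y.carrier} (h : U ≤ V) (h' : V ≤ W)
    (r : Y.presheaf.obj (op W)) : ores Y h (ores Y h' r) = ores Y (h.trans h') r :=
  (ConcreteCategory.congr_hom (Y.presheaf.map_comp (homOfLE h').op (homOfLE h).op) r).symm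

/-- Pullback of functions. -/
def ocmp (f : X ⟶ Y) (V : Opens Y.carrier) :
    Y.presheaf.obj (op V) →+* X.presheaf.obj (op ((Opens.map f.hom.base).obj V)) :=
  (f.hom.c.app (op V)).hom

lemma ocmp_ores (f : X ⟶ Y) {V W : Opens Y.carrier} (h : V ≤ W) (r : Y.presheaf.obj (op W)) :
    ocmp f V (ores Y h r) =
      ores X (leOfHom ((Opens.map f.hom.base).map (homOfLE h))) (ocmp f W r) :=
  ConcreteCategory.congr_hom (f.hom.c.naturality (homOfLE h).op) r

lemma map_obj_comp (f : X ⟶ Y) (g : Y ⟶ Z) (h : X ⟶ Z) (e : f ≫ g = h) (V : Opens Z.carrier) :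
    (Opens.map h.hom.base).obj V =
      (Opens.map f.hom.base).obj ((Opens.map g.hom.base).obj V) := by
  subst e
  rfl

lemma map_obj_id (f : X ⟶ X) (e : f = 𝟙 X) (V : Opens X.carrier) :
    (Opens.map f.hom.base).obj V = V := by
  subst e
  rfl

lemma ocmp_comp (f : X ⟶ Y) (g : Y ⟶ Z) (h : X ⟶ Z) (e : f ≫ g = h) (V : Opens Z.carrier)
    (r : Z.presheaf.obj (op V)) :
    ocmp h V r = ores X (map_obj_comp f g h e V).le (ocmp f _ (ocmp g V r)) := by
  subst e
  exact (ores_refl _ _).symm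

lemma ocmp_id (f : X ⟶ X) (e : f = 𝟙 X) (V : Opens X.carrier) (r : X.presheaf.obj (op V)) :
    ocmp f V r = ores X (map_obj_id f e V).le r := by
  subst e
  exact (ores_refl _ _).symm

/-- The underlying presheaf of abelian groups of a module. -/
abbrev ab (M : Modules Y) : (Opens Y.carrier)ᵒᵖ ⥤ AddCommGrpCat.{u} := ((toAb Y).obj M).obj

/-- Multiplication of a section by a function. -/
def osmul (M : Modules Y) {V : Opens Y.carrier} (r : Y.presheaf.obj (op V)) :
    (ab M).obj (op V) →+ (ab M).obj (op V) :=
  let r' : (structureSheaf Y).obj.obj (op V) := r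
  DistribSMul.toAddMonoidHom (M.val.obj (op V)) r'

lemma osmul_one (M : Modules Y) {V : Opens Y.carrier} (s : (ab M).obj (op V)) :
    osmul M (1 : Y.presheaf.obj (op V)) s = s :=
  let s' : M.val.obj (op V) := s
  one_smul ((structureSheaf Y).obj.obj (op V)) s'

lemma osmul_mul (M : Modules Y) {V : Opens Y.carrier} (r r' : Y.presheaf.obj (op V))
    (s : (ab M).obj (op V)) : osmul M (r * r') s = osmul M r (osmul M r' s) :=
  let s' : M.val.obj (op V) := s
  let t : (structureSheaf Y).obj.obj (op V) := r
  let t' : (structureSheaf Y).obj.obj (op V) := r'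
  mul_smul t t' s'

lemma osmul_add (M : Modules Y) {V : Opens Y.carrier} (r r' : Y.presheaf.obj (op V))
    (s : (ab M).obj (op V)) : osmul M (r + r') s = osmul M r s + osmul M r' s :=
  let s' : M.val.obj (op V) := s
  let t : (structureSheaf Y).obj.obj (op V) := r
  let t' : (structureSheaf Y).obj.obj (op V) := r'
  add_smul t t' s'

lemma res_osmul (M : Modules Y) {V W : Opens Y.carrier} (h : V ≤ W) (r : Y.presheaf.obj (op W))
    (s : (ab M).obj (op W)) :
    res (ab M) h (osmul M r s) = osmul M (ores Y h r) (res (ab M) h s) :=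
  let s' : M.val.obj (op W) := s
  let t : (structureSheaf Y).obj.obj (op W) := r
  M.val.map_smul (homOfLE h).op t s'

/-- The map on sections `Γ(V, G) → Γ(f⁻¹ V, F)` given by `φ : f^* G ⟶ F`. -/
def cmp (f : X ⟶ Y) {G : Modules Y} {F : Modules X} (φ : (pullback f).obj G ⟶ F)
    (V : Opens Y.carrier) :
    (ab G).obj (op V) →+ (ab F).obj (op ((Opens.map f.hom.base).obj V)) :=
  secMap (moduleComparison f φ).hom V

lemma cmp_res (f : X ⟶ Y) {G : Modules Y} {F : Modules X} (φ : (pullback f).obj G ⟶ F)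
    {V W : Opens Y.carrier} (h : V ≤ W) (s : (ab G).obj (op W)) :
    cmp f φ V (res (ab G) h s) =
      res (ab F) (leOfHom ((Opens.map f.hom.base).map (homOfLE h))) (cmp f φ W s) :=
  secMap_res (moduleComparison f φ).hom h s

lemma cmp_osmul (f : X ⟶ Y) {G : Modules Y} {F : Modules X} (φ : (pullback f).obj G ⟶ F)
    {V : Opens Y.carrier} (r : Y.presheaf.obj (op V)) (s : (ab G).obj (op V)) :
    cmp f φ V (osmul G r s) = osmul F (ocmp f V r) (cmp f φ V s) :=
  let s' : G.val.obj (op V) := s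
  let t : (structureSheaf Y).obj.obj (op V) := r
  (((pullbackAdj f).homEquiv G F φ).val.app (op V)).hom.map_smul t s'

lemma pushforwardComp_app_apply (f : X ⟶ Y) (g : Y ⟶ Z) (h : X ⟶ Z) (e : f ≫ g = h)
    (F : Modules X) (V : Opens Z.carrier)
    (s : (ab F).obj (op ((Opens.map f.hom.base).obj ((Opens.map g.hom.base).obj V)))) :
    secMap ((toAb Z).map ((pushforwardComp f g h e).hom.app F)).hom V s =
      res (ab F) (map_obj_comp f g h e V).le s := by
  subst e
  exact (res_refl (ab F) _ s).symm

/-- `homEquiv_pullbackComp` read on sections; the equality of the two preimages enters as a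
restriction along `≤` instead of a transport. -/
lemma cmp_comp (f : X ⟶ Y) (g : Y ⟶ Z) (h : X ⟶ Z) (e : f ≫ g = h) {G : Modules Z}
    {M : Modules Y} {F : Modules X} (a : (pullback g).obj G ⟶ M) (b : (pullback f).obj M ⟶ F)
    (V : Opens Z.carrier) (s : (ab G).obj (op V)) :
    cmp h ((pullbackComp f g h e).hom.app G ≫ (pullback f).map a ≫ b) V s =
      res (ab F) (map_obj_comp f g h e V).le (cmp f b _ (cmp g a V s)) := by
  have h₁ := homEquiv_pullbackComp f g h e G a b
  have h₂ := congrArg (fun k => secMap ((toAb Z).map k).hom V s) h₁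
  refine h₂.trans ?_
  exact pushforwardComp_app_apply f g h e F V (cmp f b _ (cmp g a V s))

lemma pushforwardId_app_apply (f : X ⟶ X) (e : f = 𝟙 X) (F : Modules X) (V : Opens X.carrier)
    (s : (ab F).obj (op V)) :
    secMap ((toAb X).map ((pushforwardId f e).inv.app F)).hom V s =
      res (ab F) (map_obj_id f e V).le s := by
  subst e
  exact (res_refl (ab F) _ s).symm

lemma cmp_id (f : X ⟶ X) (e : f = 𝟙 X) (G : Modules X) (V : Opens X.carrier)
    (s : (ab G).obj (op V)) :
    cmp f ((pullbackId f e).hom.app G) V s = res (ab G) (map_obj_id f e V).le s := by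
  have h₁ := homEquiv_pullbackId f e G
  have h₂ := congrArg (fun k => secMap ((toAb X).map k).hom V s) h₁
  exact h₂.trans (pushforwardId_app_apply f e G V s)

lemma cmp_comp_right (f : X ⟶ Y) {G : Modules Y} {F F' : Modules X} (φ : (pullback f).obj G ⟶ F)
    (b : F ⟶ F') (V : Opens Y.carrier) (s : (ab G).obj (op V)) :
    cmp f (φ ≫ b) V s = secMap ((toAb X).map b).hom _ (cmp f φ V s) := by
  have h := (pullbackAdj f).homEquiv_naturality_right φ b
  exact congrArg (fun k => secMap ((toAb Y).map k).hom V s) h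

/-- Morphisms out of `f^* G` are determined by their adjoints, and these by their effect on
sections. -/
lemma hom_ext_cmp (f : X ⟶ Y) {G : Modules Y} {F : Modules X} (φ ψ : (pullback f).obj G ⟶ F)
    (h : ∀ V s, cmp f φ V s = cmp f ψ V s) : φ = ψ := by
  apply ((pullbackAdj f).homEquiv G F).injective
  apply (SheafOfModules.toSheaf (structureSheaf Y)).map_injective
  apply Sheaf.hom_ext
  apply NatTrans.ext
  funext V
  apply AddCommGrpCat.hom_ext
  exact AddMonoidHom.ext (h V.unop)

end ModuleSections

/-! ### The sheaf on the site of stages of a system of modules -/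

section SystemSheaf

variable {L : Type u} [Preorder L] {X : Lᵒᵖ ⥤ RingedSpace.{u, u}}

/-- A presheaf on the site of stages is a sheaf if its restrictions to the spaces are. -/
lemma isSheaf_of_restrict (F : (Stage X)ᵒᵖ ⥤ AddCommGrpCat.{u})
    (hF : ∀ l, TopCat.Presheaf.IsSheaf ((stageIncl X l).op ⋙ F)) :
    Presheaf.IsSheaf (stageTopology X) F := by
  rw [Presheaf.isSheaf_iff_isSheaf_forget (stageTopology X) F (forget AddCommGrpCat.{u}),
    isSheaf_iff_isSheaf_of_type]
  intro e S hS x hx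
  let N (l : L) : TopCat.Sheaf AddCommGrpCat.{u} (X.obj (op l)).carrier := ⟨_, hF l⟩
  -- Only the members of the sieve at the index of `e` are glued; by the definition of the topology
  -- they already cover.
  let ι : Type u := {V : Opens (X.obj (op e.l)).carrier // ∃ h : V ≤ e.V,
    S.arrows (homOfLE (Stage.mk_le_mk h) : (⟨e.l, V⟩ : Stage X) ⟶ e)}
  have hx' {e₁ e₂ e₃ : Stage X} (g₁ : e₃ ≤ e₁) (g₂ : e₃ ≤ e₂) (f₁ : e₁ ⟶ e) (f₂ : e₂ ⟶ e)
      (h₁ : S.arrows f₁) (h₂ : S.arrows f₂) :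
      sres F g₁ (x f₁ h₁) = sres F g₂ (x f₂ h₂) :=
    hx (homOfLE g₁) (homOfLE g₂) h₁ h₂ (Subsingleton.elim _ _)
  obtain ⟨t, ht⟩ := exists_glue (N e.l) (fun i : ι => i.1) e.V (fun i => i.2.1)
    (fun y hy => by
      obtain ⟨V, h, hyV, hV⟩ := hS y hy
      exact Opens.mem_iSup.2 ⟨⟨V, h, hV⟩, hyV⟩)
    (fun i => x _ i.2.2) (fun i j => hx' _ _ _ _ i.2.2 j.2.2)
  refine ⟨t, ?_, ?_⟩
  · intro e' f hf
    refine section_ext (N e'.l) (W := e'.V) _ _ fun y hy => ?_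
    have hle := leOfHom f
    obtain ⟨V, h, hyV, hV⟩ := hS _ (hle.2 hy)
    -- A member at another index is compared with `t` on the preimages of the opens used for gluing.
    have k : (⟨e'.l, e'.V ⊓ (transOpens X hle.1).obj V⟩ : Stage X) ≤ ⟨e.l, V⟩ :=
      ⟨hle.1, inf_le_right⟩
    have k' : (⟨e'.l, e'.V ⊓ (transOpens X hle.1).obj V⟩ : Stage X) ≤ e' :=
      Stage.mk_le_mk inf_le_left
    refine ⟨e'.V ⊓ (transOpens X hle.1).obj V, inf_le_left, ⟨hy, hyV⟩, ?_⟩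
    have h₁ : sres F (Stage.mk_le_mk h) t = x _ hV := ht ⟨V, h, hV⟩
    have h₂ : sres F (k.trans (Stage.mk_le_mk h)) t = sres F k' (x f hf) :=
      ((sres_sres F k (Stage.mk_le_mk h) t).symm.trans (congrArg (sres F k) h₁)).trans
        (hx' k k' _ f hV hf)
    refine Eq.trans ?_ h₂
    exact sres_sres F k' hle t
  · intro t' ht'
    refine section_ext (N e.l) (W := e.V) _ _ fun y hy => ?_
    obtain ⟨V, h, hyV, hV⟩ := hS y hy
    exact ⟨V, h, hyV, (ht' _ hV).trans (ht ⟨V, h, hV⟩).symm⟩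

variable (X) in
/-- The presheaf of rings on the site of stages. -/
def stageRing : (Stage X)ᵒᵖ ⥤ CommRingCat.{u} where
  obj e := (X.obj (op e.unop.l)).presheaf.obj (op e.unop.V)
  map {e e'} f := CommRingCat.ofHom
    ((ores _ (leOfHom f.unop).2).comp (ocmp (transition X (leOfHom f.unop).1) e.unop.V))
  map_id e := by
    ext r
    change ores _ _ (ocmp _ _ r) = r
    rw [ocmp_id _ (transition_refl X e.unop.l), ores_ores, ores_refl]
  map_comp {e e' e''} f g := by
    ext r
    change ores _ _ (ocmp _ _ r) = ores _ _ (ocmp _ _ (ores _ _ (ocmp _ _ r)))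
    rw [ocmp_comp _ _ _ (transition_trans X (leOfHom f.unop).1 (leOfHom g.unop).1), ores_ores,
      ocmp_ores, ores_ores]

namespace ModuleSystem

variable (S : ModuleSystem X)

lemma cmp_map_refl (l : L) (V : Opens (X.obj (op l)).carrier) {V' : Opens (X.obj (op l)).carrier}
    (h : V' ≤ (transOpens X (le_refl l)).obj V) (h' : V' ≤ V) (s : (ab (S.obj l)).obj (op V)) :
    res (ab (S.obj l)) h (cmp (transition X (le_refl l)) (S.map (le_refl l)) V s) =
      res (ab (S.obj l)) h' s := by
  rw [S.isModuleSystem.map_refl, cmp_id, res_res]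

lemma cmp_map_trans {l m n : L} (h : l ≤ m) (h' : m ≤ n) (V : Opens (X.obj (op l)).carrier)
    (s : (ab (S.obj l)).obj (op V)) :
    cmp (transition X (h.trans h')) (S.map (h.trans h')) V s =
      res (ab (S.obj n)) (map_obj_comp _ _ _ (transition_trans X h h') V).le
        (cmp (transition X h') (S.map h') _ (cmp (transition X h) (S.map h) V s)) := by
  rw [S.isModuleSystem.map_trans h h', cmp_comp]

/-- The presheaf on the site of stages of a system of modules. -/
def stagePresheaf : (Stage X)ᵒᵖ ⥤ AddCommGrpCat.{u} where
  obj e := (ab (S.obj e.unop.l)).obj (op e.unop.V)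
  map {e e'} f := AddCommGrpCat.ofHom
    ((res (ab (S.obj e'.unop.l)) (leOfHom f.unop).2).comp
      (cmp (transition X (leOfHom f.unop).1) (S.map (leOfHom f.unop).1) e.unop.V))
  map_id e := by
    ext s
    exact (S.cmp_map_refl e.unop.l e.unop.V _ le_rfl s).trans (res_refl _ _ _)
  map_comp {e e' e''} f g := by
    ext s
    refine (congrArg (res (ab (S.obj e''.unop.l)) _)
      (S.cmp_map_trans (leOfHom f.unop).1 (leOfHom g.unop).1 e.unop.V s)).trans ?_
    refine (res_res _ _ _ _).trans ?_
    refine Eq.trans ?_ (congrArg (res (ab (S.obj e''.unop.l)) (leOfHom g.unop).2)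
      (cmp_res (transition X (leOfHom g.unop).1) (S.map (leOfHom g.unop).1)
        (leOfHom f.unop).2 _).symm)
    exact (res_res _ _ _ _).symm

lemma stagePresheaf_sres_incl {l : L} {V V' : Opens (X.obj (op l)).carrier} (h : V ≤ V')
    (s : (ab (S.obj l)).obj (op V')) :
    sres S.stagePresheaf (e := ⟨l, V⟩) (e' := ⟨l, V'⟩) (Stage.mk_le_mk h) s =
      res (ab (S.obj l)) h s :=
  S.cmp_map_refl l V' _ h s

/-- The restriction of the presheaf of a system of modules to one of the spaces. -/
def stagePresheafIso (l : L) : (stageIncl X l).op ⋙ S.stagePresheaf ≅ ab (S.obj l) :=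
  NatIso.ofComponents (fun _ => Iso.refl _) (fun {V V'} f => by
    ext s
    exact S.stagePresheaf_sres_incl (leOfHom f.unop) s)

/-- The sheaf on the site of stages of a system of modules. -/
def stageSheaf : StageSheaf X :=
  ⟨S.stagePresheaf, isSheaf_of_restrict _ fun l =>
    TopCat.Presheaf.isSheaf_of_iso (S.stagePresheafIso l).symm ((toAb _).obj (S.obj l)).2⟩

/-- The restriction of the sheaf of a system of modules to one of the spaces. -/
def restrictStageIso (l : L) : (restrictStage X l).obj S.stageSheaf ≅ (toAb _).obj (S.obj l) :=
  (fullyFaithfulSheafToPresheaf _ _).preimageIso (S.stagePresheafIso l)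

end ModuleSystem

end SystemSheaf

/-! ### The structure sheaf of the limit -/

section Rings

/-- Restriction along an inequality replaces the transport between preimages under `f` and `g`. -/
lemma ringedSpace_hom_ext {X Y : RingedSpace.{u, u}} (f g : X ⟶ Y) (hb : f.hom.base = g.hom.base)
    (h : ∀ (V : Opens Y.carrier) (r : Y.presheaf.obj (op V)), ocmp f V r =
      ores X (congrArg (fun b => (Opens.map b).obj V) hb).le (ocmp g V r)) : f = g := by
  rcases f with ⟨⟨b, k⟩⟩
  rcases g with ⟨⟨b', k'⟩⟩
  obtain rfl : b = b' := hb
  have e : k = k' := by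
    apply NatTrans.ext
    funext V
    apply CommRingCat.hom_ext
    ext r
    exact (h V.unop r).trans (ores_refl _ _)
  rw [e]

/-- The morphism of ringed spaces which is the identity on spaces. -/
def homOfComorphism {T : TopCat.{u}} {O O' : TopCat.Presheaf CommRingCat.{u} T} (hO : O.IsSheaf)
    (hO' : O'.IsSheaf) (β : O' ⟶ O) :
    (⟨⟨T, O⟩, hO⟩ : RingedSpace.{u, u}) ⟶ (⟨⟨T, O'⟩, hO'⟩ : RingedSpace.{u, u}) where
  hom :=
    { base := 𝟙 T
      c := { app := fun V => β.app V, naturality := fun _ _ i => β.naturality i } }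

lemma exists_comorphism {T : TopCat.{u}} {O O' : TopCat.Presheaf CommRingCat.{u} T}
    (hO : O.IsSheaf) (hO' : O'.IsSheaf)
    (f : (⟨⟨T, O⟩, hO⟩ : RingedSpace.{u, u}) ⟶ (⟨⟨T, O'⟩, hO'⟩ : RingedSpace.{u, u}))
    (hf : f.hom.base = 𝟙 T) : ∃ β : O' ⟶ O, f = homOfComorphism hO hO' β := by
  rcases f with ⟨⟨b, k⟩⟩
  obtain rfl : b = 𝟙 T := hf
  exact ⟨{ app := fun V => k.app V, naturality := fun _ _ i => k.naturality i }, rfl⟩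

variable {L : Type u} [Preorder L] {X : Lᵒᵖ ⥤ RingedSpace.{u, u}} (c : Cone X)

lemma ocmp_proj_transition {e e' : Stage X} (h : e ≤ e')
    (r : (X.obj (op e'.l)).presheaf.obj (op e'.V)) :
    ocmp (c.π.app (op e.l)) e.V (ores (X.obj (op e.l)) h.2 (ocmp (transition X h.1) e'.V r)) =
      ores c.pt (stagePreimage_mono c h) (ocmp (c.π.app (op e'.l)) e'.V r) := by
  have h₁ := ocmp_ores (c.π.app (op e.l)) h.2 (ocmp (transition X h.1) e'.V r)
  have h₂ := ocmp_comp (c.π.app (op e.l)) _ _ (proj_transition c h.1) e'.V r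
  have h₃ := congrArg (ores c.pt (stagePreimage_mono c h)) h₂
  exact h₁.trans ((h₃.trans (ores_ores _ _ _)).symm)

/-- The pullback of functions at the stages to the vertex of a cone. -/
def stageRingToLimit : stageRing X ⟶ (stagePreimage c).op ⋙ c.pt.presheaf where
  app e := CommRingCat.ofHom (ocmp (c.π.app (op e.unop.l)) e.unop.V)
  naturality e e' f := by
    ext r
    exact ocmp_proj_transition c (leOfHom f.unop) r

/-- The presheaf colimit of the functions at the stages. -/
def ringLan : (Opens c.pt.carrier)ᵒᵖ ⥤ CommRingCat.{u} :=
  (stagePreimage c).op.lan.obj (stageRing X)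

/-- The maps from functions at the stages to their presheaf colimit. -/
def ringLanUnit : stageRing X ⟶ (stagePreimage c).op ⋙ ringLan c :=
  (stagePreimage c).op.lanUnit.app (stageRing X)

instance : (ringLan c).IsLeftKanExtension (ringLanUnit c) :=
  inferInstanceAs (((stagePreimage c).op.lan.obj (stageRing X)).IsLeftKanExtension
    ((stagePreimage c).op.lanUnit.app (stageRing X)))

/-- The comparison of the presheaf colimit of the functions at the stages with the structure sheaf
of the vertex. -/
def ringLanDesc : ringLan c ⟶ c.pt.presheaf :=
  Functor.descOfIsLeftKanExtension _ (ringLanUnit c) _ (stageRingToLimit c)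

lemma ringLanDesc_fac :
    ringLanUnit c ≫ Functor.whiskerLeft (stagePreimage c).op (ringLanDesc c) =
      stageRingToLimit c :=
  Functor.descOfIsLeftKanExtension_fac _ (ringLanUnit c) _ (stageRingToLimit c)

lemma ringLanDesc_unit (e : Stage X) (r : (stageRing X).obj (op e)) :
    ((ringLanDesc c).app (op ((stagePreimage c).obj e))).hom
      (((ringLanUnit c).app (op e)).hom r) = ocmp (c.π.app (op e.l)) e.V r :=
  congrArg (fun a => (a.app (op e)).hom r) (ringLanDesc_fac c)

/-- The sheaf colimit of the functions at the stages. -/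
def ringSheaf : (Opens c.pt.carrier)ᵒᵖ ⥤ CommRingCat.{u} :=
  sheafify (Opens.grothendieckTopology c.pt.carrier) (ringLan c)

/-- The map to the sheafification. -/
def toRingSheaf : ringLan c ⟶ ringSheaf c :=
  toSheafify (Opens.grothendieckTopology c.pt.carrier) (ringLan c)

lemma isSheaf_ringSheaf : TopCat.Presheaf.IsSheaf (ringSheaf c) :=
  ((presheafToSheaf (Opens.grothendieckTopology c.pt.carrier) CommRingCat.{u}).obj
    (ringLan c)).property

/-- The maps from functions at the stages to their sheaf colimit. -/
def ringSheafUnit : stageRing X ⟶ (stagePreimage c).op ⋙ ringSheaf c :=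
  ringLanUnit c ≫ Functor.whiskerLeft (stagePreimage c).op (toRingSheaf c)

/-- The universal properties of sheafification and of the Kan extension combined: such a map is
determined by the functions at the stages. -/
lemma ringSheaf_hom_ext {O : TopCat.Presheaf CommRingCat.{u} c.pt.carrier} (hO : O.IsSheaf)
    (a b : ringSheaf c ⟶ O)
    (h : ringSheafUnit c ≫ Functor.whiskerLeft (stagePreimage c).op a =
      ringSheafUnit c ≫ Functor.whiskerLeft (stagePreimage c).op b) : a = b := by
  refine sheafify_hom_ext (Opens.grothendieckTopology c.pt.carrier) a b hO ?_
  refine Functor.hom_ext_of_isLeftKanExtension (ringLan c) (ringLanUnit c) _ _ ?_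
  exact h

/-- The comparison of the sheaf colimit of the functions at the stages with the structure sheaf
of the vertex. -/
def ringSheafDesc : ringSheaf c ⟶ c.pt.presheaf :=
  sheafifyLift (Opens.grothendieckTopology c.pt.carrier) (ringLanDesc c) c.pt.IsSheaf

lemma toRingSheaf_ringSheafDesc : toRingSheaf c ≫ ringSheafDesc c = ringLanDesc c :=
  toSheafify_sheafifyLift _ _ _

/-- The vertex of a cone with the sheaf colimit of the functions at the stages as structure
sheaf. -/
abbrev stageRinged : RingedSpace.{u, u} := ⟨⟨c.pt.carrier, ringSheaf c⟩, isSheaf_ringSheaf c⟩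

lemma ringSheafUnit_naturality {e e' : Stage X} (h : e ≤ e') (r : (stageRing X).obj (op e')) :
    ((ringSheafUnit c).app (op e)).hom (ores (X.obj (op e.l)) h.2 (ocmp (transition X h.1) e'.V r)) =
      ores (stageRinged c) (stagePreimage_mono c h) (((ringSheafUnit c).app (op e')).hom r) :=
  ConcreteCategory.congr_hom ((ringSheafUnit c).naturality (homOfLE h).op) r

/-- The projections out of `stageRinged c`. -/
def stageRingedProj (l : L) : stageRinged c ⟶ X.obj (op l) where
  hom :=
    { base := (c.π.app (op l)).hom.base
      c :=
        { app := fun V => (ringSheafUnit c).app (op ⟨l, V.unop⟩)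
          naturality := fun V V' f => by
            ext r
            have h := ringSheafUnit_naturality c
              (Stage.mk_le_mk (leOfHom f.unop) : (⟨l, V'.unop⟩ : Stage X) ≤ ⟨l, V.unop⟩) r
            refine Eq.trans ?_ h
            refine congrArg (((ringSheafUnit c).app (op ⟨l, V'.unop⟩)).hom) ?_
            have e := ocmp_id (transition X (le_refl l)) (transition_refl X l) V.unop r
            refine Eq.trans ?_ (congrArg (ores (X.obj (op l)) _) e.symm)
            exact (ores_ores _ _ r).symm } }

lemma base_proj_transition {l m : L} (h : l ≤ m) :
    (c.π.app (op m)).hom.base ≫ (transition X h).hom.base = (c.π.app (op l)).hom.base :=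
  congrArg (fun f : c.pt ⟶ X.obj (op l) => f.hom.base) (proj_transition c h)

lemma stageRingedProj_transition {l m : L} (h : l ≤ m) :
    stageRingedProj c m ≫ transition X h = stageRingedProj c l := by
  refine ringedSpace_hom_ext _ _
    (base_proj_transition c h) ?_
  intro V r
  have e : (⟨m, (transOpens X h).obj V⟩ : Stage X) ≤ ⟨l, V⟩ := ⟨h, le_rfl⟩
  have k := ringSheafUnit_naturality c e r
  refine Eq.trans ?_ k
  exact congrArg (((ringSheafUnit c).app (op ⟨m, (transOpens X h).obj V⟩)).hom)
    (ores_refl _ _).symm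

/-- The cone with vertex `stageRinged c`. -/
def stageRingedCone : Cone X where
  pt := stageRinged c
  π :=
    { app := fun l => stageRingedProj c l.unop
      naturality := fun _ _ f => (Category.id_comp _).trans
        (stageRingedProj_transition c (leOfHom f.unop)).symm }

/-- The morphism from the vertex of a cone to `stageRinged c`. -/
def toStageRinged : c.pt ⟶ stageRinged c :=
  homOfComorphism c.pt.IsSheaf (isSheaf_ringSheaf c) (ringSheafDesc c)

lemma ringSheafDesc_unit (e : Stage X) (r : (stageRing X).obj (op e)) :
    ((ringSheafDesc c).app (op ((stagePreimage c).obj e))).hom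
      (((ringSheafUnit c).app (op e)).hom r) = ocmp (c.π.app (op e.l)) e.V r := by
  refine Eq.trans ?_ (ringLanDesc_unit c e r)
  exact congrArg (fun a => (a.app (op ((stagePreimage c).obj e))).hom
    (((ringLanUnit c).app (op e)).hom r)) (toRingSheaf_ringSheafDesc c)

lemma toStageRinged_proj (l : L) : toStageRinged c ≫ stageRingedProj c l = c.π.app (op l) := by
  refine ringedSpace_hom_ext _ _ rfl fun V r => ?_
  refine Eq.trans ?_ (ores_refl _ _).symm
  exact ringSheafDesc_unit c ⟨l, V⟩ r

variable {c}

/-- The space with structure sheaf `ringSheaf c` is a cone over the system, so the limit property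
gives a morphism from it to `c.pt`. Its base map is the identity by uniqueness, and its comorphism
`β` is the inverse. -/
lemma isIso_ringSheafDesc (hc : IsLimit c) : IsIso (ringSheafDesc c) := by
  obtain ⟨f, hf⟩ : ∃ f : stageRinged c ⟶ c.pt,
      ∀ l : L, f ≫ c.π.app (op l) = stageRingedProj c l :=
    ⟨hc.lift (stageRingedCone c), fun l => hc.fac (stageRingedCone c) (op l)⟩
  have h₁ : toStageRinged c ≫ f = 𝟙 c.pt := by
    refine hc.hom_ext fun l => ?_
    rw [Category.assoc, Category.id_comp]
    exact (congrArg (toStageRinged c ≫ ·) (hf l.unop)).trans (toStageRinged_proj c l.unop)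
  have hb : f.hom.base = 𝟙 c.pt.carrier := by
    refine (isLimitSpace hc).hom_ext fun l => ?_
    exact (congrArg (fun k : stageRinged c ⟶ X.obj l => k.hom.base) (hf l.unop)).trans
      (Category.id_comp _).symm
  obtain ⟨β, hβ⟩ := exists_comorphism (isSheaf_ringSheaf c) c.pt.IsSheaf f hb
  subst hβ
  refine ⟨β, ?_, ?_⟩
  -- This composite is compared with the identity on functions at the stages, where both maps are
  -- compatible with the projections.
  · refine ringSheaf_hom_ext c (isSheaf_ringSheaf c) _ _ ?_
    apply NatTrans.ext
    funext e
    apply CommRingCat.hom_ext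
    ext r
    have h₂ := ocmp_comp _ (c.π.app (op e.unop.l)) _ (hf e.unop.l) e.unop.V r
    have h₃ := ringSheafDesc_unit c e.unop r
    refine (congrArg (β.app (op ((stagePreimage c).obj e.unop))).hom h₃).trans ?_
    refine Eq.trans ?_ h₂.symm
    exact (ores_refl (Y := stageRinged c) le_rfl
      ((β.app (op ((stagePreimage c).obj e.unop))).hom
        (ocmp (c.π.app (op e.unop.l)) e.unop.V r))).symm
  -- This composite is the comorphism of `toStageRinged c ≫ f`, the identity by `h₁`.
  · apply NatTrans.ext
    funext V
    apply CommRingCat.hom_ext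
    ext r
    have h₂ := ocmp_comp _ _ _ h₁ V.unop r
    refine Eq.trans ?_ (h₂.symm.trans ?_)
    · exact (ores_refl _ _).symm
    · exact (ocmp_id (𝟙 c.pt) rfl V.unop r).trans (ores_refl _ _)

/-- The comparison of the presheaf colimit of the functions at the stages with the structure sheaf
of the vertex. -/
def ringLanToStructureSheaf (c : Cone X) :
    ringLan c ⋙ forget₂ CommRingCat.{u} RingCat.{u} ⟶ (structureSheaf c.pt).obj :=
  Functor.whiskerRight (ringLanDesc c) _

/-- The map is sheafification followed by an isomorphism. Local bijectivity is what permits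
sheafifying modules over `ringLan c` to `O_X`-modules. -/
lemma isLocallyInjective_ringLanDesc (hc : IsLimit c) :
    CategoryTheory.Presheaf.IsLocallyInjective (Opens.grothendieckTopology c.pt.carrier)
      (ringLanDesc c) := by
  have := isIso_ringSheafDesc hc
  have : CategoryTheory.Presheaf.IsLocallyInjective (Opens.grothendieckTopology c.pt.carrier)
      (toRingSheaf c) :=
    inferInstanceAs (CategoryTheory.Presheaf.IsLocallyInjective _
      (toSheafify (Opens.grothendieckTopology c.pt.carrier) (ringLan c)))
  rw [← toRingSheaf_ringSheafDesc]
  infer_instance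

lemma isLocallySurjective_ringLanDesc (hc : IsLimit c) :
    CategoryTheory.Presheaf.IsLocallySurjective (Opens.grothendieckTopology c.pt.carrier)
      (ringLanDesc c) := by
  have := isIso_ringSheafDesc hc
  have : CategoryTheory.Presheaf.IsLocallySurjective (Opens.grothendieckTopology c.pt.carrier)
      (toRingSheaf c) :=
    inferInstanceAs (CategoryTheory.Presheaf.IsLocallySurjective _
      (toSheafify (Opens.grothendieckTopology c.pt.carrier) (ringLan c)))
  rw [← toRingSheaf_ringSheafDesc]
  infer_instance

lemma isLocallyInjective_ringLanToStructureSheaf (hc : IsLimit c) :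
    CategoryTheory.Presheaf.IsLocallyInjective (Opens.grothendieckTopology c.pt.carrier)
      (ringLanToStructureSheaf c) where
  equalizerSieve_mem x y h :=
    (isLocallyInjective_ringLanDesc hc).equalizerSieve_mem x y h

lemma isLocallySurjective_ringLanToStructureSheaf (hc : IsLimit c) :
    CategoryTheory.Presheaf.IsLocallySurjective (Opens.grothendieckTopology c.pt.carrier)
      (ringLanToStructureSheaf c) where
  imageSieve_mem s := (isLocallySurjective_ringLanDesc hc).imageSieve_mem s

end Rings

/-! ### The module structure on the colimit of a system of modules -/

section ColimitModule

variable {L : Type u} [Preorder L] {X : Lᵒᵖ ⥤ RingedSpace.{u, u}}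

/-- Restriction of functions on the site of stages. -/
def rres {e e' : Stage X} (h : e ≤ e') :
    (stageRing X).obj (op e') →+* (stageRing X).obj (op e) :=
  ((stageRing X).map (homOfLE h).op).hom

namespace ModuleSystem

variable (S : ModuleSystem X)

/-- Multiplication of a section at a stage by a function. -/
def stageSmul {e : Stage X} (a : (stageRing X).obj (op e)) :
    S.stagePresheaf.obj (op e) →+ S.stagePresheaf.obj (op e) :=
  osmul (S.obj e.l) (V := e.V) a

lemma sres_stageSmul {e e' : Stage X} (h : e ≤ e') (a : (stageRing X).obj (op e'))
    (s : S.stagePresheaf.obj (op e')) :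
    sres S.stagePresheaf h (S.stageSmul a s) =
      S.stageSmul (rres h a) (sres S.stagePresheaf h s) := by
  have h₁ := congrArg (res (ab (S.obj e.l)) h.2)
    (cmp_osmul (transition X h.1) (S.map h.1) (V := e'.V) a s)
  exact h₁.trans (res_osmul _ _ _ _)

end ModuleSystem

variable (c : Cone X)

/-- The function on `W` represented by a function at a stage. -/
def ringRep {W : Opens c.pt.carrier} {e : Stage X} (h : W ≤ (stagePreimage c).obj e) :
    (stageRing X).obj (op e) →+* (ringLan c).obj (op W) :=
  ((ringLan c).map (homOfLE h).op).hom.comp ((ringLanUnit c).app (op e)).hom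

lemma ringRep_rres {W : Opens c.pt.carrier} {e e' : Stage X} (h : W ≤ (stagePreimage c).obj e)
    (h' : W ≤ (stagePreimage c).obj e') (k : e ≤ e') (a : (stageRing X).obj (op e')) :
    ringRep c h (rres k a) = ringRep c h' a := by
  have h₁ := ConcreteCategory.congr_hom ((ringLanUnit c).naturality (homOfLE k).op) a
  have h₂ := congrArg ((ringLan c).map (homOfLE h).op).hom h₁
  refine h₂.trans ?_
  exact (ConcreteCategory.congr_hom ((ringLan c).map_comp
    (homOfLE (stagePreimage_mono c k)).op (homOfLE h).op) _).symm

lemma map_ringRep {W W' : Opens c.pt.carrier} {e : Stage X} (h : W ≤ (stagePreimage c).obj e)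
    (i : W' ≤ W) (a : (stageRing X).obj (op e)) :
    ((ringLan c).map (homOfLE i).op).hom (ringRep c h a) = ringRep c (i.trans h) a :=
  (ConcreteCategory.congr_hom ((ringLan c).map_comp (homOfLE h).op (homOfLE i).op) _).symm

/-- The presheaf colimit of the sections at the stages. -/
abbrev modLan (S : ModuleSystem X) : (Opens c.pt.carrier)ᵒᵖ ⥤ AddCommGrpCat.{u} :=
  (stagePreimage c).op.lan.obj S.stagePresheaf

variable (S : ModuleSystem X)

/-- The section on `W` represented by a section at a stage. -/
def modRep {W : Opens c.pt.carrier} {e : Stage X} (h : W ≤ (stagePreimage c).obj e) :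
    S.stagePresheaf.obj (op e) →+ (modLan c S).obj (op W) :=
  (res (modLan c S) h).comp ((lanStageMap c S.stagePresheaf).map e)

lemma modRep_sres {W : Opens c.pt.carrier} {e e' : Stage X} (h : W ≤ (stagePreimage c).obj e)
    (h' : W ≤ (stagePreimage c).obj e') (k : e ≤ e') (s : S.stagePresheaf.obj (op e')) :
    modRep c S h (sres S.stagePresheaf k s) = modRep c S h' s := by
  have h₁ := congrArg (res (modLan c S) h) ((lanStageMap c S.stagePresheaf).map_sres k s)
  exact h₁.trans (res_res _ _ _ _)

lemma res_modRep {W W' : Opens c.pt.carrier} {e : Stage X} (h : W ≤ (stagePreimage c).obj e)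
    (i : W' ≤ W) (s : S.stagePresheaf.obj (op e)) :
    res (modLan c S) i (modRep c S h s) = modRep c S (i.trans h) s :=
  res_res _ _ _ _

section Rep

variable [IsDirectedOrder L]

lemma exists_common_stage {W : Opens c.pt.carrier} {e e' : Stage X}
    (h : W ≤ (stagePreimage c).obj e) (h' : W ≤ (stagePreimage c).obj e') :
    ∃ e'' : Stage X, e'' ≤ e ∧ e'' ≤ e' ∧ W ≤ (stagePreimage c).obj e'' := by
  obtain ⟨e'', k, k', h''⟩ := Stage.exists_le_le c e e'
  exact ⟨e'', k, k', (le_inf h h').trans h''⟩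

variable [Nonempty L]

lemma exists_ringRep {W : Opens c.pt.carrier} (r : (ringLan c).obj (op W)) :
    ∃ (e : Stage X) (h : W ≤ (stagePreimage c).obj e) (a : (stageRing X).obj (op e)),
      ringRep c h a = r := by
  have H := Functor.isPointwiseLeftKanExtensionOfIsLeftKanExtension (F := stageRing X)
      (ringLan c) (ringLanUnit c) (op W)
  obtain ⟨j, s, hs⟩ := Concrete.isColimit_exists_rep _ H r
  exact ⟨j.left.unop, leOfHom j.hom.unop, s, hs⟩

lemma exists_rres_eq {W : Opens c.pt.carrier} {e : Stage X} (h : W ≤ (stagePreimage c).obj e)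
    (a a' : (stageRing X).obj (op e)) (ha : ringRep c h a = ringRep c h a') :
    ∃ (e' : Stage X) (k : e' ≤ e), W ≤ (stagePreimage c).obj e' ∧ rres k a = rres k a' := by
  have H := Functor.isPointwiseLeftKanExtensionOfIsLeftKanExtension (F := stageRing X)
      (ringLan c) (ringLanUnit c) (op W)
  let j : CostructuredArrow (stagePreimage c).op (op W) :=
    CostructuredArrow.mk (Y := op e) (homOfLE h).op
  obtain ⟨k, f, g, hfg⟩ := Concrete.isColimit_exists_of_rep_eq _ H (i := j) (j := j) a a' ha
  obtain rfl : f = g := CostructuredArrow.hom_ext _ _ (Subsingleton.elim _ _)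
  exact ⟨k.left.unop, leOfHom f.left.unop, leOfHom k.hom.unop, hfg⟩

lemma exists_modRep {W : Opens c.pt.carrier} (m : (modLan c S).obj (op W)) :
    ∃ (e : Stage X) (h : W ≤ (stagePreimage c).obj e) (s : S.stagePresheaf.obj (op e)),
      modRep c S h s = m := by
  obtain ⟨e, h, s, rfl⟩ := (isColimitPresentation_lanStageMap c S.stagePresheaf).exists_rep W m
  exact ⟨e, h, s, rfl⟩

lemma exists_sres_eq {W : Opens c.pt.carrier} {e : Stage X} (h : W ≤ (stagePreimage c).obj e)
    (s s' : S.stagePresheaf.obj (op e)) (hs : modRep c S h s = modRep c S h s') :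
    ∃ (e' : Stage X) (k : e' ≤ e), W ≤ (stagePreimage c).obj e' ∧
      sres S.stagePresheaf k s = sres S.stagePresheaf k s' := by
  obtain ⟨e', k, hW, h'⟩ := (isColimitPresentation_lanStageMap c S.stagePresheaf).exists_eq_zero
    W e h (s - s') (Eq.trans (map_sub (modRep c S h) s s') (sub_eq_zero.2 hs))
  exact ⟨e', k, hW, sub_eq_zero.1 ((map_sub _ _ _).symm.trans h')⟩

lemma exists_rep {W : Opens c.pt.carrier} (r : (ringLan c).obj (op W))
    (m : (modLan c S).obj (op W)) :
    ∃ (e : Stage X) (h : W ≤ (stagePreimage c).obj e) (a : (stageRing X).obj (op e))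
      (s : S.stagePresheaf.obj (op e)), ringRep c h a = r ∧ modRep c S h s = m := by
  obtain ⟨e₁, h₁, a, rfl⟩ := exists_ringRep c r
  obtain ⟨e₂, h₂, s, rfl⟩ := exists_modRep c S m
  obtain ⟨e, k₁, k₂, h⟩ := exists_common_stage c h₁ h₂
  exact ⟨e, h, rres k₁ a, sres _ k₂ s, ringRep_rres c h h₁ k₁ a, modRep_sres c S h h₂ k₂ s⟩

/-- Well-definedness of the product: equal representatives become equal at a common later stage, and
restriction there is semilinear. -/
lemma modRep_stageSmul_eq {W : Opens c.pt.carrier} {e e' : Stage X}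
    (h : W ≤ (stagePreimage c).obj e) (h' : W ≤ (stagePreimage c).obj e')
    (a : (stageRing X).obj (op e)) (a' : (stageRing X).obj (op e'))
    (s : S.stagePresheaf.obj (op e)) (s' : S.stagePresheaf.obj (op e'))
    (ha : ringRep c h a = ringRep c h' a') (hs : modRep c S h s = modRep c S h' s') :
    modRep c S h (S.stageSmul a s) = modRep c S h' (S.stageSmul a' s') := by
  obtain ⟨e₁, k, k', h₁⟩ := exists_common_stage c h h'
  rw [← ringRep_rres c h₁ h k, ← ringRep_rres c h₁ h' k'] at ha
  rw [← modRep_sres c S h₁ h k, ← modRep_sres c S h₁ h' k'] at hs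
  obtain ⟨e₂, l₂, h₂, ha₂⟩ := exists_rres_eq c h₁ _ _ ha
  obtain ⟨e₃, l₃, h₃, hs₃⟩ := exists_sres_eq c S h₁ _ _ hs
  obtain ⟨e₄, m₂, m₃, h₄⟩ := exists_common_stage c h₂ h₃
  have e₅ : rres (m₂.trans l₂) (rres k a) = rres (m₂.trans l₂) (rres k' a') := by
    have := congrArg (rres m₂) ha₂
    have hh (x : (stageRing X).obj (op e₁)) : rres m₂ (rres l₂ x) = rres (m₂.trans l₂) x :=
      (ConcreteCategory.congr_hom ((stageRing X).map_comp (homOfLE l₂).op (homOfLE m₂).op) x).symm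
    rwa [hh, hh] at this
  have e₆ : sres S.stagePresheaf (m₂.trans l₂) (sres _ k s) =
      sres S.stagePresheaf (m₂.trans l₂) (sres _ k' s') := by
    have := congrArg (sres _ m₃) hs₃
    simp only [sres_sres] at this ⊢
    exact this
  rw [← modRep_sres c S h₁ h k, ← modRep_sres c S h₁ h' k', ← modRep_sres c S h₄ h₁ (m₂.trans l₂),
    ← modRep_sres c S h₄ h₁ (m₂.trans l₂), S.sres_stageSmul, S.sres_stageSmul, S.sres_stageSmul,
    S.sres_stageSmul, e₅, e₆]

/-- Multiplication of a section of the presheaf colimit by a function. -/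
def lanSmul {W : Opens c.pt.carrier} (r : (ringLan c).obj (op W))
    (m : (modLan c S).obj (op W)) : (modLan c S).obj (op W) :=
  modRep c S (exists_rep c S r m).choose_spec.choose
    (S.stageSmul (exists_rep c S r m).choose_spec.choose_spec.choose
      (exists_rep c S r m).choose_spec.choose_spec.choose_spec.choose)

lemma lanSmul_rep {W : Opens c.pt.carrier} {e : Stage X} (h : W ≤ (stagePreimage c).obj e)
    (a : (stageRing X).obj (op e)) (s : S.stagePresheaf.obj (op e)) :
    lanSmul c S (ringRep c h a) (modRep c S h s) = modRep c S h (S.stageSmul a s) :=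
  have H := (exists_rep c S (ringRep c h a)
    (modRep c S h s)).choose_spec.choose_spec.choose_spec.choose_spec
  modRep_stageSmul_eq c S _ h _ a _ s H.1 H.2

/-- All elements occurring in a module axiom are represented at one stage, where the axiom holds. -/
lemma exists_rep_rep {W : Opens c.pt.carrier} (r r' : (ringLan c).obj (op W))
    (m m' : (modLan c S).obj (op W)) :
    ∃ (e : Stage X) (h : W ≤ (stagePreimage c).obj e) (a a' : (stageRing X).obj (op e))
      (s s' : S.stagePresheaf.obj (op e)), ringRep c h a = r ∧ ringRep c h a' = r' ∧
        modRep c S h s = m ∧ modRep c S h s' = m' := by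
  obtain ⟨e₁, h₁, a, s, rfl, rfl⟩ := exists_rep c S r m
  obtain ⟨e₂, h₂, a', s', rfl, rfl⟩ := exists_rep c S r' m'
  obtain ⟨e, k₁, k₂, h⟩ := exists_common_stage c h₁ h₂
  exact ⟨e, h, rres k₁ a, rres k₂ a', sres _ k₁ s, sres _ k₂ s', ringRep_rres c h h₁ k₁ a,
    ringRep_rres c h h₂ k₂ a', modRep_sres c S h h₁ k₁ s, modRep_sres c S h h₂ k₂ s'⟩

lemma lanSmul_add {W : Opens c.pt.carrier} (r : (ringLan c).obj (op W))
    (m m' : (modLan c S).obj (op W)) :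
    lanSmul c S r (m + m') = lanSmul c S r m + lanSmul c S r m' := by
  obtain ⟨e, h, a, -, s, s', rfl, -, rfl, rfl⟩ := exists_rep_rep c S r r m m'
  rw [← map_add, lanSmul_rep, lanSmul_rep, lanSmul_rep, map_add, map_add]

lemma add_lanSmul {W : Opens c.pt.carrier} (r r' : (ringLan c).obj (op W))
    (m : (modLan c S).obj (op W)) :
    lanSmul c S (r + r') m = lanSmul c S r m + lanSmul c S r' m := by
  obtain ⟨e, h, a, a', s, -, rfl, rfl, rfl, -⟩ := exists_rep_rep c S r r' m m
  rw [← map_add, lanSmul_rep, lanSmul_rep, lanSmul_rep, ← map_add]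
  exact congrArg (modRep c S h) (osmul_add (S.obj e.l) (V := e.V) a a' s)

lemma mul_lanSmul {W : Opens c.pt.carrier} (r r' : (ringLan c).obj (op W))
    (m : (modLan c S).obj (op W)) :
    lanSmul c S (r * r') m = lanSmul c S r (lanSmul c S r' m) := by
  obtain ⟨e, h, a, a', s, -, rfl, rfl, rfl, -⟩ := exists_rep_rep c S r r' m m
  rw [← map_mul, lanSmul_rep, lanSmul_rep, lanSmul_rep]
  exact congrArg (modRep c S h) (osmul_mul (S.obj e.l) (V := e.V) a a' s)

lemma one_lanSmul {W : Opens c.pt.carrier} (m : (modLan c S).obj (op W)) :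
    lanSmul c S 1 m = m := by
  obtain ⟨e, h, s, rfl⟩ := exists_modRep c S m
  rw [← map_one (ringRep c h), lanSmul_rep]
  exact congrArg (modRep c S h) (osmul_one (S.obj e.l) (V := e.V) s)

lemma res_lanSmul {W W' : Opens c.pt.carrier} (i : W' ≤ W) (r : (ringLan c).obj (op W))
    (m : (modLan c S).obj (op W)) :
    res (modLan c S) i (lanSmul c S r m) =
      lanSmul c S (((ringLan c).map (homOfLE i).op).hom r) (res (modLan c S) i m) := by
  obtain ⟨e, h, a, s, rfl, rfl⟩ := exists_rep c S r m
  rw [lanSmul_rep, map_ringRep, res_modRep, res_modRep, lanSmul_rep]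

instance (W : (Opens c.pt.carrier)ᵒᵖ) :
    Module ((ringLan c ⋙ forget₂ CommRingCat.{u} RingCat.{u}).obj W) ((modLan c S).obj W) :=
  letI : SMul ((ringLan c ⋙ forget₂ CommRingCat.{u} RingCat.{u}).obj W) ((modLan c S).obj W) :=
    ⟨fun r m => lanSmul c S (W := W.unop) r m⟩
  Module.ofMinimalAxioms (lanSmul_add c S (W := W.unop)) (add_lanSmul c S (W := W.unop))
    (mul_lanSmul c S (W := W.unop)) (one_lanSmul c S (W := W.unop))

/-- The presheaf colimit of the sections at the stages, as a presheaf of modules. -/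
def lanModule : PresheafOfModules.{u} (ringLan c ⋙ forget₂ CommRingCat.{u} RingCat.{u}) :=
  PresheafOfModules.ofPresheaf (modLan c S) fun _ _ f r m =>
    res_lanSmul c S (leOfHom f.unop) r m

end Rep

end ColimitModule

/-! ### The colimit of a system of modules as an inverse image -/

section ColimitModuleIso

/-- A semilinear family of maps on sections compatible with restriction is a morphism `G ⟶ f_* F`;
its adjoint is the desired one. -/
lemma exists_cmp_eq {X Y : RingedSpace.{u, u}} (f : X ⟶ Y) {G : Modules Y} {F : Modules X}
    (a : ∀ V, (ab G).obj (op V) →+ (ab F).obj (op ((Opens.map f.hom.base).obj V)))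
    (ha : ∀ ⦃V W : Opens Y.carrier⦄ (h : V ≤ W) (s : (ab G).obj (op W)), a V (res (ab G) h s) =
      res (ab F) (leOfHom ((Opens.map f.hom.base).map (homOfLE h))) (a W s))
    (ha' : ∀ (V : Opens Y.carrier) (r : Y.presheaf.obj (op V)) (s : (ab G).obj (op V)),
      a V (osmul G r s) = osmul F (ocmp f V r) (a V s)) :
    ∃ φ : (pullback f).obj G ⟶ F, ∀ V s, cmp f φ V s = a V s := by
  let τ : G.val.presheaf ⟶ ((pushforward f).obj F).val.presheaf :=
    { app := fun V => AddCommGrpCat.ofHom (a V.unop)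
      naturality := fun V W i => by
        ext s
        exact ha (leOfHom i.unop) s }
  let ψ : G ⟶ (pushforward f).obj F :=
    ⟨PresheafOfModules.homMk τ fun V r s => ha' V.unop r s⟩
  refine ⟨((pullbackAdj f).homEquiv G F).symm ψ, fun V s => ?_⟩
  have h := ((pullbackAdj f).homEquiv G F).apply_symm_apply ψ
  exact congrArg (fun k => secMap ((toAb Y).map k).hom V s) h

variable {L : Type u} [Preorder L] {X : Lᵒᵖ ⥤ RingedSpace.{u, u}} {c : Cone X}
  (S : ModuleSystem X)

section Cocone

variable (t : Cocone (S.pulledBack c))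

lemma cmp_cocone {e e' : Stage X} (h : e ≤ e') (s : (ab (S.obj e'.l)).obj (op e'.V)) :
    cmp (c.π.app (op e.l)) (t.ι.app e.l) e.V
        (res (ab (S.obj e.l)) h.2 (cmp (transition X h.1) (S.map h.1) e'.V s)) =
      res (ab t.pt) (stagePreimage_mono c h) (cmp (c.π.app (op e'.l)) (t.ι.app e'.l) e'.V s) := by
  have h₁ : t.ι.app e'.l = (pullbackComp (c.π.app (op e.l)) (transition X h.1) (c.π.app (op e'.l))
      (proj_transition c h.1)).hom.app (S.obj e'.l) ≫
        (pullback (c.π.app (op e.l))).map (S.map h.1) ≫ t.ι.app e.l :=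
    (t.w (homOfLE h.1)).symm.trans (Category.assoc _ _ _)
  have h₂ := cmp_comp (c.π.app (op e.l)) (transition X h.1) (c.π.app (op e'.l))
      (proj_transition c h.1) (S.map h.1) (t.ι.app e.l) e'.V s
  rw [← h₁] at h₂
  have h₃ := congrArg (res (ab t.pt) (stagePreimage_mono c h)) h₂
  have h₄ := cmp_res (c.π.app (op e.l)) (t.ι.app e.l) h.2 (cmp (transition X h.1) (S.map h.1) e'.V s)
  refine h₄.trans (Eq.trans ?_ h₃.symm)
  exact (res_res _ _ _ _).symm

/-- The maps from the sections at the stages to the sections of the vertex of a cocone. -/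
def coconeStageMap : S.stagePresheaf ⟶ (stagePreimage c).op ⋙ ab t.pt where
  app e := AddCommGrpCat.ofHom (cmp (c.π.app (op e.unop.l)) (t.ι.app e.unop.l) e.unop.V)
  naturality e e' f := by
    ext s
    exact cmp_cocone S t (leOfHom f.unop) s

/-- The morphism from the presheaf colimit of the sections at the stages to the vertex of a
cocone. -/
def lanModuleDesc : modLan c S ⟶ ab t.pt :=
  Functor.descOfIsLeftKanExtension _ ((stagePreimage c).op.lanUnit.app S.stagePresheaf) _
    (coconeStageMap S t)

lemma lanModuleDesc_modRep {W : Opens c.pt.carrier} {e : Stage X}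
    (h : W ≤ (stagePreimage c).obj e) (s : S.stagePresheaf.obj (op e)) :
    secMap (lanModuleDesc S t) W (modRep c S h s) =
      res (ab t.pt) h (cmp (c.π.app (op e.l)) (t.ι.app e.l) e.V s) := by
  have h₁ := Functor.descOfIsLeftKanExtension_fac _
    ((stagePreimage c).op.lanUnit.app S.stagePresheaf) _ (coconeStageMap S t)
  have h₂ := congrArg (fun a => (a.app (op e)).hom s) h₁
  refine (secMap_res (lanModuleDesc S t) h _).trans ?_
  exact congrArg (res (ab t.pt) h) h₂

lemma ringLanDesc_ringRep {W : Opens c.pt.carrier} {e : Stage X}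
    (h : W ≤ (stagePreimage c).obj e) (a : (stageRing X).obj (op e)) :
    ((ringLanDesc c).app (op W)).hom (ringRep c h a) =
      ores c.pt h (ocmp (c.π.app (op e.l)) e.V a) := by
  have h₁ := ConcreteCategory.congr_hom ((ringLanDesc c).naturality (homOfLE h).op)
    (((ringLanUnit c).app (op e)).hom a)
  refine h₁.trans ?_
  exact congrArg (ores c.pt h) (ringLanDesc_unit c e a)

end Cocone

variable [IsDirectedOrder L] [Nonempty L]

/-- The map from the presheaf colimit of the sections at the stages to its sheafification. -/
def lanModuleToSheaf (c : Cone X) :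
    (lanModule c S).presheaf ⟶ ((stagePullback c).obj S.stageSheaf).obj :=
  toSheafify (Opens.grothendieckTopology c.pt.carrier) (modLan c S)

instance (c : Cone X) : CategoryTheory.Presheaf.IsLocallyInjective
    (Opens.grothendieckTopology c.pt.carrier) (lanModuleToSheaf S c) :=
  inferInstanceAs (CategoryTheory.Presheaf.IsLocallyInjective
    (Opens.grothendieckTopology c.pt.carrier)
    (toSheafify (Opens.grothendieckTopology c.pt.carrier) (modLan c S)))

instance (c : Cone X) : CategoryTheory.Presheaf.IsLocallySurjective
    (Opens.grothendieckTopology c.pt.carrier) (lanModuleToSheaf S c) :=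
  inferInstanceAs (CategoryTheory.Presheaf.IsLocallySurjective
    (Opens.grothendieckTopology c.pt.carrier)
    (toSheafify (Opens.grothendieckTopology c.pt.carrier) (modLan c S)))

/-- The inverse image of the sheaf of a system of modules, as a module. -/
def limitModule (hc : IsLimit c) : Modules c.pt :=
  haveI := isLocallyInjective_ringLanToStructureSheaf hc
  haveI := isLocallySurjective_ringLanToStructureSheaf hc
  PresheafOfModules.sheafify (ringLanToStructureSheaf c) (lanModuleToSheaf S c)

lemma unitStageMap_map (e : Stage X) (s : S.stagePresheaf.obj (op e)) :
    (unitStageMap c S.stageSheaf).map e s =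
      secMap (toSheafify (Opens.grothendieckTopology c.pt.carrier) (modLan c S))
        ((stagePreimage c).obj e) (modRep c S le_rfl s) := by
  have h := congrArg (fun a => (a.app (op e)).hom s) (stageAdj_unit_app c S.stageSheaf)
  refine h.trans ?_
  exact congrArg (secMap (toSheafify (Opens.grothendieckTopology c.pt.carrier) (modLan c S))
    ((stagePreimage c).obj e)) (res_refl (modLan c S) le_rfl _).symm

lemma osmul_limitModule (hc : IsLimit c) {W : Opens c.pt.carrier} (r : (ringLan c).obj (op W))
    (m : (modLan c S).obj (op W)) :
    osmul (limitModule S hc) (((ringLanDesc c).app (op W)).hom r)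
      (secMap (toSheafify (Opens.grothendieckTopology c.pt.carrier) (modLan c S)) W m) =
    secMap (toSheafify (Opens.grothendieckTopology c.pt.carrier) (modLan c S)) W
      (lanSmul c S r m) := by
  have := isLocallyInjective_ringLanToStructureSheaf hc
  have := isLocallySurjective_ringLanToStructureSheaf hc
  let φ := PresheafOfModules.toSheafify (ringLanToStructureSheaf c) (lanModuleToSheaf S c)
  let r' : (ringLan c ⋙ forget₂ CommRingCat.{u} RingCat.{u}).obj (op W) := r
  let m' : (lanModule c S).obj (op W) := m
  exact ((φ.app (op W)).hom.map_smul r' m').symm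

lemma osmul_unitStageMap (hc : IsLimit c) (e : Stage X) (a : (stageRing X).obj (op e))
    (s : S.stagePresheaf.obj (op e)) :
    (unitStageMap c S.stageSheaf).map e (S.stageSmul a s) =
      osmul (limitModule S hc) (ocmp (c.π.app (op e.l)) e.V a)
        ((unitStageMap c S.stageSheaf).map e s) := by
  have h₁ := osmul_limitModule S hc (((ringLanUnit c).app (op e)).hom a)
    (modRep c S le_rfl s)
  have h₂ : ((ringLanUnit c).app (op e)).hom a = ringRep c le_rfl a :=
    (ConcreteCategory.congr_hom ((ringLan c).map_id (op ((stagePreimage c).obj e)))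
      (((ringLanUnit c).app (op e)).hom a)).symm
  have h₃ := congrArg (fun x => secMap (toSheafify (Opens.grothendieckTopology c.pt.carrier)
    (modLan c S)) ((stagePreimage c).obj e) (lanSmul c S x (modRep c S le_rfl s))) h₂
  have h₄ := congrArg (secMap (toSheafify (Opens.grothendieckTopology c.pt.carrier)
    (modLan c S)) ((stagePreimage c).obj e)) (lanSmul_rep c S le_rfl a s)
  refine (unitStageMap_map S e _).trans (((h₁.trans h₃).trans h₄).symm.trans ?_)
  have h₅ := unitStageMap_map (c := c) S e s
  have h₆ := ringLanDesc_unit c e a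
  refine (congrArg (fun x => osmul (limitModule S hc) (V := (stagePreimage c).obj e) x
    (secMap (toSheafify (Opens.grothendieckTopology c.pt.carrier) (modLan c S))
        ((stagePreimage c).obj e) (modRep c S le_rfl s))) h₆).trans ?_
  exact congrArg (osmul (limitModule S hc) (V := (stagePreimage c).obj e)
    (ocmp (c.π.app (op e.l)) e.V a)) h₅.symm

/-- The maps of `unitStageMap` are semilinear over the functions at the stages, so they define
morphisms from the `v_l^* F_l`. Compatibility with the transition maps is `map_sres`. -/
lemma exists_cocone_limitModule (hc : IsLimit c) :
    ∃ φ : ∀ l : L, (pullback (c.π.app (op l))).obj (S.obj l) ⟶ limitModule S hc,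
      (∀ (l m : L) (h : l ≤ m), S.pulledBackMap c (l := l) (m := m) h ≫ φ m = φ l) ∧
      ∀ (e : Stage X) (s : S.stagePresheaf.obj (op e)),
        cmp (c.π.app (op e.l)) (φ e.l) e.V s = (unitStageMap c S.stageSheaf).map e s := by
  have H (l : L) : ∃ φ : (pullback (c.π.app (op l))).obj (S.obj l) ⟶ limitModule S hc,
      ∀ V s, cmp (c.π.app (op l)) φ V s = (unitStageMap c S.stageSheaf).map ⟨l, V⟩ s := by
    refine exists_cmp_eq (c.π.app (op l)) (G := S.obj l) (F := limitModule S hc)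
      (fun V => (unitStageMap c S.stageSheaf).map ⟨l, V⟩) ?_ ?_
    · intro V W h s
      have h₁ := (unitStageMap c S.stageSheaf).map_sres
        (e := ⟨l, V⟩) (e' := ⟨l, W⟩) (Stage.mk_le_mk h) s
      have h₂ := congrArg ((unitStageMap c S.stageSheaf).map ⟨l, V⟩)
        (S.stagePresheaf_sres_incl h s)
      exact h₂.symm.trans h₁
    · intro V r s
      exact osmul_unitStageMap S hc ⟨l, V⟩ r s
  choose φ hφ using H
  refine ⟨φ, fun l m h => ?_, fun e s => hφ e.l e.V s⟩
  refine hom_ext_cmp _ _ _ fun V s => ?_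
  have h₁ := cmp_comp (c.π.app (op m)) (transition X h) (c.π.app (op l))
    (proj_transition c h) (S.map h) (φ m) V s
  have h₂ : S.pulledBackMap c (l := l) (m := m) h ≫ φ m = (pullbackComp (c.π.app (op m)) (transition X h)
    (c.π.app (op l)) (proj_transition c h)).hom.app (S.obj l) ≫
      (pullback (c.π.app (op m))).map (S.map h) ≫ φ m := Category.assoc _ _ _
  rw [h₂]
  refine h₁.trans ?_
  have h₃ := (unitStageMap c S.stageSheaf).map_sres
      (e := ⟨m, (transOpens X h).obj V⟩) (e' := ⟨l, V⟩) ⟨h, le_rfl⟩ s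
  have h₄ := hφ m ((transOpens X h).obj V) (cmp (transition X h) (S.map h) V s)
  have h₅ : sres S.stagePresheaf (e := ⟨m, (transOpens X h).obj V⟩) (e' := ⟨l, V⟩) ⟨h, le_rfl⟩ s =
    cmp (transition X h) (S.map h) V s :=
    res_refl (ab (S.obj m)) le_rfl (cmp (transition X h) (S.map h) V s)
  have h₆ := h₄.trans ((congrArg ((unitStageMap c S.stageSheaf).map _) h₅.symm).trans h₃)
  have h₇ := congrArg (res (ab (limitModule S hc)) (map_obj_comp _ _ _ (proj_transition c h) V).le)
    h₆
  refine h₇.trans (Eq.trans ?_ (hφ l V s).symm)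
  refine (res_res _ _ _ _).trans ?_
  exact res_refl _ _ _

lemma lanModuleDesc_lanSmul (t : Cocone (S.pulledBack c)) {W : Opens c.pt.carrier}
    (r : (ringLan c).obj (op W)) (m : (modLan c S).obj (op W)) :
    secMap (lanModuleDesc S t) W (lanSmul c S r m) =
      osmul t.pt (((ringLanDesc c).app (op W)).hom r) (secMap (lanModuleDesc S t) W m) := by
  obtain ⟨e, h, a, s, rfl, rfl⟩ := exists_rep c S r m
  rw [lanSmul_rep, lanModuleDesc_modRep, lanModuleDesc_modRep, ringLanDesc_ringRep]
  refine Eq.trans ?_ (res_osmul t.pt h _ _)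
  exact congrArg (res (ab t.pt) h)
    (cmp_osmul (c.π.app (op e.l)) (t.ι.app e.l) (V := e.V) a s)

/-- A cocone gives a linear map out of the presheaf colimit, which extends to `limitModule` by the
universal property of sheafification of modules. -/
lemma exists_limitModule_desc (hc : IsLimit c) (t : Cocone (S.pulledBack c)) :
    ∃ k : limitModule S hc ⟶ t.pt, ∀ (e : Stage X) (s : S.stagePresheaf.obj (op e)),
      secMap ((toAb c.pt).map k).hom _ ((unitStageMap c S.stageSheaf).map e s) =
        cmp (c.π.app (op e.l)) (t.ι.app e.l) e.V s := by
  have := isLocallyInjective_ringLanToStructureSheaf hc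
  have := isLocallySurjective_ringLanToStructureSheaf hc
  let f₀ : lanModule c S ⟶ (PresheafOfModules.restrictScalars (ringLanToStructureSheaf c)).obj
      ((SheafOfModules.forget _).obj t.pt) :=
    PresheafOfModules.homMk (lanModuleDesc S t) fun W r m =>
      lanModuleDesc_lanSmul S t (W := W.unop) r m
  obtain ⟨k, hk⟩ := (PresheafOfModules.sheafifyHomEquiv (ringLanToStructureSheaf c)
    (lanModuleToSheaf S c)).surjective f₀
  refine ⟨k, fun e s => ?_⟩
  have h₁ : secMap ((PresheafOfModules.toPresheaf _).map (PresheafOfModules.sheafifyHomEquiv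
      (ringLanToStructureSheaf c) (lanModuleToSheaf S c) k)) ((stagePreimage c).obj e)
        (modRep c S le_rfl s) = secMap (lanModuleDesc S t) _ (modRep c S le_rfl s) :=
    congrArg (fun a : modLan c S ⟶ ab t.pt => secMap a ((stagePreimage c).obj e)
      (modRep c S le_rfl s)) (congrArg (PresheafOfModules.toPresheaf _).map hk)
  have h₂ := congrArg (secMap ((toAb c.pt).map k).hom ((stagePreimage c).obj e))
    (unitStageMap_map (c := c) S e s)
  refine h₂.trans (Eq.trans h₁ ?_)
  exact (lanModuleDesc_modRep S t le_rfl s).trans (res_refl _ _ _)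

lemma stagePullback_hom_ext {F : StageSheaf X} {N : TopCat.Sheaf AddCommGrpCat.{u} c.pt.carrier}
    (a b : (stagePullback c).obj F ⟶ N)
    (h : ∀ (e : Stage X) (s : F.obj.obj (op e)), secMap a.hom _ ((unitStageMap c F).map e s) =
      secMap b.hom _ ((unitStageMap c F).map e s)) : a = b := by
  apply ((stageAdj c).homEquiv F N).injective
  rw [Adjunction.homEquiv_unit, Adjunction.homEquiv_unit]
  apply Sheaf.hom_ext
  apply NatTrans.ext
  funext e
  apply AddCommGrpCat.hom_ext
  exact AddMonoidHom.ext (h e.unop)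

/-- The colimit of the inverse images of a system of modules on the limit is the inverse image of
the sheaf on the site of stages. -/
theorem exists_stagePullback_iso (hc : IsLimit c) {t : Cocone (S.pulledBack c)}
    (ht : IsColimit t) :
    ∃ θ : (stagePullback c).obj S.stageSheaf ≅ (toAb c.pt).obj t.pt,
      ∀ (e : Stage X) (s : S.stagePresheaf.obj (op e)),
        secMap θ.hom.hom _ ((unitStageMap c S.stageSheaf).map e s) =
          cmp (c.π.app (op e.l)) (t.ι.app e.l) e.V s := by
  obtain ⟨φ, hφ, hφ'⟩ := exists_cocone_limitModule S hc
  obtain ⟨k, hk⟩ := exists_limitModule_desc S hc t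
  let t' : Cocone (S.pulledBack c) :=
    ⟨limitModule S hc, ⟨φ, fun l m f => (hφ l m (leOfHom f)).trans (Category.comp_id _).symm⟩⟩
  let d : t.pt ⟶ limitModule S hc := ht.desc t'
  have hd (l : L) : t.ι.app l ≫ d = φ l := ht.fac t' l
  -- Uniqueness for the colimit `t` reduces this to sections at the stages; the other composite is
  -- treated below as a map of abelian sheaves, where `stagePullback_hom_ext` gives the same
  -- reduction.
  have h₁ : d ≫ k = 𝟙 t.pt := by
    refine ht.hom_ext fun l => ?_
    refine hom_ext_cmp _ _ _ fun V s => ?_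
    have e₁ : t.ι.app l ≫ d ≫ k = φ l ≫ k :=
      (Category.assoc _ _ _).symm.trans (congrArg (· ≫ k) (hd l))
    have h := congrArg (secMap ((toAb c.pt).map k).hom _) (hφ' ⟨l, V⟩ s)
    refine (congrArg (fun ψ => cmp (c.π.app (op l)) ψ V s) e₁).trans ?_
    refine (cmp_comp_right (c.π.app (op l)) (φ l) k V s).trans (h.trans ((hk ⟨l, V⟩ s).trans ?_))
    exact congrArg (fun ψ => cmp (c.π.app (op l)) ψ V s) (Category.comp_id (t.ι.app l)).symm
  have h₂ : (toAb c.pt).map k ≫ (toAb c.pt).map d = 𝟙 _ := by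
    refine stagePullback_hom_ext (F := S.stageSheaf) _ _ fun e s => ?_
    have h := congrArg (secMap ((toAb c.pt).map d).hom _) (hk e s)
    refine Eq.trans h ?_
    refine (cmp_comp_right (c.π.app (op e.l)) (t.ι.app e.l) d e.V s).symm.trans ?_
    exact (congrArg (fun ψ => cmp (c.π.app (op e.l)) ψ e.V s) (hd e.l)).trans (hφ' e s)
  have h₃ : (toAb c.pt).map d ≫ (toAb c.pt).map k = 𝟙 _ :=
    ((toAb c.pt).map_comp d k).symm.trans
      ((congrArg (toAb c.pt).map h₁).trans ((toAb c.pt).map_id _))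
  exact ⟨⟨(toAb c.pt).map k, (toAb c.pt).map d, h₂, h₃⟩, hk⟩

end ColimitModuleIso

/-! ### Linearity of the pullback maps -/

section Linearity

section Naturality

variable {X Y : TopCat.{u}} (f : X ⟶ Y)
  {G : TopCat.Sheaf AddCommGrpCat.{u} Y}
  {K : CochainComplex (TopCat.Sheaf AddCommGrpCat.{u} Y) ℕ} {ε : G ⟶ K.X 0}
  {M : CochainComplex (TopCat.Sheaf AddCommGrpCat.{u} X) ℕ}

/-- The comparison `Γ_Z(Y, f_* M) ⟶ Γ_{f⁻¹ Z}(X, M)` on complexes. -/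
def sectionsComparisonComplex (P : SupportPair Y) (Q : SupportPair X) (h : Q = P.comap f)
    (M : CochainComplex (TopCat.Sheaf AddCommGrpCat.{u} X) ℕ) :
    ((sectionsWithSupport P).mapHomologicalComplex (ComplexShape.up ℕ)).obj
      (((TopCat.Sheaf.pushforward AddCommGrpCat.{u} f).mapHomologicalComplex
        (ComplexShape.up ℕ)).obj M) ⟶
      ((sectionsWithSupport Q).mapHomologicalComplex (ComplexShape.up ℕ)).obj M :=
  (NatTrans.mapHomologicalComplex (sectionsComparison f P Q h).hom (ComplexShape.up ℕ)).app M

lemma sectionsMap_eq (s : K ⟶ ((TopCat.Sheaf.pushforward AddCommGrpCat.{u} f).mapHomologicalComplex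
        (ComplexShape.up ℕ)).obj M) (P : SupportPair Y) (Q : SupportPair X) (h : Q = P.comap f) :
    sectionsMap f P Q h s =
      ((sectionsWithSupport P).mapHomologicalComplex (ComplexShape.up ℕ)).map s ≫
        sectionsComparisonComplex f P Q h M :=
  rfl

lemma homologyMap_sectionsMap_eq (hK : IsResolution K ε) (hM : ∀ n, Injective (M.X n))
    (s s' : K ⟶ ((TopCat.Sheaf.pushforward AddCommGrpCat.{u} f).mapHomologicalComplex
        (ComplexShape.up ℕ)).obj M) (hs : ε ≫ s.f 0 = ε ≫ s'.f 0)
    (P : SupportPair Y) (Q : SupportPair X) (h : Q = P.comap f) (i : ℕ) :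
    HomologicalComplex.homologyMap (sectionsMap f P Q h s) i =
      HomologicalComplex.homologyMap (sectionsMap f P Q h s') i := by
  have H : Homotopy s s' := hK.homotopy (fun n => injective_pushforward f (M.X n)) s s' hs
  rw [sectionsMap_eq, sectionsMap_eq, HomologicalComplex.homologyMap_comp,
    HomologicalComplex.homologyMap_comp, ((sectionsWithSupport P).mapHomotopy H).homologyMap_eq i]

lemma comp_iso_conj {C : Type*} [Category* C] {D D' D'' D₁ I I' I'' I₁ : C} {e : D ≅ I}
    {e' : D' ≅ I'} {e'' : D'' ≅ I''} {e₁ : D₁ ≅ I₁} {p : I ⟶ I'} {q : I' ⟶ I''}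
    {p' : I ⟶ I₁} {q' : I₁ ⟶ I''} (w : p ≫ q = p' ≫ q') :
    (e.hom ≫ p ≫ e'.inv) ≫ e'.hom ≫ q ≫ e''.inv =
      (e.hom ≫ p' ≫ e₁.inv) ≫ e₁.hom ≫ q' ≫ e''.inv := by
  simp [reassoc_of% w]

/-- The map on local cohomology is natural. -/
lemma rightDerived_map_localCohomologyMap {G G' : TopCat.Sheaf AddCommGrpCat.{u} Y}
    {F F' : TopCat.Sheaf AddCommGrpCat.{u} X}
    (a : G ⟶ (TopCat.Sheaf.pushforward AddCommGrpCat.{u} f).obj F)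
    (a' : G' ⟶ (TopCat.Sheaf.pushforward AddCommGrpCat.{u} f).obj F') (g : G ⟶ G') (b : F ⟶ F')
    (w : g ≫ a' = a ≫ (TopCat.Sheaf.pushforward AddCommGrpCat.{u} f).map b)
    (P : SupportPair Y) (Q : SupportPair X) (h : Q = P.comap f) (i : ℕ) :
    ((sectionsWithSupport P).rightDerived i).map g ≫ localCohomologyMap f a' P Q h i =
      localCohomologyMap f a P Q h i ≫ ((sectionsWithSupport Q).rightDerived i).map b := by
  let Φ := TopCat.Sheaf.pushforward AddCommGrpCat.{u} f
  let fK := Φ.mapHomologicalComplex (ComplexShape.up ℕ)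
  let ΓP := (sectionsWithSupport P).mapHomologicalComplex (ComplexShape.up ℕ)
  let ΓQ := (sectionsWithSupport Q).mapHomologicalComplex (ComplexShape.up ℕ)
  let u := resolutionLift f a (injectiveResolution G) (injectiveResolution F)
  let u' := resolutionLift f a' (injectiveResolution G') (injectiveResolution F')
  obtain ⟨γ, hγ⟩ := (isResolution_injectiveResolution (injectiveResolution G)).exists_lift
    (injectiveResolution G').cocomplex (injectiveResolution G').injective
    (g ≫ (injectiveResolution G').ι.f 0) ((Category.assoc _ _ _).trans
      ((congrArg (g ≫ ·) (injectiveResolution G').ι_f_zero_comp_complex_d).trans comp_zero))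
  obtain ⟨β, hβ⟩ := (isResolution_injectiveResolution (injectiveResolution F)).exists_lift
    (injectiveResolution F').cocomplex (injectiveResolution F').injective
    (b ≫ (injectiveResolution F').ι.f 0) ((Category.assoc _ _ _).trans
      ((congrArg (b ≫ ·) (injectiveResolution F').ι_f_zero_comp_complex_d).trans comp_zero))
  have hu : (injectiveResolution G).ι.f 0 ≫ u.f 0 =
    a ≫ Φ.map ((injectiveResolution F).ι.f 0) := resolutionLift_spec f a _ _
  have hu' : (injectiveResolution G').ι.f 0 ≫ u'.f 0 =
    a' ≫ Φ.map ((injectiveResolution F').ι.f 0) := resolutionLift_spec f a' _ _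
  -- By `w`, both maps extend the same morphism from `G` into a complex of injectives.
  have key : HomologicalComplex.homologyMap (sectionsMap f P Q h (γ ≫ u')) i =
      HomologicalComplex.homologyMap (sectionsMap f P Q h (u ≫ fK.map β)) i := by
    refine homologyMap_sectionsMap_eq f
      (isResolution_injectiveResolution (injectiveResolution G))
      (injectiveResolution F').injective _ _ ?_ P Q h i
    have e₁ : (injectiveResolution G).ι.f 0 ≫ γ.f 0 ≫ u'.f 0 =
        g ≫ a' ≫ Φ.map ((injectiveResolution F').ι.f 0) :=
      ((Category.assoc _ _ _).symm.trans (congrArg (· ≫ u'.f 0) hγ)).trans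
        ((Category.assoc _ _ _).trans (congrArg (g ≫ ·) hu'))
    have e₂ : (injectiveResolution G).ι.f 0 ≫ u.f 0 ≫ Φ.map (β.f 0) =
        a ≫ Φ.map b ≫ Φ.map ((injectiveResolution F').ι.f 0) := by
      refine ((Category.assoc _ _ _).symm.trans (congrArg (· ≫ Φ.map (β.f 0)) hu)).trans ?_
      refine (Category.assoc _ _ _).trans (congrArg (a ≫ ·) ?_)
      exact (Φ.map_comp _ _).symm.trans ((congrArg Φ.map hβ).trans (Φ.map_comp _ _))
    refine e₁.trans (Eq.trans ?_ e₂.symm)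
    exact (Category.assoc _ _ _).symm.trans
      ((congrArg (· ≫ Φ.map ((injectiveResolution F').ι.f 0)) w).trans (Category.assoc _ _ _))
  have nat : ΓP.map (fK.map β) ≫ sectionsComparisonComplex f P Q h _ =
      sectionsComparisonComplex f P Q h _ ≫ ΓQ.map β :=
    (NatTrans.mapHomologicalComplex (sectionsComparison f P Q h).hom
      (ComplexShape.up ℕ)).naturality β
  have final : HomologicalComplex.homologyMap (ΓP.map γ) i ≫
      HomologicalComplex.homologyMap (sectionsMap f P Q h u') i =
      HomologicalComplex.homologyMap (sectionsMap f P Q h u) i ≫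
      HomologicalComplex.homologyMap (ΓQ.map β) i := by
    rw [← HomologicalComplex.homologyMap_comp, ← HomologicalComplex.homologyMap_comp]
    have e₁ : ΓP.map γ ≫ sectionsMap f P Q h u' = sectionsMap f P Q h (γ ≫ u') := by
      rw [sectionsMap_eq, sectionsMap_eq, Functor.map_comp, Category.assoc]
    have e₂ : sectionsMap f P Q h u ≫ ΓQ.map β = sectionsMap f P Q h (u ≫ fK.map β) := by
      rw [sectionsMap_eq, sectionsMap_eq, Functor.map_comp, Category.assoc, Category.assoc, nat]
    rw [e₁, e₂, key]
  have hg := (sectionsWithSupport P).rightDerived_map_eq i g γ (by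
    apply HomologicalComplex.from_single_hom_ext
    simpa using hγ)
  have hb := (sectionsWithSupport Q).rightDerived_map_eq i b β (by
    apply HomologicalComplex.from_single_hom_ext
    simpa using hβ)
  rw [hg, hb]
  exact comp_iso_conj final

end Naturality

variable {X Y : RingedSpace.{u, u}}

/-- Pullback of sections is semilinear along pullback of functions. This square is what naturality
of local cohomology turns into linearity. -/
lemma scalar_moduleComparison (f : X ⟶ Y) {G : Modules Y} {F : Modules X}
    (φ : (pullback f).obj G ⟶ F) (r : globalSections Y) :
    scalar G r ≫ moduleComparison f φ = moduleComparison f φ ≫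
      (TopCat.Sheaf.pushforward AddCommGrpCat.{u} f.hom.base).map
        (scalar F (globalSectionsMap f r)) := by
  apply Sheaf.hom_ext
  apply NatTrans.ext
  funext V
  apply AddCommGrpCat.hom_ext
  refine AddMonoidHom.ext fun (s : (ab G).obj (op V.unop)) => ?_
  have h₁ := cmp_osmul f φ (ores Y (le_top : V.unop ≤ ⊤) r) s
  have h₂ := ocmp_ores f (le_top : V.unop ≤ ⊤) r
  exact h₁.trans (congrArg (fun x => osmul F x (cmp f φ V.unop s)) h₂)

/-- The pullback maps on local cohomology are linear. -/
lemma pullbackMap_smul {A : Type*} [Ring A] (f : X ⟶ Y) {ρ' : A →+* globalSections Y}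
    {ρ : A →+* globalSections X} (hρ : (globalSectionsMap f).comp ρ' = ρ)
    {P : SupportPair Y.carrier} {Q : SupportPair X.carrier} (h : Q = P.comap f.hom.base)
    {G : Modules Y} {F : Modules X} (φ : (pullback f).obj G ⟶ F) (i : ℕ) (a : A)
    (x : LocalCohomology ρ' P G i) :
    LocalCohomology.pullbackMap (ρ' := ρ') (ρ := ρ) f h φ i (a • x) =
      a • LocalCohomology.pullbackMap (ρ' := ρ') (ρ := ρ) f h φ i x := by
  subst hρ
  have H := rightDerived_map_localCohomologyMap f.hom.base (moduleComparison f φ)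
    (moduleComparison f φ) _ _ (scalar_moduleComparison f φ (ρ' a)) P Q h i
  exact ConcreteCategory.congr_hom H x

lemma globalSectionsMap_comp {Z : RingedSpace.{u, u}} (f : X ⟶ Y) (g : Y ⟶ Z) (h : X ⟶ Z)
    (e : f ≫ g = h) :
    (globalSectionsMap f).comp (globalSectionsMap g) = globalSectionsMap h := by
  subst e
  rfl

end Linearity

/-! ### Homology of directed colimits of complexes -/

section DirectedHomology

variable {J : Type*} [Preorder J] {ι : Type*} {sh : ComplexShape ι}
  {K : J → HomologicalComplex AddCommGrpCat.{u} sh} {M : HomologicalComplex AddCommGrpCat.{u} sh}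
  {σ : ∀ ⦃l m : J⦄, l ≤ m → (K l ⟶ K m)} {τ : ∀ l, K l ⟶ M}

lemma hom_comm_apply {K M : HomologicalComplex AddCommGrpCat.{u} sh} (φ : K ⟶ M) (i j : ι)
    (x : K.X i) : (M.d i j).hom ((φ.f i).hom x) = (φ.f j).hom ((K.d i j).hom x) :=
  ConcreteCategory.congr_hom (φ.comm i j) x

/-- Exactness of directed colimits in elements: a bounding chain in `M` comes from a stage, and the
relation it satisfies holds at a later one. -/
lemma exists_homologyMap_eq_zero [IsDirectedOrder J]
    (hσ : ∀ ⦃l m n : J⦄ (h : l ≤ m) (h' : m ≤ n) i (x : (K l).X i),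
      ((σ h').f i).hom (((σ h).f i).hom x) = ((σ (h.trans h')).f i).hom x)
    (hτ : ∀ ⦃l m : J⦄ (h : l ≤ m) i (x : (K l).X i),
      ((τ m).f i).hom (((σ h).f i).hom x) = ((τ l).f i).hom x)
    (hinj : ∀ (l : J) i (x : (K l).X i), ((τ l).f i).hom x = 0 →
      ∃ (m : J) (h : l ≤ m), ((σ h).f i).hom x = 0)
    (hsurj : ∀ i (y : M.X i), ∃ (l : J) (x : (K l).X i), ((τ l).f i).hom x = y)
    (i : ι) (l : J) (z : (K l).homology i)
    (hz : (HomologicalComplex.homologyMap (τ l) i).hom z = 0) :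
    ∃ (m : J) (h : l ≤ m), (HomologicalComplex.homologyMap (σ h) i).hom z = 0 := by
  obtain ⟨w, rfl⟩ := exists_cycle (K l) i z
  rw [homologyMap_homologyπ_apply, homologyπ_eq_zero_iff] at hz
  obtain ⟨y, hy⟩ := hz
  rw [iCycles_cyclesMap_apply] at hy
  obtain ⟨k, y', rfl⟩ := hsurj _ y
  obtain ⟨m, hm, hm'⟩ := exists_ge_ge l k
  have h₀ : ((τ m).f i).hom (((K m).d (sh.prev i) i).hom (((σ hm').f (sh.prev i)).hom y') -
      ((σ hm).f i).hom (((K l).iCycles i).hom w)) = 0 := by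
    rw [map_sub, ← hom_comm_apply, hτ, hτ, hy, sub_self]
  obtain ⟨n, hn, h₁⟩ := hinj m i _ h₀
  refine ⟨n, hm.trans hn, ?_⟩
  rw [homologyMap_homologyπ_apply, homologyπ_eq_zero_iff]
  refine ⟨((σ (hm'.trans hn)).f (sh.prev i)).hom y', ?_⟩
  rw [map_sub, sub_eq_zero, ← hom_comm_apply, hσ, hσ] at h₁
  rw [h₁, iCycles_cyclesMap_apply]

/-- A representative cocycle of `M` lifts to a chain at some stage, whose differential dies in `M`
and hence at a later stage. -/
lemma exists_homologyMap_eq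
    (hτ : ∀ ⦃l m : J⦄ (h : l ≤ m) i (x : (K l).X i),
      ((τ m).f i).hom (((σ h).f i).hom x) = ((τ l).f i).hom x)
    (hinj : ∀ (l : J) i (x : (K l).X i), ((τ l).f i).hom x = 0 →
      ∃ (m : J) (h : l ≤ m), ((σ h).f i).hom x = 0)
    (hsurj : ∀ i (y : M.X i), ∃ (l : J) (x : (K l).X i), ((τ l).f i).hom x = y)
    (i : ι) (b : M.homology i) :
    ∃ (l : J) (z : (K l).homology i), (HomologicalComplex.homologyMap (τ l) i).hom z = b := by
  obtain ⟨w, rfl⟩ := exists_cycle M i b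
  obtain ⟨l, x, hx⟩ := hsurj i ((M.iCycles i).hom w)
  obtain ⟨m, hm, h₀⟩ := hinj l (sh.next i) (((K l).d i (sh.next i)).hom x) (by
    rw [← hom_comm_apply, hx, d_iCycles_apply])
  obtain ⟨z, hz⟩ := exists_cycle_of_d_eq_zero (((σ hm).f i).hom x) (by rw [hom_comm_apply, h₀])
  refine ⟨m, ((K m).homologyπ i).hom z, ?_⟩
  rw [homologyMap_homologyπ_apply]
  congr 1
  apply iCycles_injective
  rw [iCycles_cyclesMap_apply, hz, hτ, hx]

end DirectedHomology

/-! ### Sections with support at the stages and in the limit -/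

section SupportSections

variable {T : TopCat.{u}}

/-- A section with support, as a section. -/
def supp (P : SupportPair T) (F : TopCat.Sheaf AddCommGrpCat.{u} T) :
    (sectionsWithSupport P).obj F →+ F.obj.obj (op P.U) :=
  AddSubgroup.subtype _

lemma supp_injective (P : SupportPair T) (F : TopCat.Sheaf AddCommGrpCat.{u} T) :
    Function.Injective (supp P F) :=
  Subtype.val_injective

lemma res_supp (P : SupportPair T) (F : TopCat.Sheaf AddCommGrpCat.{u} T)
    (x : (sectionsWithSupport P).obj F) : res F.obj P.compl_le (supp P F x) = 0 :=
  x.2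

lemma exists_supp_eq (P : SupportPair T) (F : TopCat.Sheaf AddCommGrpCat.{u} T)
    (s : F.obj.obj (op P.U)) (hs : res F.obj P.compl_le s = 0) : ∃ x, supp P F x = s :=
  ⟨⟨s, hs⟩, rfl⟩

variable {T' : TopCat.{u}} (f : T' ⟶ T)

lemma supp_sectionsComparison (P : SupportPair T) (Q : SupportPair T') (h : Q = P.comap f)
    (F : TopCat.Sheaf AddCommGrpCat.{u} T')
    (x : (sectionsWithSupport P).obj ((TopCat.Sheaf.pushforward AddCommGrpCat.{u} f).obj F)) :
    supp Q F (((sectionsComparison f P Q h).hom.app F).hom x) =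
      res F.obj (congrArg SupportPair.U h).le (supp P _ x) := by
  subst h
  exact (res_refl F.obj _ _).symm

lemma supp_sectionsMap {K : CochainComplex (TopCat.Sheaf AddCommGrpCat.{u} T) ℕ}
    {M : CochainComplex (TopCat.Sheaf AddCommGrpCat.{u} T') ℕ}
    (s : K ⟶ ((TopCat.Sheaf.pushforward AddCommGrpCat.{u} f).mapHomologicalComplex
        (ComplexShape.up ℕ)).obj M)
    (P : SupportPair T) (Q : SupportPair T') (h : Q = P.comap f) (n : ℕ)
    (x : (sectionsWithSupport P).obj (K.X n)) :
    supp Q (M.X n) (((sectionsMap f P Q h s).f n).hom x) =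
      res (M.X n).obj (congrArg SupportPair.U h).le
        (secMap (s.f n).hom P.U (supp P (K.X n) x)) :=
  supp_sectionsComparison f P Q h (M.X n) (((sectionsWithSupport P).map (s.f n)).hom x)

end SupportSections

/-! ### Restriction and projection as natural transformations -/

section StageTransformations

variable {L : Type u} [Preorder L] {X : Lᵒᵖ ⥤ RingedSpace.{u, u}}

/-- The restriction maps of sheaves on the site of stages, from one space to another. -/
def stageTrans {l m : L} (h : l ≤ m) : restrictStage X l ⟶ restrictStage X m ⋙
    TopCat.Sheaf.pushforward AddCommGrpCat.{u} (transition X h).hom.base where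
  app F := ⟨{
    app := fun V => AddCommGrpCat.ofHom (sres F.obj (Stage.trans_le h V.unop))
    naturality := fun V W i => by
      ext s
      have h₁ := sres_sres F.obj (Stage.trans_le h W.unop) (Stage.mk_le_mk (leOfHom i.unop)) s
      have h₂ := sres_sres F.obj (Stage.mk_le_mk
        (leOfHom ((transOpens X h).map i.unop))) (Stage.trans_le h V.unop) s
      exact h₁.trans h₂.symm }⟩
  naturality F G a := by
    apply Sheaf.hom_ext
    apply NatTrans.ext
    funext V
    apply AddCommGrpCat.hom_ext
    ext s
    exact (ConcreteCategory.congr_hom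
      (a.hom.naturality (homOfLE (Stage.trans_le h V.unop)).op) s).symm

variable [IsDirectedOrder L] [Nonempty L] (c : Cone X)

/-- The maps from sections at the stages to sections on the limit. -/
def stageProj (l : L) : restrictStage X l ⟶ stagePullback c ⋙
    TopCat.Sheaf.pushforward AddCommGrpCat.{u} (c.π.app (op l)).hom.base where
  app F := ⟨{
    app := fun V => AddCommGrpCat.ofHom ((unitStageMap c F).map ⟨l, V.unop⟩)
    naturality := fun V W i => by
      ext s
      exact (unitStageMap c F).map_sres (Stage.mk_le_mk (leOfHom i.unop)) s }⟩
  naturality F G a := by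
    apply Sheaf.hom_ext
    apply NatTrans.ext
    funext V
    apply AddCommGrpCat.hom_ext
    ext s
    exact congrArg (fun b : F ⟶ (stagePushforward c).obj ((stagePullback c).obj G) =>
      (b.hom.app (op ⟨l, V.unop⟩)).hom s) ((stageAdj c).unit.naturality a)

lemma secMap_stagePullback_map {F G : StageSheaf X} (a : F ⟶ G) (e : Stage X)
    (s : F.obj.obj (op e)) :
    secMap ((stagePullback c).map a).hom _ ((unitStageMap c F).map e s) =
      (unitStageMap c G).map e ((a.hom.app (op e)).hom s) :=
  (congrArg (fun b : F ⟶ (stagePushforward c).obj ((stagePullback c).obj G) =>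
      (b.hom.app (op e)).hom s) ((stageAdj c).unit.naturality a)).symm

end StageTransformations

/-! ### Resolutions at the stages and on the limit -/

section StageResolutions

variable {L : Type u} [Preorder L] {X : Lᵒᵖ ⥤ RingedSpace.{u, u}} {c : Cone X}

lemma hasCompactBasis_of_spectralSpace {T : TopCat.{u}} (hT : SpectralSpace T) :
    HasCompactBasis T where
  exists_le W x hx := by
    obtain ⟨V, hV, hxV, hVW⟩ :=
      hT.isTopologicalBasis.exists_subset_of_mem_open hx W.isOpen
    exact ⟨⟨V, hV.1⟩, hV.2, hxV, hVW⟩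
  inter V W hV hW := QuasiSeparatedSpace.inter_isCompact _ _ V.isOpen hV W.isOpen hW

/-- Every arrow of a preorder is a monomorphism, so injectivity on the site of stages gives
surjectivity of all restriction maps. -/
lemma isQuasiFlasque_restrictStage (I : StageSheaf X) (hI : Injective I) (l : L) :
    IsQuasiFlasque ((restrictStage X l).obj I) := fun _ _ h _ _ =>
  @map_surjective_of_injective _ _ (stageTopology X) I hI _ _
    (homOfLE (Stage.mk_le_mk h)) ⟨fun _ _ _ => Subsingleton.elim _ _⟩

section Limit

variable [IsDirectedOrder L] [Nonempty L]

lemma hasStageBasis (hc : IsLimit c)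
    (hX : ∀ l : L, SpectralSpace (X.obj (op l)).carrier)
    (hv : ∀ (l m : L) (h : l ≤ m), IsSpectralMap (transition X h).hom.base) : HasStageBasis c := by
  intro W x hx
  obtain ⟨l, V, -, hxV, hVW⟩ := exists_stage_le hc hX hv W x hx
  exact ⟨⟨l, V⟩, hxV, hVW⟩

lemma hasCompactBasis_limit (hc : IsLimit c)
    (hX : ∀ l : L, SpectralSpace (X.obj (op l)).carrier)
    (hv : ∀ (l m : L) (h : l ≤ m), IsSpectralMap (transition X h).hom.base) : HasCompactBasis c.pt.carrier where
  exists_le W x hx := by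
    obtain ⟨l, V, hV, hxV, hVW⟩ := exists_stage_le hc hX hv W x hx
    exact ⟨_, isCompact_projOpens hc hX hv hV, hxV, hVW⟩
  inter V W hV hW := isCompact_inter_of_limit hc hX hv V W hV hW

/-- The section and the inclusion `V ≤ W` both descend to a stage; there injectivity of `I` extends
the section, and the extension is projected back to the limit. -/
lemma isQuasiFlasque_stagePullback (hc : IsLimit c)
    (hX : ∀ l : L, SpectralSpace (X.obj (op l)).carrier)
    (hv : ∀ (l m : L) (h : l ≤ m), IsSpectralMap (transition X h).hom.base)
    (I : StageSheaf X) (hI : Injective I) :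
    IsQuasiFlasque ((stagePullback c).obj I) := by
  intro V W h hV hW y
  have hη := isPresentation_unitStageMap c (hasStageBasis hc hX hv) I
  obtain ⟨l, V₀, hV₀, rfl⟩ := exists_projOpens_eq hc hX hv V hV
  obtain ⟨k, W₀, hW₀, rfl⟩ := exists_projOpens_eq hc hX hv W hW
  obtain ⟨m, hm, s, hs⟩ := hη.exists_section_over hc hX hv hV₀ y
  obtain ⟨n, hn, hn'⟩ := exists_ge_ge m k
  -- The inclusion `V ≤ W` is known only in the limit, and is needed at a stage before injectivity
  -- can be applied.
  obtain ⟨p, hp, hle⟩ := exists_transOpens_le hc hX hv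
    (isCompact_transOpens hv (hm.trans hn) hV₀) (W := (transOpens X hn').obj W₀) (by
      rw [projOpens_transOpens, projOpens_transOpens]
      exact h)
  let eV : Stage X := ⟨p, (transOpens X (hm.trans (hn.trans hp))).obj V₀⟩
  let eW : Stage X := ⟨p, (transOpens X (hn'.trans hp)).obj W₀⟩
  have k₁ : eV ≤ ⟨m, (transOpens X hm).obj V₀⟩ :=
    ⟨hn.trans hp, (transOpens_transOpens X hm (hn.trans hp) V₀).ge⟩
  have k₂ : eV ≤ eW := Stage.mk_le_mk (by
    rw [← transOpens_transOpens X (hm.trans hn) hp, ← transOpens_transOpens X hn' hp]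
    exact hle)
  obtain ⟨r, hr⟩ := @map_surjective_of_injective _ _ (stageTopology X) I hI _ _
    (homOfLE k₂) ⟨fun _ _ _ => Subsingleton.elim _ _⟩ (sres I.obj k₁ s)
  have hr' : sres I.obj k₂ r = sres I.obj k₁ s := hr
  have eqV : (stagePreimage c).obj eV = (projOpens c l).obj V₀ := projOpens_transOpens c _ V₀
  have eqW : (stagePreimage c).obj eW = (projOpens c k).obj W₀ := projOpens_transOpens c _ W₀
  refine ⟨res _ eqW.ge ((unitStageMap c I).map eW r), ?_⟩
  have h₁ := congrArg (res ((stagePullback c).obj I).obj eqV.ge)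
    (congrArg ((unitStageMap c I).map eV) hr')
  rw [(unitStageMap c I).map_sres, (unitStageMap c I).map_sres, hs] at h₁
  rw [res_res] at h₁ ⊢
  refine h₁.trans ?_
  rw [res_res]
  exact (res_res _ _ _ y).trans (res_refl _ _ y)

end Limit

section Complexes

variable (S : ModuleSystem X)

/-- The chosen injective resolution on the site of stages. -/
abbrev stageResolution : InjectiveResolution S.stageSheaf := injectiveResolution S.stageSheaf

/-- The restriction to one of the spaces of the resolution on the site of stages. -/
abbrev resolutionAt (l : L) :
    CochainComplex (TopCat.Sheaf AddCommGrpCat.{u} (X.obj (op l)).carrier) ℕ :=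
  ((restrictStage X l).mapHomologicalComplex (ComplexShape.up ℕ)).obj (stageResolution S).cocomplex

/-- The augmentation of the resolution on the site of stages. -/
def stageAugmentation : S.stageSheaf ⟶ (stageResolution S).cocomplex.X 0 :=
  (stageResolution S).ι.f 0

lemma isResolution_stageResolution :
    IsResolution (stageResolution S).cocomplex (stageAugmentation S) :=
  isResolution_injectiveResolution (stageResolution S)

/-- The augmentation of the resolution at one of the spaces. -/
def augmentationAt (l : L) : (toAb (X.obj (op l))).obj (S.obj l) ⟶ (resolutionAt S l).X 0 :=
  (S.restrictStageIso l).inv ≫ (restrictStage X l).map (stageAugmentation S)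

lemma isResolution_resolutionAt (l : L) : IsResolution (resolutionAt S l) (augmentationAt S l) :=
  ((isResolution_stageResolution S).map (restrictStage X l)).precomp_iso
    (S.restrictStageIso l).inv

/-- The restriction maps from one space to another, on the resolutions. -/
def resolutionTrans {l m : L} (h : l ≤ m) : resolutionAt S l ⟶
    ((TopCat.Sheaf.pushforward AddCommGrpCat.{u} (transition X h).hom.base).mapHomologicalComplex
      (ComplexShape.up ℕ)).obj (resolutionAt S m) :=
  (NatTrans.mapHomologicalComplex (stageTrans h) (ComplexShape.up ℕ)).app
    (stageResolution S).cocomplex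

/-- Shows that `resolutionTrans` extends the sheaf map given by `S.map h`, as
`toRightDerived_localCohomologyMap` requires. -/
lemma augmentationAt_resolutionTrans {l m : L} (h : l ≤ m) :
    augmentationAt S l ≫ (resolutionTrans S h).f 0 = moduleComparison (transition X h) (S.map h) ≫
      (TopCat.Sheaf.pushforward AddCommGrpCat.{u} (transition X h).hom.base).map
        (augmentationAt S m) := by
  apply Sheaf.hom_ext
  apply NatTrans.ext
  funext V
  apply AddCommGrpCat.hom_ext
  refine AddMonoidHom.ext fun (s : (ab (S.obj l)).obj (op V.unop)) => ?_
  have h₁ := ConcreteCategory.congr_hom ((stageAugmentation S).hom.naturality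
    (homOfLE (Stage.trans_le h V.unop)).op) s
  refine h₁.symm.trans ?_
  exact congrArg ((stageAugmentation S).hom.app (op ⟨m, (transOpens X h).obj V.unop⟩)).hom
    (res_refl (ab (S.obj m)) le_rfl (cmp (transition X h) (S.map h) V.unop s))

section Limit

variable [IsDirectedOrder L] [Nonempty L] (c)

/-- The inverse image on the limit of the resolution on the site of stages. -/
abbrev limitResolution : CochainComplex (TopCat.Sheaf AddCommGrpCat.{u} c.pt.carrier) ℕ :=
  ((stagePullback c).mapHomologicalComplex (ComplexShape.up ℕ)).obj (stageResolution S).cocomplex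

/-- The maps from sections at the stages to sections on the limit, on the resolutions. -/
def resolutionProj (l : L) : resolutionAt S l ⟶
    ((TopCat.Sheaf.pushforward AddCommGrpCat.{u} (c.π.app (op l)).hom.base).mapHomologicalComplex
      (ComplexShape.up ℕ)).obj (limitResolution c S) :=
  (NatTrans.mapHomologicalComplex (stageProj c l) (ComplexShape.up ℕ)).app
    (stageResolution S).cocomplex

variable {c} {t : Cocone (S.pulledBack c)}
  (θ : (stagePullback c).obj S.stageSheaf ≅ (toAb c.pt).obj t.pt)

/-- The augmentation of the resolution on the limit. -/
def limitAugmentation : (toAb c.pt).obj t.pt ⟶ (limitResolution c S).X 0 :=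
  θ.inv ≫ (stagePullback c).map (stageAugmentation S)

lemma isResolution_limitResolution :
    IsResolution (limitResolution c S) (limitAugmentation S θ) :=
  ((isResolution_stageResolution S).map (stagePullback c)).precomp_iso θ.inv

/-- The condition `hθ` says that `θ` respects the maps from the stages; this makes `resolutionProj`
an extension of the canonical map given by the colimit cocone. -/
lemma augmentationAt_resolutionProj
    (hθ : ∀ (e : Stage X) (s : S.stagePresheaf.obj (op e)),
        secMap θ.hom.hom _ ((unitStageMap c S.stageSheaf).map e s) =
          cmp (c.π.app (op e.l)) (t.ι.app e.l) e.V s) (l : L) :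
    augmentationAt S l ≫ (resolutionProj c S l).f 0 =
      moduleComparison (c.π.app (op l)) (t.ι.app l) ≫
      (TopCat.Sheaf.pushforward AddCommGrpCat.{u} (c.π.app (op l)).hom.base).map
        (limitAugmentation S θ) := by
  apply Sheaf.hom_ext
  apply NatTrans.ext
  funext V
  apply AddCommGrpCat.hom_ext
  refine AddMonoidHom.ext fun (s : (ab (S.obj l)).obj (op V.unop)) => ?_
  have h₁ := secMap_stagePullback_map c (stageAugmentation S) ⟨l, V.unop⟩ s
  refine h₁.symm.trans ?_
  have h₂ := congrArg (secMap θ.inv.hom _) (hθ ⟨l, V.unop⟩ s)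
  have h₃ : secMap θ.inv.hom _ (secMap θ.hom.hom _
      ((unitStageMap c S.stageSheaf).map ⟨l, V.unop⟩ s)) =
      (unitStageMap c S.stageSheaf).map ⟨l, V.unop⟩ s :=
    congrArg (fun b : (stagePullback c).obj S.stageSheaf ⟶ (stagePullback c).obj S.stageSheaf =>
      secMap b.hom _ ((unitStageMap c S.stageSheaf).map ⟨l, V.unop⟩ s)) θ.hom_inv_id
  exact congrArg (secMap ((stagePullback c).map (stageAugmentation S)).hom _) (h₃.symm.trans h₂)

end Limit

end Complexes

end StageResolutions

/-! ### Local cohomology commutes with the limit -/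

section Comparison

variable {L : Type u} [Preorder L] {X : Lᵒᵖ ⥤ RingedSpace.{u, u}} (S : ModuleSystem X)
  {α : L} (Pα : SupportPair (X.obj (op α)).carrier)

/-- The complex of sections with support of the resolution at one of the spaces. -/
abbrev stageComplex (l : Set.Ici α) : CochainComplex AddCommGrpCat.{u} ℕ :=
  ((sectionsWithSupport (stagePair Pα l)).mapHomologicalComplex (ComplexShape.up ℕ)).obj
    (resolutionAt S l.1)

/-- The restriction maps of the complexes of sections with support. -/
def stageComplexMap ⦃l m : Set.Ici α⦄ (h : l ≤ m) : stageComplex S Pα l ⟶ stageComplex S Pα m :=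
  sectionsMap _ (stagePair Pα l) (stagePair Pα m) (stagePair_comap Pα h)
    (resolutionTrans S (l := l.1) (m := m.1) h)

lemma stagePair_le {l m : Set.Ici α} (h : l ≤ m) :
    (⟨m.1, (stagePair Pα m).U⟩ : Stage X) ≤ ⟨l.1, (stagePair Pα l).U⟩ :=
  ⟨h, (congrArg SupportPair.U (stagePair_comap Pα h)).le⟩

lemma supp_stageComplexMap {l m : Set.Ici α} (h : l ≤ m) (n : ℕ)
    (x : (stageComplex S Pα l).X n) :
    supp (stagePair Pα m) _ (((stageComplexMap S Pα h).f n).hom x) =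
      sres ((stageResolution S).cocomplex.X n).obj (stagePair_le Pα h)
        (supp (stagePair Pα l) ((resolutionAt S l.1).X n) x) := by
  refine (supp_sectionsMap _ _ _ _ _ n x).trans ?_
  exact sres_sres ((stageResolution S).cocomplex.X n).obj
    (Stage.mk_le_mk (congrArg SupportPair.U (stagePair_comap Pα h)).le) (Stage.trans_le _ _) _

lemma stageComplexMap_comp ⦃l m n : Set.Ici α⦄ (h : l ≤ m) (h' : m ≤ n) (i : ℕ)
    (x : (stageComplex S Pα l).X i) :
    ((stageComplexMap S Pα h').f i).hom (((stageComplexMap S Pα h).f i).hom x) =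
      ((stageComplexMap S Pα (h.trans h')).f i).hom x := by
  apply supp_injective
  refine (supp_stageComplexMap S Pα h' i _).trans ?_
  refine Eq.trans ?_ (supp_stageComplexMap S Pα (h.trans h') i x).symm
  refine (congrArg (sres _ _) (supp_stageComplexMap S Pα h i x)).trans ?_
  exact sres_sres _ _ _ _

lemma stageComplexMap_refl (l : Set.Ici α) (i : ℕ) (x : (stageComplex S Pα l).X i) :
    ((stageComplexMap S Pα (le_refl l)).f i).hom x = x := by
  apply supp_injective
  refine (supp_stageComplexMap S Pα (le_refl l) i x).trans ?_
  exact sres_refl _ _ _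

section StageCohomology

variable {A : Type w} [Ring A] (ρ : ∀ l : L, A →+* globalSections (X.obj (op l))) (i : ℕ)

/-- The map from the cohomology of the complex of sections with support to local cohomology, at one
of the spaces. -/
def toStageCohomology (l : Set.Ici α) :
    (stageComplex S Pα l).homology i →+ stageCohomology S ρ Pα i l :=
  ((isResolution_resolutionAt S l.1).toRightDerived (sectionsWithSupport (stagePair Pα l)) i).hom

/-- `U_l` and `U_l - Z_l` are preimages of quasi-compact opens, and the resolution at `l` is
quasi-flasque. -/
lemma toStageCohomology_bijective (hX : ∀ l : L, SpectralSpace (X.obj (op l)).carrier)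
    (hv : ∀ (l m : L) (h : l ≤ m), IsSpectralMap (transition X h).hom.base)
    (hUα : IsCompact (Pα.U : Set (X.obj (op α)).carrier))
    (hUZα : IsCompact ((Pα.U : Set (X.obj (op α)).carrier) \ Pα.Z)) (l : Set.Ici α) :
    Function.Bijective (toStageCohomology S Pα ρ i l) := by
  have h := (isAdaptedClass_sectionsWithSupport (hasCompactBasis_of_spectralSpace (hX l.1))
    (stagePair Pα l) (isCompact_transOpens hv l.2 hUα)
    (isCompact_transOpens hv (V := Pα.compl) l.2 hUZα)).isIso_toRightDerived
      isQuasiFlasque_of_injective (isResolution_resolutionAt S l.1)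
      (fun n => isQuasiFlasque_restrictStage _ ((stageResolution S).injective n) l.1) i
  exact ConcreteCategory.bijective_of_isIso ((isResolution_resolutionAt S l.1).toRightDerived
    (sectionsWithSupport (stagePair Pα l)) i)

lemma stageMap_toStageCohomology {l m : Set.Ici α} (h : l ≤ m)
    (z : (stageComplex S Pα l).homology i) :
    stageMap S ρ Pα i l m h (toStageCohomology S Pα ρ i l z) =
      toStageCohomology S Pα ρ i m
        ((HomologicalComplex.homologyMap (stageComplexMap S Pα h) i).hom z) :=
  ConcreteCategory.congr_hom (toRightDerived_localCohomologyMap _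
    (moduleComparison (transition X (l := l.1) (m := m.1) h) (S.map (l := l.1) (m := m.1) h))
    (isResolution_resolutionAt S l.1) (isResolution_resolutionAt S m.1) (resolutionTrans S h)
    (augmentationAt_resolutionTrans S h) (stagePair Pα l) (stagePair Pα m)
    (stagePair_comap Pα h) i) z

lemma stageMap_smul
    (hρ : ∀ (l m : L) (h : l ≤ m), (globalSectionsMap (transition X h)).comp (ρ l) = ρ m)
    {l m : Set.Ici α} (h : l ≤ m) (a : A) (x : stageCohomology S ρ Pα i l) :
    stageMap S ρ Pα i l m h (a • x) = a • stageMap S ρ Pα i l m h x :=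
  pullbackMap_smul _ (hρ l.1 m.1 h) _ _ i a x

lemma limitMap_smul
    (hρ : ∀ (l m : L) (h : l ≤ m), (globalSectionsMap (transition X h)).comp (ρ l) = ρ m)
    {c : Cone X} {P : SupportPair c.pt.carrier}
    (hP : P = Pα.comap (c.π.app (op α)).hom.base) (t : Cocone (S.pulledBack c)) (l : Set.Ici α)
    (a : A) (x : stageCohomology S ρ Pα i l) :
    limitMap S ρ Pα i t hP l (a • x) = a • limitMap S ρ Pα i t hP l x := by
  refine pullbackMap_smul _ ?_ _ _ i a x
  -- The action on the limit is defined through the index `α`; compatibility of `ρ` rewrites it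
  -- through `l`.
  rw [← hρ α l.1 l.2, ← RingHom.comp_assoc]
  exact congrArg (fun k : globalSections _ →+* globalSections c.pt => k.comp (ρ α))
    (globalSectionsMap_comp _ _ _ (proj_transition c (l := α) (m := l.1) l.2))

end StageCohomology

variable [IsDirectedOrder L] [Nonempty L] (c : Cone X)

/-- The complex of sections with support of the resolution on the limit. -/
abbrev limitComplex (P : SupportPair c.pt.carrier) : CochainComplex AddCommGrpCat.{u} ℕ :=
  ((sectionsWithSupport P).mapHomologicalComplex (ComplexShape.up ℕ)).obj (limitResolution c S)

variable {P : SupportPair c.pt.carrier} (hP : P = Pα.comap (c.π.app (op α)).hom.base)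

/-- The maps of complexes of sections with support from the stages to the limit. -/
def limitComplexMap (l : Set.Ici α) : stageComplex S Pα l ⟶ limitComplex S c P :=
  sectionsMap _ (stagePair Pα l) P (hP.trans (stagePair_comap_proj Pα c l))
    (resolutionProj c S l.1)

lemma supp_limitComplexMap (l : Set.Ici α) (n : ℕ) (x : (stageComplex S Pα l).X n) :
    supp P _ (((limitComplexMap S Pα c hP l).f n).hom x) =
      res ((limitResolution c S).X n).obj
        (congrArg SupportPair.U (hP.trans (stagePair_comap_proj Pα c l))).le
        ((unitStageMap c ((stageResolution S).cocomplex.X n)).map ⟨l.1, (stagePair Pα l).U⟩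
          (supp (stagePair Pα l) ((resolutionAt S l.1).X n) x)) :=
  supp_sectionsMap _ _ _ _ _ n x

lemma limitComplexMap_comp ⦃l m : Set.Ici α⦄ (h : l ≤ m) (i : ℕ)
    (x : (stageComplex S Pα l).X i) :
    ((limitComplexMap S Pα c hP m).f i).hom (((stageComplexMap S Pα h).f i).hom x) =
      ((limitComplexMap S Pα c hP l).f i).hom x := by
  apply supp_injective
  refine (supp_limitComplexMap S Pα c hP m i _).trans ?_
  refine Eq.trans ?_ (supp_limitComplexMap S Pα c hP l i x).symm
  have h₁ := (congrArg ((unitStageMap c ((stageResolution S).cocomplex.X i)).map _)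
    (supp_stageComplexMap S Pα h i x)).trans ((unitStageMap c _).map_sres _ _)
  refine (congrArg (res _ _) h₁).trans ?_
  exact res_res _ _ _ _

variable {c}

/-- Vanishing may be tested on underlying sections over the quasi-compact open `U_l`, where
`exists_sres_eq_zero` applies. -/
lemma exists_stageComplexMap_eq_zero (hc : IsLimit c)
    (hX : ∀ l : L, SpectralSpace (X.obj (op l)).carrier)
    (hv : ∀ (l m : L) (h : l ≤ m), IsSpectralMap (transition X h).hom.base)
    (hUα : IsCompact (Pα.U : Set (X.obj (op α)).carrier)) (l : Set.Ici α) (i : ℕ)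
    (x : (stageComplex S Pα l).X i) (hx : ((limitComplexMap S Pα c hP l).f i).hom x = 0) :
    ∃ (m : Set.Ici α) (h : l ≤ m), ((stageComplexMap S Pα h).f i).hom x = 0 := by
  let I := (stageResolution S).cocomplex.X i
  have hη := isPresentation_unitStageMap c (hasStageBasis hc hX hv) I
  let y : I.obj.obj (op ⟨l.1, (stagePair Pα l).U⟩) :=
    supp (stagePair Pα l) ((resolutionAt S l.1).X i) x
  have hy : (unitStageMap c I).map ⟨l.1, (stagePair Pα l).U⟩ y = 0 := by
    have h₁ := (supp_limitComplexMap S Pα c hP l i x).symm.trans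
      ((congrArg (supp P _) hx).trans (map_zero _))
    have h₂ := congrArg (res ((stagePullback c).obj I).obj
      (congrArg SupportPair.U (hP.trans (stagePair_comap_proj Pα c l))).ge) h₁
    refine Eq.trans ?_ (h₂.trans (map_zero _))
    exact ((res_res _ _ _ _).trans (res_refl _ _ _)).symm
  obtain ⟨m, hm, hm'⟩ := hη.exists_sres_eq_zero hc hX hv (isCompact_transOpens hv l.2 hUα) y hy
  refine ⟨⟨m, l.2.trans hm⟩, hm, ?_⟩
  apply supp_injective
  refine (supp_stageComplexMap S Pα (l := l) (m := ⟨m, l.2.trans hm⟩) hm i x).trans ?_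
  refine Eq.trans ?_ (map_zero (supp _ _)).symm
  have k : (⟨m, (stagePair Pα ⟨m, l.2.trans hm⟩).U⟩ : Stage X) ≤
      ⟨m, (transOpens X hm).obj (stagePair Pα l).U⟩ :=
    Stage.mk_le_mk (congrArg SupportPair.U (stagePair_comap Pα (l := l)
      (m := ⟨m, l.2.trans hm⟩) hm)).le
  refine (sres_sres I.obj k (Stage.trans_le hm _) y).symm.trans ?_
  exact (congrArg (sres I.obj k) hm').trans (map_zero _)

/-- The section descends first, by quasi-compactness of `U_α`. Its vanishing off `Z` descends
afterwards, by quasi-compactness of `U_α - Z_α`, so two successive stages are needed. -/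
lemma exists_limitComplexMap_eq (hc : IsLimit c)
    (hX : ∀ l : L, SpectralSpace (X.obj (op l)).carrier)
    (hv : ∀ (l m : L) (h : l ≤ m), IsSpectralMap (transition X h).hom.base)
    (hUα : IsCompact (Pα.U : Set (X.obj (op α)).carrier))
    (hUZα : IsCompact ((Pα.U : Set (X.obj (op α)).carrier) \ Pα.Z)) (i : ℕ)
    (y : (limitComplex S c P).X i) :
    ∃ (l : Set.Ici α) (x : (stageComplex S Pα l).X i),
      ((limitComplexMap S Pα c hP l).f i).hom x = y := by
  subst hP
  let I := (stageResolution S).cocomplex.X i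
  let N := (stagePullback c).obj I
  have hη := isPresentation_unitStageMap c (hasStageBasis hc hX hv) I
  let P := Pα.comap (c.π.app (op α)).hom.base
  let y₀ : N.obj.obj (op ((projOpens c α).obj Pα.U)) := supp P N y
  have hy₀ : res N.obj P.compl_le y₀ = 0 := res_supp P N y
  obtain ⟨m, hm, s, hs⟩ := hη.exists_section_over hc hX hv hUα y₀
  let Pm := stagePair (X := X) Pα ⟨m, hm⟩
  let s' : I.obj.obj (op ⟨m, Pm.compl⟩) :=
    sres I.obj (e := ⟨m, Pm.compl⟩) (e' := ⟨m, (transOpens X hm).obj Pα.U⟩)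
      (Stage.mk_le_mk Pm.compl_le) s
  have hcompl : (stagePreimage c).obj ⟨m, Pm.compl⟩ ≤ P.compl :=
    (projOpens_transOpens c hm Pα.compl).le
  have hs' : (unitStageMap c I).map ⟨m, Pm.compl⟩ s' = 0 := by
    refine ((unitStageMap c I).map_sres _ s).trans ?_
    refine (congrArg (res N.obj _) hs).trans ?_
    refine (res_res _ _ _ y₀).trans ?_
    refine Eq.trans ?_ ((congrArg (res N.obj hcompl) hy₀).trans (map_zero _))
    exact (res_res _ _ _ y₀).symm
  -- At stage `m` the section need not yet have support in the closed set; this holds from stage `n`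
  -- on.
  obtain ⟨n, hn, hn'⟩ := hη.exists_sres_eq_zero hc hX hv (V := Pm.compl)
    (isCompact_transOpens hv (V := Pα.compl) hm hUZα) s' hs'
  let j : Set.Ici α := ⟨m, hm⟩
  let k : Set.Ici α := ⟨n, hm.trans hn⟩
  have hjk : j ≤ k := hn
  let s'' : I.obj.obj (op ⟨n, (stagePair Pα k).U⟩) := sres I.obj (stagePair_le Pα hjk) s
  have hs'' : res ((resolutionAt S n).X i).obj (stagePair Pα k).compl_le s'' = 0 := by
    have e : (⟨n, (stagePair Pα k).compl⟩ : Stage X) ≤ ⟨n, (transOpens X hn).obj Pm.compl⟩ :=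
      Stage.mk_le_mk (congrArg SupportPair.compl (stagePair_comap Pα hjk)).le
    have h₁ : sres I.obj (e.trans ((Stage.trans_le hn Pm.compl).trans
        (Stage.mk_le_mk Pm.compl_le))) s = 0 := by
      refine Eq.trans ?_ ((congrArg (sres I.obj e) hn').trans (map_zero _))
      refine Eq.trans ?_ (sres_sres I.obj e (Stage.trans_le hn Pm.compl) s').symm
      exact (sres_sres I.obj (e.trans (Stage.trans_le hn Pm.compl))
        (Stage.mk_le_mk Pm.compl_le) s).symm
    refine Eq.trans ?_ h₁
    exact sres_sres I.obj (Stage.mk_le_mk (stagePair Pα k).compl_le) (stagePair_le Pα hjk) s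
  obtain ⟨x, hx⟩ := exists_supp_eq (stagePair Pα k) ((resolutionAt S n).X i) s'' hs''
  refine ⟨k, x, ?_⟩
  apply supp_injective
  refine (supp_limitComplexMap S Pα c rfl k i x).trans ?_
  refine (congrArg (fun z => res N.obj _ ((unitStageMap c I).map ⟨n, (stagePair Pα k).U⟩ z))
    hx).trans ?_
  refine (congrArg (res N.obj _) ((unitStageMap c I).map_sres (stagePair_le Pα hjk) s)).trans ?_
  refine (congrArg (fun z => res N.obj _ (res N.obj _ z)) hs).trans ?_
  refine (res_res N.obj _ _ _).trans ?_
  refine (res_res N.obj _ _ _).trans ?_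
  exact res_refl N.obj _ y₀

section Cohomology

variable {A : Type w} [Ring A] (ρ : ∀ l : L, A →+* globalSections (X.obj (op l))) (i : ℕ)

variable {t : Cocone (S.pulledBack c)}
  (θ : (stagePullback c).obj S.stageSheaf ≅ (toAb c.pt).obj t.pt)

/-- The map from the cohomology of the complex of sections with support to local cohomology, on the
limit. -/
def toLimitCohomology (P : SupportPair c.pt.carrier) (α : L) :
    (limitComplex S c P).homology i →+ limitCohomology S ρ i t P α :=
  ((isResolution_limitResolution S θ).toRightDerived (sectionsWithSupport P) i).hom

/-- The pulled-back resolution is not claimed to be injective; quasi-flasqueness suffices for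
quasi-compact support pairs. -/
lemma toLimitCohomology_bijective (hc : IsLimit c)
    (hX : ∀ l : L, SpectralSpace (X.obj (op l)).carrier)
    (hv : ∀ (l m : L) (h : l ≤ m), IsSpectralMap (transition X h).hom.base)
    (P : SupportPair c.pt.carrier) (hU : IsCompact (P.U : Set c.pt.carrier))
    (hUZ : IsCompact ((P.U : Set c.pt.carrier) \ P.Z)) (α : L) :
    Function.Bijective (toLimitCohomology S ρ i θ P α) := by
  have h := (isAdaptedClass_sectionsWithSupport (hasCompactBasis_limit hc hX hv)
    P hU hUZ).isIso_toRightDerived isQuasiFlasque_of_injective (isResolution_limitResolution S θ)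
      (fun n => isQuasiFlasque_stagePullback hc hX hv _ ((stageResolution S).injective n)) i
  exact ConcreteCategory.bijective_of_isIso ((isResolution_limitResolution S θ).toRightDerived
    (sectionsWithSupport P) i)

lemma limitMap_toStageCohomology
    (hθ : ∀ (e : Stage X) (s : S.stagePresheaf.obj (op e)),
        secMap θ.hom.hom _ ((unitStageMap c S.stageSheaf).map e s) =
          cmp (c.π.app (op e.l)) (t.ι.app e.l) e.V s)
    (l : Set.Ici α) (z : (stageComplex S Pα l).homology i) :
    limitMap S ρ Pα i t hP l (toStageCohomology S Pα ρ i l z) =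
      toLimitCohomology S ρ i θ P α
        ((HomologicalComplex.homologyMap (limitComplexMap S Pα c hP l) i).hom z) :=
  ConcreteCategory.congr_hom (toRightDerived_localCohomologyMap _
    (moduleComparison (c.π.app (op l.1)) (t.ι.app l.1))
    (isResolution_resolutionAt S l.1) (isResolution_limitResolution S θ) (resolutionProj c S l.1)
    (augmentationAt_resolutionProj S θ hθ l.1) (stagePair Pα l) P
    (hP.trans (stagePair_comap_proj Pα c l)) i) z

end Cohomology

/-- Local cohomology on the limit is the direct limit of the local cohomology at the stages. -/
theorem exists_linearMaps_bijective_lift [DecidableEq L] (hc : IsLimit c)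
    (hX : ∀ l : L, SpectralSpace (X.obj (op l)).carrier)
    (hv : ∀ (l m : L) (h : l ≤ m), IsSpectralMap (transition X h).hom.base)
    (t : Cocone (S.pulledBack c)) (ht : IsColimit t)
    (hU : IsCompact (P.U : Set c.pt.carrier)) (hUZ : IsCompact ((P.U : Set c.pt.carrier) \ P.Z))
    {A : Type w} [Ring A] (ρ : ∀ l : L, A →+* globalSections (X.obj (op l)))
    (hρ : ∀ (l m : L) (h : l ≤ m), (globalSectionsMap (transition X h)).comp (ρ l) = ρ m)
    (hUα : IsCompact (Pα.U : Set (X.obj (op α)).carrier))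
    (hUZα : IsCompact ((Pα.U : Set (X.obj (op α)).carrier) \ Pα.Z)) (i : ℕ) :
    ∃ (T : ∀ l m : Set.Ici α, l ≤ m →
        stageCohomology S ρ Pα i l →ₗ[A] stageCohomology S ρ Pα i m)
      (τ : ∀ l : Set.Ici α, stageCohomology S ρ Pα i l →ₗ[A] limitCohomology S ρ i t P α),
      (∀ l m h x, T l m h x = stageMap S ρ Pα i l m h x) ∧
      (∀ l x, τ l x = limitMap S ρ Pα i t hP l x) ∧
      DirectedSystem (stageCohomology S ρ Pα i) (fun l m h => T l m h) ∧
      ∃ hτ : ∀ l m h x, τ m (T l m h x) = τ l x,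
        Function.Bijective (Module.DirectLimit.lift A (Set.Ici α)
          (stageCohomology S ρ Pα i) T τ hτ) := by
  obtain ⟨θ, hθ⟩ := exists_stagePullback_iso S hc ht
  have : IsDirectedOrder (Set.Ici α) := ⟨fun l m => by
    obtain ⟨n, hn, hn'⟩ := exists_ge_ge l.1 m.1
    exact ⟨⟨n, l.2.trans hn⟩, hn, hn'⟩⟩
  have : Nonempty (Set.Ici α) := ⟨⟨α, le_refl α⟩⟩
  have hq := toStageCohomology_bijective S Pα ρ i hX hv hUα hUZα
  have hq' := toLimitCohomology_bijective S ρ i θ hc hX hv P hU hUZ α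
  have hinj := exists_homologyMap_eq_zero (stageComplexMap_comp S Pα)
    (limitComplexMap_comp S Pα c hP)
    (exists_stageComplexMap_eq_zero S Pα hP hc hX hv hUα)
    (exists_limitComplexMap_eq S Pα hP hc hX hv hUα hUZα) i
  have hsurj := exists_homologyMap_eq (limitComplexMap_comp S Pα c hP)
    (exists_stageComplexMap_eq_zero S Pα hP hc hX hv hUα)
    (exists_limitComplexMap_eq S Pα hP hc hX hv hUα hUZα) i
  have hcomp {l m n : Set.Ici α} (h : l ≤ m) (h' : m ≤ n) :
      stageComplexMap S Pα h ≫ stageComplexMap S Pα h' = stageComplexMap S Pα (h.trans h') := by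
    ext j x
    exact stageComplexMap_comp S Pα h h' j x
  have hrefl (l : Set.Ici α) : stageComplexMap S Pα (le_refl l) = 𝟙 _ := by
    ext j x
    exact stageComplexMap_refl S Pα l j x
  have hcomp' {l m : Set.Ici α} (h : l ≤ m) :
      stageComplexMap S Pα h ≫ limitComplexMap S Pα c hP m = limitComplexMap S Pα c hP l := by
    ext j x
    exact limitComplexMap_comp S Pα c hP h j x
  let T (l m : Set.Ici α) (h : l ≤ m) :
      stageCohomology S ρ Pα i l →ₗ[A] stageCohomology S ρ Pα i m :=
    { toFun := stageMap S ρ Pα i l m h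
      map_add' := map_add _
      map_smul' := stageMap_smul S Pα ρ i hρ h }
  let τ (l : Set.Ici α) : stageCohomology S ρ Pα i l →ₗ[A] limitCohomology S ρ i t P α :=
    { toFun := limitMap S ρ Pα i t hP l
      map_add' := map_add _
      map_smul' := limitMap_smul S Pα ρ i hρ hP t l }
  have hT (l m : Set.Ici α) (h : l ≤ m) (z : (stageComplex S Pα l).homology i) :
      T l m h (toStageCohomology S Pα ρ i l z) = toStageCohomology S Pα ρ i m
        ((HomologicalComplex.homologyMap (stageComplexMap S Pα h) i).hom z) :=
    stageMap_toStageCohomology S Pα ρ i h z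
  have hτ (l : Set.Ici α) (z : (stageComplex S Pα l).homology i) :
      τ l (toStageCohomology S Pα ρ i l z) = toLimitCohomology S ρ i θ P α
        ((HomologicalComplex.homologyMap (limitComplexMap S Pα c hP l) i).hom z) :=
    limitMap_toStageCohomology S Pα hP ρ i θ hθ l z
  -- Every class comes from the complex of the chosen resolution, so identities between the maps are
  -- checked on complexes, where they hold strictly.
  have hτT (l m : Set.Ici α) (h : l ≤ m) (x : stageCohomology S ρ Pα i l) :
      τ m (T l m h x) = τ l x := by
    obtain ⟨z, rfl⟩ := (hq l).2 x
    rw [hT, hτ, hτ, ← hcomp' h, HomologicalComplex.homologyMap_comp]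
    rfl
  refine ⟨T, τ, fun _ _ _ _ => rfl, fun _ _ => rfl, ⟨?_, ?_⟩, hτT, ?_, ?_⟩
  · intro l x
    obtain ⟨z, rfl⟩ := (hq l).2 x
    refine (hT l l _ z).trans ?_
    rw [hrefl, HomologicalComplex.homologyMap_id]
    rfl
  · intro l m n h h' x
    obtain ⟨z, rfl⟩ := (hq n).2 x
    refine (congrArg (T _ _ _) (hT _ _ _ z)).trans ((hT _ _ _ _).trans (Eq.trans ?_ (hT _ _ _ z).symm))
    rw [← hcomp h h', HomologicalComplex.homologyMap_comp]
    rfl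
  -- A class at stage `l` dying in the limit dies at a later stage by `hinj`, and is therefore zero
  -- in the direct limit.
  · rw [injective_iff_map_eq_zero]
    intro x hx
    obtain ⟨l, y, rfl⟩ := Module.DirectLimit.exists_of x
    rw [Module.DirectLimit.lift_of] at hx
    obtain ⟨z, rfl⟩ := (hq l).2 y
    rw [hτ] at hx
    obtain ⟨m, h, hz⟩ := hinj l z (hq'.1 (hx.trans (map_zero _).symm))
    rw [← Module.DirectLimit.of_f (hij := h), hT, hz, map_zero, map_zero]
  · intro y
    obtain ⟨w, rfl⟩ := hq'.2 y
    obtain ⟨l, z, rfl⟩ := hsurj w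
    exact ⟨Module.DirectLimit.of A _ _ _ l (toStageCohomology S Pα ρ i l z),
      (Module.DirectLimit.lift_of _ _ _).trans (hτ l z)⟩

end Comparison

end LocalCohomologyLimits

end

theorem mainTheorem6 {L : Type u} [Preorder L] [IsDirectedOrder L] [Nonempty L] [DecidableEq L]
    (X : Lᵒᵖ ⥤ RingedSpace.{u})
    (hX : ∀ l : L, SpectralSpace (X.obj (op l)).carrier)
    (hv : ∀ (l m : L) (h : l ≤ m), IsSpectralMap (transition X h).hom.base)
    (c : Cone X) (hc : IsLimit c)
    (S : ModuleSystem X) (t : Cocone (S.pulledBack c)) (ht : IsColimit t)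
    (P : SupportPair c.pt.carrier) (hU : IsCompact (P.U : Set c.pt.carrier))
    (hUZ : IsCompact ((P.U : Set c.pt.carrier) \ P.Z)) :
    (∃ (α : L) (Pα : SupportPair (X.obj (op α)).carrier),
      IsCompact (Pα.U : Set (X.obj (op α)).carrier) ∧
      IsCompact ((Pα.U : Set (X.obj (op α)).carrier) \ Pα.Z) ∧
      P = Pα.comap (c.π.app (op α)).hom.base) ∧
    (∀ (A : Type w) [Ring A] (ρ : ∀ l : L, A →+* globalSections (X.obj (op l)))
      (hρ : ∀ (l m : L) (h : l ≤ m), (globalSectionsMap (transition X h)).comp (ρ l) = ρ m)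
      (α : L) (Pα : SupportPair (X.obj (op α)).carrier)
      (hUα : IsCompact (Pα.U : Set (X.obj (op α)).carrier))
      (hUZα : IsCompact ((Pα.U : Set (X.obj (op α)).carrier) \ Pα.Z))
      (hP : P = Pα.comap (c.π.app (op α)).hom.base) (i : ℕ),
      ∃ (T : ∀ l m : Set.Ici α, l ≤ m →
          stageCohomology S ρ Pα i l →ₗ[A] stageCohomology S ρ Pα i m)
        (τ : ∀ l : Set.Ici α, stageCohomology S ρ Pα i l →ₗ[A] limitCohomology S ρ i t P α),
        (∀ l m h x, T l m h x = stageMap S ρ Pα i l m h x) ∧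
        (∀ l x, τ l x = limitMap S ρ Pα i t hP l x) ∧
        DirectedSystem (stageCohomology S ρ Pα i) (fun l m h => T l m h) ∧
        ∃ hτ : ∀ l m h x, τ m (T l m h x) = τ l x,
          Function.Bijective (Module.DirectLimit.lift A (Set.Ici α)
            (stageCohomology S ρ Pα i) T τ hτ)) := by
  refine ⟨exists_stage_supportPair hc hX hv P hU hUZ, ?_⟩
  intro A _ ρ hρ α Pα hUα hUZα hP i
  exact exists_linearMaps_bijective_lift S Pα hP hc hX hv t ht hU hUZ ρ hρ hUα hUZα i
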